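/- Let $q\ge 5$ be an integer, $S=\{1,\dots,q\}$, and let $\Xi=\{x\in[0,1]^q: x_1+\dots+x_q=1\}$. For $\beta>0$ put $$F_\beta(x)=-\frac12\sum_{k=1}^q x_k^2+\frac1\beta\sum_{k=1}^q x_k\log x_k\qquad(x\in\Xi,\ 0\log 0=0).$$ For $i\in\{1,2\}$ let $g_i:(0,\tfrac1{q-i})\to\mathbb R$, $g_i(t)=\frac{i}{1-qt}\log\frac{1-(q-i)t}{it}$ for $t\neq\frac1q$, $g_i(\frac1q)=q$, and let $\beta_{s,i}=\min g_i$. For $\beta\ge\beta_{s,i}$ let $u_i(\beta)\le v_i(\beta)$ be the smallest and the largest solution of $g_i(t)=\beta$ (there are at most two). Let $\mathbf p=(\frac1q,\dots,\frac1q)$; for $k\in S$ let $\mathbf u_1^k$ (resp. $\mathbf v_1^k$) be the point whose $k$-th coordinate is $1-(q-1)t$ and whose other coordinates are $t$, with $t=u_1(\beta)$ (resp. $t=v_1(\beta)$); for $k\ne l$ in $S$ let $\mathbf u_2^{k,l}$ be the point whose $k$-th and $l$-th coordinates are $\frac{1-(q-2)u_2(\beta)}2$ and whose other coordinates are $u_2(\beta)$.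 By symmetry $F_\beta(\mathbf v_1):=F_\beta(\mathbf v_1^k)$ and $F_\beta(\mathbf u_2):=F_\beta(\mathbf u_2^{k,l})$ do not depend on $k,l$. Put $\mathcal U_1=\{\mathbf u_1^k:k\in S\}$, $\mathcal V_1=\{\mathbf v_1^k:k\in S\}$. Let $\beta_1=\beta_{s,1}$ and $\beta_3=\inf\{\beta\ge\beta_{s,2}: F_\beta(\mathbf u_2)\le F_\beta(\mathbf v_1)\}$. For $\beta>\beta_1$ let $H_\beta=F_\beta(\mathbf v_1)$ if $\beta<\beta_3$ and $H_\beta=F_\beta(\mathbf u_2)$ if $\beta\ge\beta_3$. For $k\in S$ let $\mathcal W_k$ be the connected component of $\{F_\beta<H_\beta\}\subseteq\Xi$ containing $\mathbf u_1^k$, and let $\mathcal W_{\mathfrak o}$ be the connected component of $\{F_\beta<F_\beta(\mathbf v_1)\}\subseteq\Xi$ containing $\mathbf p$; such a set is empty if the point is not in the sublevel set. For $k,l\in\widehat S:=S\cup\{\mathfrak o\}$ let $\Sigma_{k,l}=\overline{\mathcal W_k}\cap\overline{\mathcal W_l}$. A saddle point of $F_\beta$ is a critical point in the interior of $\Xi$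 at which the Hessian (on directions of zero coordinate sum) has exactly one negative eigenvalue, counted with multiplicity. Theorem. We have $\beta_1<\beta_{s,2}<\beta_3$, and $F_\beta(\mathbf v_1)<F_\beta(\mathbf u_2)$ for $\beta_{s,2}\le\beta<\beta_3$, $F_\beta(\mathbf v_1)=F_\beta(\mathbf u_2)$ for $\beta=\beta_3$, $F_\beta(\mathbf v_1)>F_\beta(\mathbf u_2)$ for $\beta_3<\beta\le q$. Moreover: 1. $\beta_3<q$. 2. For $\beta\in(\beta_1,\beta_3)$ the sets $\mathcal W_k$, $k\in\widehat S$, are nonempty and pairwise disjoint; $\Sigma_{k,l}=\emptyset$ for all $k\ne l$ in $S$, and $\Sigma_{\mathfrak o,k}=\{\mathbf v_1^k\}$ for all $k\in S$. 3. For $\beta=\beta_3$ the sets $\mathcal W_k$, $k\in\widehat S$, are nonempty and pairwise disjoint; $\Sigma_{k,l}=\{\mathbf u_2^{k,l}\}$ for all $k\ne l$ in $S$, and $\Sigma_{\mathfrak o,k}=\{\mathbf v_1^k\}$ for all $k\in S$. 4. For $\beta\in(\beta_3,\infty)$ the sets $\mathcal W_k$, $k\in S$, are nonempty and pairwise disjoint;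 $\Sigma_{k,l}=\{\mathbf u_2^{k,l}\}$ for all $k\ne l$ in $S$, and $\Sigma_{\mathfrak o,k}=\emptyset$ for all $k\in S$. 5. For $\beta\in(\beta_3,q)$ we have $F_\beta(\mathbf v_1)>H_\beta$. The set $\{F_\beta<F_\beta(\mathbf v_1)\}$ has exactly two connected components: the well $\mathcal W_{\mathfrak o}$, and another one, $\mathcal C$, which contains $\mathcal U_1$. The gates between them are $\overline{\mathcal W_{\mathfrak o}}\cap\overline{\mathcal C}=\mathcal V_1$, and every element of $\mathcal V_1$ is a saddle point of $F_\beta$. -/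

import Mathlib

noncomputable section

namespace CurieWeissPotts

/-- The potential `F_β` of the Curie–Weiss–Potts model with `q` spins and no external field,
`F_β(x) = -(1/2) ∑ x_k² + (1/β) ∑ x_k log x_k`. A point of the simplex is written with all of its
`q` coordinates; `0 log 0 = 0`. -/
def potential {q : ℕ} (β : ℝ) (x : Fin q → ℝ) : ℝ :=
  -(1 / 2) * ∑ k, x k ^ 2 + (1 / β) * ∑ k, x k * Real.log (x k)

/-- The interval `(0, 1/(q-i))`, on which `g_i` is considered. -/
def gDomain (q i : ℕ) : Set ℝ := Set.Ioo 0 (1 / ((q : ℝ) - i))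

/-- `g_i(t) = i/(1-qt) * log ((1-(q-i)t)/(it))`, extended by continuity by `g_i(1/q) = q`. -/
def g (q i : ℕ) (t : ℝ) : ℝ :=
  if t = 1 / (q : ℝ) then (q : ℝ)
  else (i : ℝ) / (1 - q * t) * Real.log ((1 - ((q : ℝ) - i) * t) / (i * t))

/-- `β_{s,i}`, the minimal value of `g_i`. -/
def betaS (q i : ℕ) : ℝ := sInf (g q i '' gDomain q i)

/-- `u_i(β)`, the smaller solution of `g_i(t) = β` (there are one or two for `β ≥ β_{s,i}`). -/
def uSol (q i : ℕ) (β : ℝ) : ℝ := sInf {t | t ∈ gDomain q i ∧ g q i t = β}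

/-- `v_i(β)`, the larger solution of `g_i(t) = β`, equal to `u_i(β)` if there is only one. -/
def vSol (q i : ℕ) (β : ℝ) : ℝ := sSup {t | t ∈ gDomain q i ∧ g q i t = β}

/-- The point with coordinate `(1-(q-i)t)/i` at each of the `i` spins in `A` and `t` at all others. -/
def twoValued {q : ℕ} (A : Finset (Fin q)) (t : ℝ) : Fin q → ℝ := fun m =>
  if m ∈ A then (1 - ((q : ℝ) - A.card) * t) / A.card else t

/-- The set of the last `i` spins. -/
def lastSpins (q i : ℕ) : Finset (Fin q) := Finset.univ.filter fun m => q ≤ (m : ℕ) + i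

/-- `p = (1/q, …, 1/q)`. -/
def pPoint (q : ℕ) : Fin q → ℝ := fun _ => 1 / (q : ℝ)

/-- `u_1^k`. -/
def u1Point {q : ℕ} (β : ℝ) (k : Fin q) : Fin q → ℝ := twoValued {k} (uSol q 1 β)

/-- `v_1^k`. -/
def v1Point {q : ℕ} (β : ℝ) (k : Fin q) : Fin q → ℝ := twoValued {k} (vSol q 1 β)

/-- `u_2^{k,l}`, for `k ≠ l`. -/
def u2Point {q : ℕ} (β : ℝ) (k l : Fin q) : Fin q → ℝ := twoValued {k, l} (uSol q 2 β)

/-- The set `𝒰_1` of all `u_1^k`. -/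
def U1 (q : ℕ) (β : ℝ) : Set (Fin q → ℝ) := Set.range fun k => u1Point β k

/-- The set `𝒱_1` of all `v_1^k`. -/
def V1 (q : ℕ) (β : ℝ) : Set (Fin q → ℝ) := Set.range fun k => v1Point β k

/-- `F_β(v_1)` with the representative `v_1 = v_1^q`. -/
def heightV1 (q : ℕ) (β : ℝ) : ℝ := potential β (twoValued (lastSpins q 1) (vSol q 1 β))

/-- `F_β(u_2)` with the representative `u_2 = u_2^{q-1,q}`. -/
def heightU2 (q : ℕ) (β : ℝ) : ℝ := potential β (twoValued (lastSpins q 2) (uSol q 2 β))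

/-- The first critical temperature. -/
def beta1 (q : ℕ) : ℝ := betaS q 1

/-- The third critical temperature (`q ≥ 5`): the first `β ≥ β_{s,2}`, i.e. the first `β` among
those for which `u_2` exists, at which `F_β(u_2)` is no longer above `F_β(v_1)`. -/
def beta3 (q : ℕ) : ℝ := sInf {β | betaS q 2 ≤ β ∧ heightU2 q β ≤ heightV1 q β}

/-- `H_β`, the height of the lowest saddle points, for `β > β_1`. -/
def height (q : ℕ) (β : ℝ) : ℝ := if β < beta3 q then heightV1 q β else heightU2 q β

/-- `{F_β < c}`, as a subset of the simplex. -/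
def sublevel (q : ℕ) (β c : ℝ) : Set (Fin q → ℝ) :=
  {x | x ∈ stdSimplex ℝ (Fin q) ∧ potential β x < c}

/-- The wells `𝒲_k`, `k ∈ S ∪ {𝔬}`, with `none` for `𝔬`: the component of `{F_β < F_β(v_1)}`
that contains `p`, and the component of `{F_β < H_β}` that contains `u_1^k`. A well is empty if its
point does not belong to the sublevel set. -/
def well {q : ℕ} (β : ℝ) : Option (Fin q) → Set (Fin q → ℝ)
  | none => connectedComponentIn (sublevel q β (heightV1 q β)) (pPoint q)
  | some k => connectedComponentIn (sublevel q β (height q β)) (u1Point β k)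

/-- The gates `Σ_{k,l}`. -/
def gate {q : ℕ} (β : ℝ) (k l : Option (Fin q)) : Set (Fin q → ℝ) :=
  closure (well β k) ∩ closure (well β l)

/-- The set of connected components of `A`. -/
def components {X : Type*} [TopologicalSpace X] (A : Set X) : Set (Set X) :=
  {C | ∃ x ∈ A, C = connectedComponentIn A x}

/-- The quadratic form of the Hessian of `F_β` at `x`, in the direction `w`. -/
def hessian {q : ℕ} (β : ℝ) (x w : Fin q → ℝ) : ℝ :=
  iteratedDeriv 2 (fun s : ℝ => potential β (x + s • w)) 0

/-- `x` is a saddle point of `F_β` on the simplex: an interior critical point at which the Hessian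
has exactly one negative eigenvalue, counted with multiplicity, i.e. the largest dimension of a
space of tangent directions on which it is negative definite is one. -/
def IsSaddlePoint {q : ℕ} (β : ℝ) (x : Fin q → ℝ) : Prop :=
  x ∈ stdSimplex ℝ (Fin q) ∧ (∀ k, 0 < x k) ∧
  (∀ w : Fin q → ℝ, ∑ k, w k = 0 → deriv (fun s : ℝ => potential β (x + s • w)) 0 = 0) ∧
  IsGreatest {d : ℕ | ∃ V : Submodule ℝ (Fin q → ℝ), Module.finrank ℝ V = d ∧
    ∀ w ∈ V, ∑ k, w k = 0 ∧ (w ≠ 0 → hessian β x w < 0)} 1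

end CurieWeissPotts

end

/-! The potential is a sum of one-coordinate functions `phi`, and the slope `dphi` increases
strictly up to `1 / β` and decreases strictly afterwards. Each slope is therefore taken at most
twice, once on either side of `1 / β`. At a local minimum on the simplex all coordinates are
positive and have equal slope, and two coordinates above `1 / β` cannot coexist, since splitting
them lowers the concave contribution. So a local minimum is `p` or a point with one large
coordinate; the equal-slope condition for `i` large coordinates reads `g_i(t) = β`, and the shape of
`g_i` (down, then up) gives the two branches `u_i`, `v_i`.

The wells are separated by two kinds of barrier. Let `c` be the upper value of `v_1` (`threshold`;
for `β ≥ q` it is `1 / q`). On the surface where the largest coordinate equals `c`, a tangent-line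
inequality for `phi` gives `F ≥ F(v_1)` when `β < q`, with equality only at the `v_1^k`
(`fLine_le_potential`). On the set where two coordinates tie for the maximum and are at least `c`, a
minimiser is either on the surface or is a critical point of the constrained problem, and the lowest
candidate of the second kind is `u_2^{k,l}` (`tieSet_lower_bound`). Hence `{F < H}` does not meet
the relative boundary of the region where `k` is the strict maximum above `c`. By compactness every
component of a sublevel set contains a local minimum (`exists_isLocalMinOn`), and `u_1^k` is the
only one available in that region. Points common to two closures are forced to be equality cases of
the barrier estimates; conversely `v_1^k` is reached along the segment through `p` and `u_1^k`, and
`u_2^{k,l}` by breaking its tie.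

The order of the heights comes from an envelope argument. The `β`-derivative of `β F` at a critical
point is minus half the sum of squares of its coordinates, which is larger at `u_2` than at `v_1`;
so `β (F(u_2) - F(v_1))` decreases strictly on `[β_{s,2}, q]`. It is positive at the left end and
negative at `q`, and `β_3` is its zero (`heightGap_bounds`, `beta3_spec`).

Between `β_3` and `q` the outer wells join through the points `u_2^{k,l}` below the level `F(v_1)`,
while the surface of height at least `F(v_1)` still encloses `p`. This leaves two components,
touching exactly at the `v_1^k`. -/

namespace CurieWeissPotts

/-! ### The one-coordinate function and its slope -/

/-- The one-coordinate contribution to the potential. -/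
noncomputable def phi (β s : ℝ) : ℝ := -(1 / 2) * s ^ 2 + (1 / β) * (s * Real.log s)

/-- The derivative of `phi`. -/
noncomputable def dphi (β s : ℝ) : ℝ := -s + (1 / β) * (Real.log s + 1)

lemma potential_eq_sum {q : ℕ} (β : ℝ) (x : Fin q → ℝ) : potential β x = ∑ k, phi β (x k) := by
  simp only [potential, phi, Finset.sum_add_distrib, Finset.mul_sum]

lemma continuous_phi (β : ℝ) : Continuous (phi β) := by
  unfold phi
  exact (continuous_const.mul (continuous_id.pow 2)).add
    (continuous_const.mul Real.continuous_mul_log)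

lemma continuous_potential {q : ℕ} (β : ℝ) : Continuous (potential β : (Fin q → ℝ) → ℝ) := by
  have : (potential β : (Fin q → ℝ) → ℝ) = fun x => ∑ k, phi β (x k) := by
    ext x; exact potential_eq_sum β x
  rw [this]
  exact continuous_finsetSum _ fun k _ => (continuous_phi β).comp (continuous_apply k)

lemma hasDerivAt_phi (β : ℝ) {s : ℝ} (hs : s ≠ 0) : HasDerivAt (phi β) (dphi β s) s := by
  have h1 := (hasDerivAt_pow 2 s).const_mul (-(1 / 2) : ℝ)
  have h2 := (Real.hasDerivAt_mul_log hs).const_mul (1 / β)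
  refine (h1.add h2).congr_deriv ?_
  simp only [dphi]; push_cast; ring

lemma hasDerivAt_dphi (β : ℝ) {s : ℝ} (hs : s ≠ 0) :
    HasDerivAt (dphi β) (1 / (β * s) - 1) s := by
  have h2 := ((Real.hasDerivAt_log hs).add_const 1).const_mul (1 / β)
  refine ((hasDerivAt_id s).neg.add h2).congr_deriv ?_
  rw [one_div_mul_eq_div, one_div, mul_inv]; field_simp; ring

lemma dphi_strictMonoOn {β : ℝ} (hβ : 0 < β) : StrictMonoOn (dphi β) (Set.Ioc 0 (1 / β)) := by
  refine strictMonoOn_of_deriv_pos (convex_Ioc _ _) ?_ ?_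
  · intro s hs
    exact (hasDerivAt_dphi β hs.1.ne').continuousAt.continuousWithinAt
  · intro s hs
    rw [interior_Ioc] at hs
    rw [(hasDerivAt_dphi β hs.1.ne').deriv, sub_pos, lt_div_iff₀ (mul_pos hβ hs.1)]
    have := (lt_div_iff₀ hβ).1 hs.2
    linarith

lemma dphi_strictAntiOn {β : ℝ} (hβ : 0 < β) : StrictAntiOn (dphi β) (Set.Ici (1 / β)) := by
  have hb : 0 < 1 / β := by positivity
  refine strictAntiOn_of_deriv_neg (convex_Ici _) ?_ ?_
  · intro s hs
    exact (hasDerivAt_dphi β (hb.trans_le hs).ne').continuousAt.continuousWithinAt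
  · intro s hs
    rw [interior_Ici] at hs
    have h0 : 0 < s := hb.trans hs
    rw [(hasDerivAt_dphi β h0.ne').deriv, sub_neg, div_lt_iff₀ (mul_pos hβ h0)]
    have := (div_lt_iff₀ hβ).1 hs
    linarith

/-- Two points with the same slope lie on different sides of `1 / β`. -/
lemma dphi_eq_sides {β a b : ℝ} (hβ : 0 < β) (ha : 0 < a) (hab : a < b)
    (h : dphi β a = dphi β b) : a < 1 / β ∧ 1 / β < b := by
  constructor
  · by_contra hc
    push Not at hc
    exact (dphi_strictAntiOn hβ hc (hc.trans hab.le) hab).ne h.symm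
  · by_contra hc
    push Not at hc
    exact (dphi_strictMonoOn hβ ⟨ha, hab.le.trans hc⟩ ⟨ha.trans hab, hc⟩ hab).ne h

/-- Conjugate points: a larger upper point belongs to a smaller lower point. -/
lemma dphi_conj_lt {β a b a' b' : ℝ} (hβ : 0 < β) (ha : 0 < a) (hab : a < b)
    (h : dphi β a = dphi β b) (ha' : 0 < a') (hab' : a' < b') (h' : dphi β a' = dphi β b')
    (haa : a < a') : b' < b := by
  obtain ⟨h1, h2⟩ := dphi_eq_sides hβ ha hab h
  obtain ⟨h3, h4⟩ := dphi_eq_sides hβ ha' hab' h'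
  have := dphi_strictMonoOn hβ ⟨ha, h1.le⟩ ⟨ha', h3.le⟩ haa
  rw [h, h'] at this
  exact ((dphi_strictAntiOn hβ).lt_iff_gt h2.le h4.le).1 this

/-- The tangent inequality: `t` minimises `phi - phi'(t) s` on `[0, c]` if `c > t` has the same
slope as `t`. -/
lemma phi_tangent {β t c s : ℝ} (hβ : 0 < β) (ht : 0 < t) (htc : t < c)
    (h : dphi β t = dphi β c) (hs0 : 0 ≤ s) (hsc : s ≤ c) (hst : s ≠ t) :
    phi β t - dphi β t * t < phi β s - dphi β t * s := by
  obtain ⟨h1, h2⟩ := dphi_eq_sides hβ ht htc h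
  set ψ : ℝ → ℝ := fun s => phi β s - dphi β t * s with hψ
  have hcont : Continuous ψ := (continuous_phi β).sub (continuous_const.mul continuous_id)
  have hder : ∀ s, s ≠ 0 → HasDerivAt ψ (dphi β s - dphi β t) s := by
    intro s hs
    exact ((hasDerivAt_phi β hs).sub ((hasDerivAt_id s).const_mul (dphi β t))).congr_deriv (by simp)
  have hanti : StrictAntiOn ψ (Set.Icc 0 t) := by
    refine strictAntiOn_of_deriv_neg (convex_Icc _ _) hcont.continuousOn ?_
    intro s hs
    rw [interior_Icc] at hs
    rw [(hder s hs.1.ne').deriv, sub_neg]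
    exact dphi_strictMonoOn hβ ⟨hs.1, (hs.2.trans h1).le⟩ ⟨ht, h1.le⟩ hs.2
  have hmono : StrictMonoOn ψ (Set.Icc t c) := by
    refine strictMonoOn_of_deriv_pos (convex_Icc _ _) hcont.continuousOn ?_
    intro s hs
    rw [interior_Icc] at hs
    rw [(hder s (ht.trans hs.1).ne').deriv, sub_pos]
    rcases le_total s (1 / β) with hsb | hsb
    · exact dphi_strictMonoOn hβ ⟨ht, h1.le⟩ ⟨ht.trans hs.1, hsb⟩ hs.1
    · rw [h]; exact dphi_strictAntiOn hβ hsb h2.le hs.2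
  rcases lt_or_gt_of_ne hst with hlt | hgt
  · exact hanti ⟨hs0, hlt.le⟩ ⟨ht.le, le_rfl⟩ hlt
  · exact hmono ⟨le_rfl, htc.le⟩ ⟨hgt.le, hsc⟩ hgt

/-! ### Exchange of mass between coordinates -/

/-- The mass `s` is moved to a coordinate `a` from a coordinate `b` of weight `n`. -/
lemma hasDerivAt_transfer (β : ℝ) {n a b : ℝ} (hn : n ≠ 0) {s : ℝ} (ha : a + s ≠ 0)
    (hb : b - s / n ≠ 0) :
    HasDerivAt (fun s => phi β (a + s) + n * phi β (b - s / n))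
      (dphi β (a + s) - dphi β (b - s / n)) s := by
  have h1 : HasDerivAt (fun s : ℝ => a + s) 1 s := (hasDerivAt_id s).const_add a
  have h2 : HasDerivAt (fun s : ℝ => b - s / n) (-(1 / n)) s := by
    simpa using ((hasDerivAt_id s).div_const n).const_sub b
  have h3 := (hasDerivAt_phi β ha).comp s h1
  have h4 := ((hasDerivAt_phi β hb).comp s h2).const_mul n
  refine (h3.add h4).congr_deriv ?_
  field_simp
  ring

/-- Moving mass to a coordinate at the boundary lowers the potential, as does moving mass down
the slope. -/
lemma transfer_lt {β n a b : ℝ} (hβ : 0 < β) (hn : 0 < n) (hb : 0 < b)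
    (h : a = 0 ∨ 0 < a ∧ dphi β a < dphi β b) :
    ∀ᶠ s in nhdsWithin (0 : ℝ) (Set.Ioi 0),
      phi β (a + s) + n * phi β (b - s / n) < phi β a + n * phi β b := by
  have ha : 0 ≤ a := by rcases h with h | h <;> [exact h.ge; exact h.1.le]
  have hcb : Filter.Tendsto (fun s : ℝ => b - s / n) (nhds 0) (nhds b) := by
    have : Continuous fun s : ℝ => b - s / n := by fun_prop
    simpa using this.tendsto 0
  have hdb : Filter.Tendsto (fun s : ℝ => dphi β (b - s / n)) (nhds 0) (nhds (dphi β b)) :=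
    (hasDerivAt_dphi β hb.ne').continuousAt.tendsto.comp hcb
  have hca : Filter.Tendsto (fun s : ℝ => a + s) (nhds 0) (nhds a) := by
    have : Continuous fun s : ℝ => a + s := by fun_prop
    simpa using this.tendsto 0
  have hneg : ∀ᶠ s in nhdsWithin (0 : ℝ) (Set.Ioi 0),
      dphi β (a + s) - dphi β (b - s / n) < 0 ∧ 0 < b - s / n := by
    have hpos : ∀ᶠ s in nhdsWithin (0 : ℝ) (Set.Ioi 0), 0 < b - s / n :=
      (hcb.mono_left nhdsWithin_le_nhds).eventually (lt_mem_nhds hb)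
    rcases h with h | ⟨h0, h⟩
    -- At an empty coordinate the entropy has slope `-∞`, which beats any finite slope at `b`.
    · have hlog : Filter.Tendsto (fun s => dphi β s) (nhdsWithin (0 : ℝ) (Set.Ioi 0))
          Filter.atBot := by
        have h1 : Filter.Tendsto (fun s : ℝ => -s) (nhdsWithin (0 : ℝ) (Set.Ioi 0)) (nhds 0) := by
          have : Continuous fun s : ℝ => -s := by fun_prop
          simpa using (this.tendsto 0).mono_left nhdsWithin_le_nhds
        have h2 : Filter.Tendsto (fun s : ℝ => (1 / β) * (Real.log s + 1))
            (nhdsWithin (0 : ℝ) (Set.Ioi 0)) Filter.atBot :=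
          (Filter.tendsto_atBot_add_const_right _ _
            Real.tendsto_log_nhdsGT_zero).const_mul_atBot (by positivity)
        exact h1.add_atBot h2
      have e1 := hlog.eventually (Filter.eventually_lt_atBot (dphi β b - 1))
      have e2 := (hdb.mono_left (nhdsWithin_le_nhds (s := Set.Ioi 0))).eventually
        (lt_mem_nhds (sub_one_lt (dphi β b)))
      filter_upwards [e1, e2, hpos] with s h1 h2 h3
      refine ⟨?_, h3⟩
      rw [h, zero_add]; linarith
    · have e1 := ((hasDerivAt_dphi β h0.ne').continuousAt.tendsto.comp hca).sub hdb
      have e2 := (e1.mono_left (nhdsWithin_le_nhds (s := Set.Ioi 0))).eventually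
        (gt_mem_nhds (sub_neg.2 h))
      filter_upwards [e2, hpos] with s h1 h2
      exact ⟨h1, h2⟩
  obtain ⟨ε, hε, hsub⟩ := mem_nhdsGT_iff_exists_Ioo_subset.1 hneg
  filter_upwards [Ioo_mem_nhdsGT hε] with s hs
  have hanti : StrictAntiOn (fun s => phi β (a + s) + n * phi β (b - s / n)) (Set.Icc 0 s) := by
    refine strictAntiOn_of_deriv_neg (convex_Icc _ _) ?_ ?_
    · have := continuous_phi β
      fun_prop
    · intro r hr
      rw [interior_Icc] at hr
      obtain ⟨h1, h2⟩ := hsub ⟨hr.1, hr.2.trans hs.2⟩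
      rw [(hasDerivAt_transfer β hn.ne' (add_pos_of_nonneg_of_pos ha hr.1).ne' h2.ne').deriv]
      exact h1
  simpa using hanti ⟨le_rfl, hs.1.le⟩ ⟨hs.1.le, le_rfl⟩ hs.1

/-- Splitting equal coordinates in the concave region lowers the potential. -/
lemma split_lt {β n a : ℝ} (hβ : 0 < β) (hn : 0 < n) (ha : 1 / β < a) :
    ∀ᶠ s in nhdsWithin (0 : ℝ) (Set.Ioi 0),
      phi β (a - s) + n * phi β (a + s / n) < phi β a + n * phi β a := by
  have hb : 0 < 1 / β := by positivity
  have hlim : Filter.Tendsto (fun s : ℝ => a - s) (nhdsWithin 0 (Set.Ioi 0)) (nhds a) := by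
    have : Continuous fun s : ℝ => a - s := by fun_prop
    simpa using (this.tendsto 0).mono_left nhdsWithin_le_nhds
  filter_upwards [hlim.eventually (lt_mem_nhds ha), self_mem_nhdsWithin] with s hs hs0
  have hs0 : 0 < s := hs0
  have hcont : ∀ r ∈ Set.Icc 0 s, 1 / β < a - r := fun r hr => by linarith [hr.2]
  have hanti : StrictAntiOn (fun s => phi β (a - s) + n * phi β (a + s / n)) (Set.Icc 0 s) := by
    refine strictAntiOn_of_deriv_neg (convex_Icc _ _) ?_ ?_
    · have := continuous_phi β
      fun_prop
    · intro r hr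
      rw [interior_Icc] at hr
      have h1 := hcont r ⟨hr.1.le, hr.2.le⟩
      have h2 : a < a + r / n := by have := div_pos hr.1 hn; linarith
      have hd : HasDerivAt (fun s => phi β (a - s) + n * phi β (a + s / n))
          (dphi β (a + r / n) - dphi β (a - r)) r := by
        have e1 : HasDerivAt (fun s : ℝ => a - s) (-1) r := (hasDerivAt_id r).const_sub a
        have e2 : HasDerivAt (fun s : ℝ => a + s / n) (1 / n) r :=
          ((hasDerivAt_id r).div_const n).const_add a
        have e3 := (hasDerivAt_phi β (hb.trans h1).ne').comp r e1
        have e4 := ((hasDerivAt_phi β (hb.trans (ha.trans h2)).ne').comp r e2).const_mul n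
        refine (e3.add e4).congr_deriv ?_
        field_simp
        ring
      rw [hd.deriv, sub_neg]
      exact dphi_strictAntiOn hβ h1.le (ha.trans h2).le (by linarith [hr.1])
  simpa using hanti ⟨le_rfl, hs0.le⟩ ⟨hs0.le, le_rfl⟩ hs0

/-! ### Shape of `g_i` in terms of the ratio of the two values -/

/-- `g_i` as a function of the ratio `r` of the two coordinate values. -/
noncomputable def gRatio (q i r : ℝ) : ℝ := i * Real.log r + q * dslope Real.log 1 r

/-- The function whose sign is the sign of the derivative of `gRatio`. -/
noncomputable def gRatioAux (q i r : ℝ) : ℝ := i * (r - 1) ^ 2 + q * (r - 1) - q * (r * Real.log r)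

lemma dslope_log {r : ℝ} (hr : r ≠ 1) : dslope Real.log 1 r = Real.log r / (r - 1) := by
  rw [dslope_of_ne _ hr, slope_def_field, Real.log_one, sub_zero]

lemma continuousOn_gRatio (q i : ℝ) : ContinuousOn (gRatio q i) (Set.Ioi 0) := by
  have h1 : ContinuousOn Real.log (Set.Ioi 0) :=
    Real.continuousOn_log.mono fun x hx => (ne_of_gt hx : x ≠ 0)
  have h2 : ContinuousOn (dslope Real.log 1) (Set.Ioi 0) :=
    (continuousOn_dslope (Ioi_mem_nhds one_pos)).2
      ⟨h1, Real.differentiableAt_log one_ne_zero⟩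
  exact (continuousOn_const.mul h1).add (continuousOn_const.mul h2)

lemma hasDerivAt_gRatio (q i : ℝ) {r : ℝ} (hr : 0 < r) (hr1 : r ≠ 1) :
    HasDerivAt (gRatio q i) (gRatioAux q i r / (r * (r - 1) ^ 2)) r := by
  have hr1' : r - 1 ≠ 0 := sub_ne_zero.2 hr1
  have h1 := (Real.hasDerivAt_log hr.ne').const_mul i
  have h2 := ((Real.hasDerivAt_log hr.ne').div ((hasDerivAt_id r).sub_const 1) hr1').const_mul q
  have h3 := h1.add h2
  refine HasDerivAt.congr_of_eventuallyEq (h3.congr_deriv ?_) ?_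
  · simp only [gRatioAux, id]
    field_simp
    ring
  · filter_upwards [isOpen_ne.mem_nhds hr1] with s hs
    simp only [gRatio, dslope_log hs, Pi.add_apply, Pi.div_apply, id]

lemma hasDerivAt_gRatioAux (q i : ℝ) {r : ℝ} (hr : r ≠ 0) :
    HasDerivAt (gRatioAux q i) (2 * i * (r - 1) - q * Real.log r) r := by
  have h1 := (((hasDerivAt_id r).sub_const 1).pow 2).const_mul i
  have h2 := ((hasDerivAt_id r).sub_const 1).const_mul q
  have h3 := (Real.hasDerivAt_mul_log hr).const_mul q
  refine ((h1.add h2).sub h3).congr_deriv ?_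
  simp; ring

lemma hasDerivAt_gRatioAux' (q i : ℝ) {r : ℝ} (hr : r ≠ 0) :
    HasDerivAt (fun r => 2 * i * (r - 1) - q * Real.log r) (2 * i - q / r) r := by
  have h1 := ((hasDerivAt_id r).sub_const 1).const_mul (2 * i)
  have h3 := (Real.hasDerivAt_log hr).const_mul q
  refine (h1.sub h3).congr_deriv ?_
  simp [div_eq_mul_inv]

lemma continuous_gRatioAux (q i : ℝ) : Continuous (gRatioAux q i) := by
  have := Real.continuous_mul_log
  unfold gRatioAux
  fun_prop

lemma tendsto_gRatioAux (q i : ℝ) (hi : 0 < i) :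
    Filter.Tendsto (gRatioAux q i) Filter.atTop Filter.atTop := by
  have h1 : Filter.Tendsto (fun r : ℝ => Real.log r / r) Filter.atTop (nhds 0) := by
    simpa using Real.tendsto_pow_log_div_mul_add_atTop 1 0 1 one_ne_zero
  have h2 : Filter.Tendsto (fun r : ℝ => 1 / r) Filter.atTop (nhds 0) := by
    simpa using tendsto_inv_atTop_zero (𝕜 := ℝ)
  -- The expression is `gRatioAux q i r / r ^ 2`, whose limit is `i > 0`.
  have h3 : Filter.Tendsto
      (fun r : ℝ => i * (1 - 1 / r) ^ 2 + q * (1 / r - (1 / r) ^ 2) - q * (Real.log r / r))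
      Filter.atTop (nhds (i * (1 - 0) ^ 2 + q * (0 - 0 ^ 2) - q * 0)) :=
    ((((h2.const_sub 1).pow 2).const_mul i).add ((h2.sub (h2.pow 2)).const_mul q)).sub
      (h1.const_mul q)
  have h4 := (Filter.tendsto_pow_atTop (two_ne_zero)).atTop_mul_pos (C := i) (by simpa using hi)
    (by simpa using h3)
  refine h4.congr' ?_
  filter_upwards [Filter.eventually_gt_atTop 0] with r hr
  simp only [gRatioAux]
  field_simp

/-- The sign pattern of `gRatioAux`. -/
lemma exists_gRatioAux_sign {q i : ℝ} (hi : 0 < i) (hq : 2 * i < q) :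
    ∃ R, 1 < R ∧ (∀ r ∈ Set.Ioo 0 R, r ≠ 1 → gRatioAux q i r < 0) ∧
      ∀ r ∈ Set.Ioi R, 0 < gRatioAux q i r := by
  set N := gRatioAux q i with hN
  set D : ℝ → ℝ := fun r => 2 * i * (r - 1) - q * Real.log r with hD
  have hN1 : N 1 = 0 := by simp [hN, gRatioAux]
  have hD1 : D 1 = 0 := by simp [hD]
  have hc := continuous_gRatioAux q i
  -- `N' = D` and `D' = 2 i - q / r`, so `D` has its minimum at `e > 1`. As `D 1 = 0`, `N` increases
  -- to `N 1 = 0` on `(0, 1]` and decreases from there on `[1, e]`.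
  set e := q / (2 * i) with he
  have he1 : 1 < e := by rw [he, lt_div_iff₀ (by positivity)]; linarith
  have hDanti : StrictAntiOn D (Set.Ioc 0 e) := by
    refine strictAntiOn_of_deriv_neg (convex_Ioc _ _) ?_ ?_
    · exact fun r hr => (hasDerivAt_gRatioAux' q i hr.1.ne').continuousAt.continuousWithinAt
    · intro r hr
      rw [interior_Ioc] at hr
      rw [(hasDerivAt_gRatioAux' q i hr.1.ne').deriv, sub_neg, lt_div_iff₀ hr.1]
      have := (lt_div_iff₀ (by positivity : 0 < 2 * i)).1 hr.2
      linarith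
  have hDmono : StrictMonoOn D (Set.Ici e) := by
    have e0 : 0 < e := one_pos.trans he1
    refine strictMonoOn_of_deriv_pos (convex_Ici _) ?_ ?_
    · exact fun r hr =>
        (hasDerivAt_gRatioAux' q i (e0.trans_le hr).ne').continuousAt.continuousWithinAt
    · intro r hr
      rw [interior_Ici] at hr
      rw [(hasDerivAt_gRatioAux' q i (e0.trans hr).ne').deriv, sub_pos, div_lt_iff₀ (e0.trans hr)]
      have := (div_lt_iff₀ (by positivity : 0 < 2 * i)).1 hr
      linarith
  have hneg1 : ∀ r ∈ Set.Ioo (0 : ℝ) 1, N r < 0 := by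
    have hm : StrictMonoOn N (Set.Ioc 0 1) := by
      refine strictMonoOn_of_deriv_pos (convex_Ioc _ _) hc.continuousOn ?_
      intro r hr
      rw [interior_Ioc] at hr
      rw [(hasDerivAt_gRatioAux q i hr.1.ne').deriv]
      have := hDanti ⟨hr.1, (hr.2.trans he1).le⟩ ⟨one_pos, he1.le⟩ hr.2
      rwa [hD1] at this
    intro r hr
    have := hm ⟨hr.1, hr.2.le⟩ ⟨one_pos, le_rfl⟩ hr.2
    rwa [hN1] at this
  have hnege : ∀ r ∈ Set.Ioc 1 e, N r < 0 := by
    have hm : StrictAntiOn N (Set.Icc 1 e) := by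
      refine strictAntiOn_of_deriv_neg (convex_Icc _ _) hc.continuousOn ?_
      intro r hr
      rw [interior_Icc] at hr
      have h0 : 0 < r := one_pos.trans hr.1
      rw [(hasDerivAt_gRatioAux q i h0.ne').deriv]
      have := hDanti ⟨one_pos, he1.le⟩ ⟨h0, hr.2.le⟩ hr.1
      rwa [hD1] at this
    intro r hr
    have := hm ⟨le_rfl, he1.le⟩ ⟨hr.1.le, hr.2⟩ hr.1
    rwa [hN1] at this
  -- Beyond `e`, `N` is strictly convex, starts negative and tends to infinity, so it has a single
  -- zero `R`.
  have hconv : StrictConvexOn ℝ (Set.Ici e) N := by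
    refine StrictMonoOn.strictConvexOn_of_deriv (convex_Ici _) hc.continuousOn ?_
    rw [interior_Ici]
    intro r hr s hs hrs
    have e0 : 0 < e := one_pos.trans he1
    rw [(hasDerivAt_gRatioAux q i (e0.trans hr).ne').deriv,
      (hasDerivAt_gRatioAux q i (e0.trans hs).ne').deriv]
    exact hDmono (Set.mem_Ici.2 (Set.mem_Ioi.1 hr).le) (Set.mem_Ici.2 (Set.mem_Ioi.1 hs).le) hrs
  have hNe : N e < 0 := hnege e ⟨he1, le_rfl⟩
  obtain ⟨M, hM0, hMe⟩ := (((tendsto_gRatioAux q i hi).eventually_gt_atTop 0).and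
    (Filter.eventually_gt_atTop e)).exists
  obtain ⟨R, hR, hR0⟩ : (0 : ℝ) ∈ N '' Set.Icc e M :=
    intermediate_value_Icc hMe.le hc.continuousOn ⟨hNe.le, hM0.le⟩
  have heR : e < R := by
    rcases hR.1.eq_or_lt with h | h
    · rw [← h] at hR0; linarith
    · exact h
  refine ⟨R, he1.trans heR, ?_, ?_⟩
  · intro r hr hr1
    rcases lt_or_gt_of_ne hr1 with h | h
    · exact hneg1 r ⟨hr.1, h⟩
    · rcases le_or_gt r e with h2 | h2
      · exact hnege r ⟨h, h2⟩
      · have := hconv.lt_on_openSegment (x := e) (y := R) (z := r) Set.self_mem_Ici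
          (Set.mem_Ici.2 heR.le) heR.ne (by rw [openSegment_eq_Ioo heR]; exact ⟨h2, hr.2⟩)
        rw [hR0] at this
        exact this.trans_le (max_le hNe.le le_rfl)
  · intro r hr
    have hr : R < r := hr
    have := hconv.lt_on_openSegment (x := e) (y := r) (z := R) Set.self_mem_Ici
          (Set.mem_Ici.2 (heR.trans hr).le) (heR.trans hr).ne
          (by rw [openSegment_eq_Ioo (heR.trans hr)]; exact ⟨heR, hr⟩)
    rw [hR0] at this
    rcases lt_max_iff.1 this with h | h
    · linarith
    · exact h

/-- The derivative formula excludes `r = 1`, where `gRatioAux` vanishes; monotonicity is proved on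
both sides of `1` and glued by continuity. -/
lemma gRatio_strictAntiOn {q i R : ℝ} (hR : 1 < R)
    (h : ∀ r ∈ Set.Ioo 0 R, r ≠ 1 → gRatioAux q i r < 0) :
    StrictAntiOn (gRatio q i) (Set.Ioc 0 R) := by
  have key : ∀ s : Set ℝ, Convex ℝ s → s ⊆ Set.Ioi 0 → (∀ r ∈ interior s, r ∈ Set.Ioo 0 R ∧ r ≠ 1) →
      StrictAntiOn (gRatio q i) s := by
    intro s hs h0 h1
    refine strictAntiOn_of_deriv_neg hs ((continuousOn_gRatio q i).mono h0) ?_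
    intro r hr
    obtain ⟨h2, h3⟩ := h1 r hr
    rw [(hasDerivAt_gRatio q i h2.1 h3).deriv]
    have : 0 < (r - 1) ^ 2 := by have := sub_ne_zero.2 h3; positivity
    exact div_neg_of_neg_of_pos (h r h2 h3) (mul_pos h2.1 this)
  have h1 := key (Set.Ioc 0 1) (convex_Ioc _ _) (fun r hr => hr.1) (by
    rw [interior_Ioc]; exact fun r hr => ⟨⟨hr.1, hr.2.trans hR⟩, hr.2.ne⟩)
  have h2 := key (Set.Icc 1 R) (convex_Icc _ _) (fun r hr => one_pos.trans_le hr.1) (by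
    rw [interior_Icc]; exact fun r hr => ⟨⟨one_pos.trans hr.1, hr.2⟩, hr.1.ne'⟩)
  have := h1.union h2 (c := 1) ⟨⟨one_pos, le_rfl⟩, fun r hr => hr.2⟩
    ⟨⟨le_rfl, hR.le⟩, fun r hr => hr.1⟩
  rwa [Set.Ioc_union_Icc_eq_Ioc one_pos hR.le] at this

lemma gRatio_strictMonoOn {q i R : ℝ} (hR : 1 < R)
    (h : ∀ r ∈ Set.Ioi R, 0 < gRatioAux q i r) :
    StrictMonoOn (gRatio q i) (Set.Ici R) := by
  have h0 : (0 : ℝ) < R := one_pos.trans hR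
  refine strictMonoOn_of_deriv_pos (convex_Ici _)
    ((continuousOn_gRatio q i).mono fun r hr => h0.trans_le hr) ?_
  intro r hr
  rw [interior_Ici] at hr
  have hr' : R < r := hr
  rw [(hasDerivAt_gRatio q i (h0.trans hr') (hR.trans hr').ne').deriv]
  have : 0 < (r - 1) ^ 2 := by have := sub_ne_zero.2 (hR.trans hr').ne'; positivity
  exact div_pos (h r hr) (mul_pos (h0.trans hr') this)

lemma tendsto_gRatio_atTop {q i : ℝ} (hi : 0 < i) (hq : 0 < q) :
    Filter.Tendsto (gRatio q i) Filter.atTop Filter.atTop := by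
  refine Filter.tendsto_atTop_mono' _ ?_ (Real.tendsto_log_atTop.const_mul_atTop hi)
  filter_upwards [Filter.eventually_gt_atTop 1] with r hr
  rw [gRatio, dslope_log hr.ne']
  have : 0 ≤ q * (Real.log r / (r - 1)) :=
    mul_nonneg hq.le (div_nonneg (Real.log_nonneg hr.le) (by linarith))
  linarith

lemma tendsto_gRatio_zero {q i : ℝ} (hq : i < q) :
    Filter.Tendsto (gRatio q i) (nhdsWithin 0 (Set.Ioi 0)) Filter.atTop := by
  -- Away from `r = 1`, `gRatio` is `log r` times this factor, whose limit `i - q` at `0` is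
  -- negative.
  have h1 : Filter.Tendsto (fun r : ℝ => i + q / (r - 1)) (nhdsWithin 0 (Set.Ioi 0))
      (nhds (i - q)) := by
    have : ContinuousAt (fun r : ℝ => i + q / (r - 1)) 0 := by
      refine continuousAt_const.add (continuousAt_const.div (by fun_prop) (by norm_num))
    have h2 := this.tendsto.mono_left (nhdsWithin_le_nhds (s := Set.Ioi 0))
    convert h2 using 2
    ring
  have h2 := Real.tendsto_log_nhdsGT_zero.atBot_mul_neg (C := i - q) (by linarith) h1
  refine h2.congr' ?_
  filter_upwards [Ioo_mem_nhdsGT (one_pos)] with r hr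
  rw [gRatio, dslope_log hr.2.ne]
  ring

/-! ### The solutions `u_i` and `v_i` of `g_i(t) = β` -/

/-- The ratio of the two coordinate values of `twoValued A t`, `A.card = i`. -/
noncomputable def ratio (q i t : ℝ) : ℝ := (1 - (q - i) * t) / (i * t)

section Shape

variable {q i : ℕ}

lemma mem_gDomain_iff (hq : i < q) {t : ℝ} :
    t ∈ gDomain q i ↔ 0 < t ∧ 0 < 1 - ((q : ℝ) - i) * t := by
  have : (0 : ℝ) < (q : ℝ) - i := sub_pos.2 (by exact_mod_cast hq)
  rw [gDomain, Set.mem_Ioo, lt_div_iff₀ this, sub_pos, mul_comm]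

lemma inv_mem_gDomain (hi : 0 < i) (hq : i < q) : 1 / (q : ℝ) ∈ gDomain q i := by
  have hq0 : (0 : ℝ) < q := by exact_mod_cast hi.trans hq
  have hi0 : (0 : ℝ) < i := by exact_mod_cast hi
  rw [mem_gDomain_iff hq]
  refine ⟨by positivity, ?_⟩
  rw [show 1 - ((q : ℝ) - i) * (1 / q) = i / q by field_simp; ring]
  positivity

/-- With `r` the ratio, `t = 1 / (i r + q - i)` and `1 - q t = i t (r - 1)`, so the prefactor `i /
(1 - q t)` becomes `i + q / (r - 1)`. The singularity at `t = 1 / q` turns into the removable one of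
`log r / (r - 1)`, which `dslope` fills in. -/
lemma g_eq_gRatio (hi : 0 < i) (hq : i < q) {t : ℝ} (ht : t ∈ gDomain q i) :
    g q i t = gRatio q i (ratio q i t) := by
  obtain ⟨h0, h1⟩ := (mem_gDomain_iff hq).1 ht
  have hq0 : (0 : ℝ) < q := by exact_mod_cast hi.trans hq
  have hi0 : (0 : ℝ) < i := by exact_mod_cast hi
  by_cases h : t = 1 / (q : ℝ)
  · have hr : ratio q i t = 1 := by
      rw [ratio, h]; field_simp; ring
    rw [hr, g, if_pos h, gRatio, dslope_same, Real.deriv_log]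
    simp
  · have h2 : 1 - q * t ≠ 0 := by
      intro h3
      apply h
      field_simp
      linarith
    have hr : ratio q i t - 1 = (1 - q * t) / (i * t) := by
      rw [ratio]; field_simp; ring
    have hr1 : ratio q i t ≠ 1 := by
      rw [← sub_ne_zero, hr]; positivity
    rw [g, if_neg h, gRatio, dslope_log hr1, hr, ratio]
    field_simp
    ring

lemma ratio_pos (hi : 0 < i) (hq : i < q) {t : ℝ} (ht : t ∈ gDomain q i) : 0 < ratio q i t := by
  obtain ⟨h0, h1⟩ := (mem_gDomain_iff hq).1 ht
  have hi0 : (0 : ℝ) < i := by exact_mod_cast hi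
  unfold ratio; positivity

lemma ratio_lt (hi : 0 < i) {s t : ℝ} (hs : 0 < s) (hst : s < t) :
    ratio q i t < ratio q i s := by
  have hi0 : (0 : ℝ) < i := by exact_mod_cast hi
  have ht := hs.trans hst
  rw [ratio, ratio, div_lt_div_iff₀ (by positivity) (by positivity)]
  nlinarith [mul_pos hi0 (sub_pos.2 hst)]

/-- The point with a given ratio. -/
lemma exists_ratio_eq (hi : 0 < i) (hq : i < q) {r : ℝ} (hr : 0 < r) :
    ∃ t ∈ gDomain q i, ratio q i t = r := by
  have hi0 : (0 : ℝ) < i := by exact_mod_cast hi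
  have hq0 : (0 : ℝ) < (q : ℝ) - i := sub_pos.2 (by exact_mod_cast hq)
  have hd : 0 < i * r + ((q : ℝ) - i) := by positivity
  refine ⟨1 / (i * r + ((q : ℝ) - i)), (mem_gDomain_iff hq).2 ⟨by positivity, ?_⟩, ?_⟩
  · rw [show 1 - ((q : ℝ) - i) * (1 / (i * r + ((q : ℝ) - i)))
      = i * r / (i * r + ((q : ℝ) - i)) by field_simp; ring]
    positivity
  · rw [ratio]; field_simp; ring

/-- The shape of `g_i`: it decreases up to a point `m < 1 / q` and increases afterwards. -/
structure IsTurningPoint (q i : ℕ) (m : ℝ) : Prop where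
  pos : 0 < m
  lt_inv : m < 1 / (q : ℝ)
  anti : StrictAntiOn (g q i) (Set.Ioc 0 m)
  mono : StrictMonoOn (g q i) (Set.Ico m (1 / ((q : ℝ) - i)))
  cont : ContinuousOn (g q i) (gDomain q i)
  left : ∀ B, ∃ t ∈ Set.Ioo 0 m, B < g q i t
  right : ∀ B, ∃ t ∈ Set.Ioo m (1 / ((q : ℝ) - i)), B < g q i t
  curv : ∀ t ∈ Set.Ioo m (1 / (q : ℝ)),
    i * ((q : ℝ) - i) / (1 - ((q : ℝ) - i) * t) + i / t < q * g q i t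

lemma exists_isTurningPoint (hi : 0 < i) (hq : 2 * i < q) : ∃ m, IsTurningPoint q i m := by
  have hiq : i < q := by omega
  have hi0 : (0 : ℝ) < i := by exact_mod_cast hi
  have hq0 : (0 : ℝ) < q := by exact_mod_cast hi.trans hiq
  have hqi : (0 : ℝ) < (q : ℝ) - i := sub_pos.2 (by exact_mod_cast hiq)
  have hq2 : 2 * (i : ℝ) < q := by exact_mod_cast hq
  obtain ⟨R, hR1, hneg, hpos⟩ := exists_gRatioAux_sign hi0 hq2
  have hanti := gRatio_strictAntiOn hR1 hneg
  have hmono := gRatio_strictMonoOn hR1 hpos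
  -- The ratio decreases in `t`: the turning point is where it equals `R`, and `R > 1` places it
  -- left of `1 / q`.
  obtain ⟨m, hm, hmR⟩ := exists_ratio_eq hi hiq (one_pos.trans hR1)
  have hinv := inv_mem_gDomain hi hiq
  have hrinv : ratio q i (1 / (q : ℝ)) = 1 := by rw [ratio]; field_simp; ring
  have hlt : ∀ {s t : ℝ}, s ∈ gDomain q i → t ∈ gDomain q i →
      (ratio q i s < ratio q i t ↔ t < s) := by
    intro s t hs ht
    refine ⟨fun h => ?_, fun h => ratio_lt hi ht.1 h⟩
    by_contra hc
    rcases (not_lt.1 hc).eq_or_lt with h2 | h2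
    · rw [h2] at h; exact lt_irrefl _ h
    · exact lt_asymm h (ratio_lt hi hs.1 h2)
  have hd1 : ∀ t ∈ Set.Ioc 0 m, t ∈ gDomain q i := fun t ht => ⟨ht.1, ht.2.trans_lt hm.2⟩
  have hd2 : ∀ t ∈ Set.Ico m (1 / ((q : ℝ) - i)), t ∈ gDomain q i :=
    fun t ht => ⟨hm.1.trans_le ht.1, ht.2⟩
  have hle1 : ∀ t ∈ Set.Ioc 0 m, R ≤ ratio q i t := by
    intro t ht
    rcases ht.2.eq_or_lt with h | h
    · rw [h, hmR]
    · exact (hmR ▸ (hlt hm (hd1 t ht)).2 h).le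
  have hle2 : ∀ t ∈ Set.Ico m (1 / ((q : ℝ) - i)), ratio q i t ≤ R := by
    intro t ht
    rcases ht.1.eq_or_lt with h | h
    · rw [← h, hmR]
    · exact (hmR ▸ (hlt (hd2 t ht) hm).2 h).le
  refine ⟨m, hm.1, ?_, ?_, ?_, ?_, ?_, ?_, ?_⟩
  · rw [← hlt hinv hm, hmR, hrinv]; exact hR1
  · intro s hs t ht hst
    rw [g_eq_gRatio hi hiq (hd1 s hs), g_eq_gRatio hi hiq (hd1 t ht)]
    exact hmono (hle1 t ht) (hle1 s hs) ((hlt (hd1 t ht) (hd1 s hs)).2 hst)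
  · intro s hs t ht hst
    rw [g_eq_gRatio hi hiq (hd2 s hs), g_eq_gRatio hi hiq (hd2 t ht)]
    exact hanti ⟨ratio_pos hi hiq (hd2 t ht), hle2 t ht⟩ ⟨ratio_pos hi hiq (hd2 s hs), hle2 s hs⟩
      ((hlt (hd2 t ht) (hd2 s hs)).2 hst)
  · have h1 : ContinuousOn (fun t => ratio q i t) (gDomain q i) := by
      unfold ratio
      refine ContinuousOn.div (by fun_prop) (by fun_prop) ?_
      intro t ht
      exact (mul_pos hi0 ht.1).ne'
    refine ((continuousOn_gRatio q i).comp h1 fun t ht => ratio_pos hi hiq ht).congr ?_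
    intro t ht
    exact g_eq_gRatio hi hiq ht
  · intro B
    obtain ⟨r, hr, hrR⟩ := (((tendsto_gRatio_atTop hi0 hq0).eventually_gt_atTop B).and
      (Filter.eventually_gt_atTop R)).exists
    obtain ⟨t, ht, htr⟩ := exists_ratio_eq hi hiq ((one_pos.trans hR1).trans hrR)
    refine ⟨t, ⟨ht.1, ?_⟩, ?_⟩
    · rw [← hlt hm ht, htr, hmR]; exact hrR
    · rw [g_eq_gRatio hi hiq ht, htr]; exact hr
  · intro B
    obtain ⟨r, hr, hrR⟩ := (((tendsto_gRatio_zero (q := q) (i := i)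
      (by exact_mod_cast hiq)).eventually_gt_atTop B).and
      (Ioo_mem_nhdsGT (one_pos.trans hR1))).exists
    obtain ⟨t, ht, htr⟩ := exists_ratio_eq hi hiq hrR.1
    refine ⟨t, ⟨?_, ht.2⟩, ?_⟩
    · rw [← hlt ht hm, htr, hmR]; exact hrR.2
    · rw [g_eq_gRatio hi hiq ht, htr]; exact hr
  · intro t ht
    have htd : t ∈ gDomain q i := ⟨hm.1.trans ht.1, ht.2.trans hinv.2⟩
    obtain ⟨h0, h1⟩ := (mem_gDomain_iff hiq).1 htd
    set r := ratio q i t with hr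
    have hr0 : 0 < r := ratio_pos hi hiq htd
    have hr1 : 1 < r := by rw [← hrinv]; exact (hlt hinv htd).2 ht.2
    have hrR : r < R := by rw [← hmR]; exact (hlt htd hm).2 ht.1
    have hb : 1 - ((q : ℝ) - i) * t = r * (i * t) := by rw [hr, ratio]; field_simp
    have ht' : t = 1 / (i * r + (q - i)) := by
      field_simp
      linarith
    have hN := hneg r ⟨hr0, hrR⟩ hr1.ne'
    rw [g_eq_gRatio hi hiq htd, ← hr, hb, gRatio, dslope_log hr1.ne']
    have hd : 0 < i * r + ((q : ℝ) - i) := by positivity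
    have hr2 : 0 < r - 1 := by linarith
    rw [ht', ← sub_pos]
    -- The curvature inequality is another form of `gRatioAux q i r < 0`, which holds because `1 < r
    -- < R`.
    have : (q : ℝ) * (i * Real.log r + q * (Real.log r / (r - 1))) -
        (i * ((q : ℝ) - i) / (r * (i * (1 / (i * r + ((q : ℝ) - i))))) +
          i / (1 / (i * r + ((q : ℝ) - i)))) =
        (i * r + (q - i)) / (r * (r - 1)) * (-gRatioAux q i r) := by
      rw [gRatioAux]
      field_simp
      ring
    rw [this]
    exact mul_pos (div_pos hd (mul_pos hr0 hr2)) (neg_pos.2 hN)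

namespace IsTurningPoint

variable {m : ℝ}

lemma mem (h : IsTurningPoint q i m) (hi : 0 < i) (hq : i < q) : m ∈ gDomain q i :=
  ⟨h.pos, h.lt_inv.trans (inv_mem_gDomain hi hq).2⟩

lemma le_g (h : IsTurningPoint q i m) (hi : 0 < i) (hq : i < q) {t : ℝ} (ht : t ∈ gDomain q i) :
    g q i m ≤ g q i t := by
  rcases le_total t m with h1 | h1
  · exact h.anti.antitoneOn ⟨ht.1, h1⟩ ⟨h.pos, le_rfl⟩ h1
  · exact h.mono.monotoneOn ⟨le_rfl, (h.mem hi hq).2⟩ ⟨h1, ht.2⟩ h1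

lemma betaS_eq (h : IsTurningPoint q i m) (hi : 0 < i) (hq : i < q) : betaS q i = g q i m :=
  IsLeast.csInf_eq ⟨⟨m, h.mem hi hq, rfl⟩, by rintro _ ⟨t, ht, rfl⟩; exact h.le_g hi hq ht⟩

/-- The two solutions of `g_i(t) = β`. -/
lemma exists_solutions (h : IsTurningPoint q i m) (hi : 0 < i) (hq : i < q) {β : ℝ}
    (hβ : betaS q i ≤ β) : uSol q i β ∈ Set.Ioc 0 m ∧ g q i (uSol q i β) = β ∧
      vSol q i β ∈ Set.Ico m (1 / ((q : ℝ) - i)) ∧ g q i (vSol q i β) = β := by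
  rw [h.betaS_eq hi hq] at hβ
  have hm := h.mem hi hq
  obtain ⟨u, hu, hgu⟩ : ∃ u ∈ Set.Ioc 0 m, g q i u = β := by
    obtain ⟨a, ha, hga⟩ := h.left β
    have hsub : Set.Icc a m ⊆ gDomain q i := fun t ht => ⟨ha.1.trans_le ht.1, ht.2.trans_lt hm.2⟩
    obtain ⟨u, hu, hgu⟩ := intermediate_value_Icc' ha.2.le (h.cont.mono hsub) ⟨hβ, hga.le⟩
    exact ⟨u, ⟨ha.1.trans_le hu.1, hu.2⟩, hgu⟩
  obtain ⟨v, hv, hgv⟩ : ∃ v ∈ Set.Ico m (1 / ((q : ℝ) - i)), g q i v = β := by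
    obtain ⟨a, ha, hga⟩ := h.right β
    have hsub : Set.Icc m a ⊆ gDomain q i := fun t ht => ⟨hm.1.trans_le ht.1, ht.2.trans_lt ha.2⟩
    obtain ⟨v, hv, hgv⟩ := intermediate_value_Icc ha.1.le (h.cont.mono hsub) ⟨hβ, hga.le⟩
    exact ⟨v, ⟨hv.1, hv.2.trans_lt ha.2⟩, hgv⟩
  have hud : u ∈ gDomain q i := ⟨hu.1, hu.2.trans_lt hm.2⟩
  have hvd : v ∈ gDomain q i := ⟨hm.1.trans_le hv.1, hv.2⟩
  have hcases : ∀ t ∈ {t | t ∈ gDomain q i ∧ g q i t = β}, t = u ∨ t = v := by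
    rintro t ⟨ht, hgt⟩
    rcases le_total t m with h1 | h1
    · left; exact h.anti.injOn ⟨ht.1, h1⟩ hu (hgt.trans hgu.symm)
    · right; exact h.mono.injOn ⟨h1, ht.2⟩ hv (hgt.trans hgv.symm)
  have hu' : uSol q i β = u := IsLeast.csInf_eq ⟨⟨hud, hgu⟩, fun t ht => by
    rcases hcases t ht with h1 | h1
    · exact h1.ge
    · rw [h1]; exact hu.2.trans hv.1⟩
  have hv' : vSol q i β = v := IsGreatest.csSup_eq ⟨⟨hvd, hgv⟩, fun t ht => by
    rcases hcases t ht with h1 | h1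
    · rw [h1]; exact hu.2.trans hv.1
    · exact h1.le⟩
  rw [hu', hv']
  exact ⟨hu, hgu, hv, hgv⟩

end IsTurningPoint

/-- The two solutions of `g_i(t) = β` and the sign of `g_i - β`. -/
structure SolSpec (q i : ℕ) (β : ℝ) : Prop where
  u_pos : 0 < uSol q i β
  u_lt_inv : uSol q i β < 1 / (q : ℝ)
  u_le_v : uSol q i β ≤ vSol q i β
  v_lt : vSol q i β < 1 / ((q : ℝ) - i)
  g_u : g q i (uSol q i β) = β
  g_v : g q i (vSol q i β) = β
  lt_u : ∀ t, 0 < t → t < uSol q i β → β < g q i t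
  mid : ∀ t, uSol q i β < t → t < vSol q i β → g q i t < β
  v_lt_g : ∀ t, vSol q i β < t → t < 1 / ((q : ℝ) - i) → β < g q i t

lemma solSpec (hi : 0 < i) (hq : 2 * i < q) {β : ℝ} (hβ : betaS q i ≤ β) : SolSpec q i β := by
  obtain ⟨m, h⟩ := exists_isTurningPoint hi hq
  have hiq : i < q := by omega
  have hm := h.mem hi hiq
  obtain ⟨hu, hgu, hv, hgv⟩ := h.exists_solutions hi hiq hβ
  refine ⟨hu.1, hu.2.trans_lt h.lt_inv, hu.2.trans hv.1, hv.2, hgu, hgv, ?_, ?_, ?_⟩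
  · intro t h0 h1
    rw [← hgu]; exact h.anti ⟨h0, h1.le.trans hu.2⟩ hu h1
  · intro t h0 h1
    rcases le_total t m with h2 | h2
    · exact (h.anti hu ⟨hu.1.trans h0, h2⟩ h0).trans_eq hgu
    · exact (h.mono ⟨h2, h1.trans hv.2⟩ hv h1).trans_eq hgv
  · intro t h0 h1
    rw [← hgv]; exact h.mono hv ⟨hv.1.trans h0.le, h1⟩ h0

lemma exists_g_eq_betaS (hi : 0 < i) (hq : 2 * i < q) :
    ∃ m, 0 < m ∧ m < 1 / (q : ℝ) ∧ g q i m = betaS q i := by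
  obtain ⟨m, h⟩ := exists_isTurningPoint hi hq
  exact ⟨m, h.pos, h.lt_inv, (h.betaS_eq hi (by omega)).symm⟩

lemma betaS_le_g (hi : 0 < i) (hq : 2 * i < q) {t : ℝ} (ht : t ∈ gDomain q i) :
    betaS q i ≤ g q i t := by
  obtain ⟨m, h⟩ := exists_isTurningPoint hi hq
  rw [h.betaS_eq hi (by omega)]
  exact h.le_g hi (by omega) ht

lemma g_inv : g q i (1 / (q : ℝ)) = q := if_pos rfl

lemma betaS_lt_q (hi : 0 < i) (hq : 2 * i < q) : betaS q i < q := by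
  obtain ⟨m, h⟩ := exists_isTurningPoint hi hq
  have hinv := inv_mem_gDomain hi (by omega : i < q)
  rw [h.betaS_eq hi (by omega), ← g_inv (q := q) (i := i)]
  exact h.mono ⟨le_rfl, (h.mem hi (by omega)).2⟩ ⟨h.lt_inv.le, hinv.2⟩ h.lt_inv

/-- At `v_i` below `1 / q` the function along the symmetric segment is strictly concave. -/
lemma curvature_vSol (hi : 0 < i) (hq : 2 * i < q) {β : ℝ} (hβ : betaS q i < β)
    (hv : vSol q i β < 1 / (q : ℝ)) :
    i * ((q : ℝ) - i) / (1 - ((q : ℝ) - i) * vSol q i β) + i / vSol q i β < q * β := by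
  obtain ⟨m, h⟩ := exists_isTurningPoint hi hq
  obtain ⟨hu, hgu, hv', hgv⟩ := h.exists_solutions hi (by omega) hβ.le
  rcases hv'.1.eq_or_lt with h1 | h1
  · rw [← h1, ← h.betaS_eq hi (by omega)] at hgv; exact absurd hgv hβ.ne
  · have := h.curv _ ⟨h1, hv⟩
    rwa [hgv] at this

/-- At the minimum value of `g_i` there is only one solution. -/
lemma uSol_betaS (hi : 0 < i) (hq : 2 * i < q) : uSol q i (betaS q i) = vSol q i (betaS q i) := by
  obtain ⟨m, h⟩ := exists_isTurningPoint hi hq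
  have hm := h.mem hi (by omega : i < q)
  obtain ⟨hu, hgu, hv, hgv⟩ := h.exists_solutions hi (by omega) (le_refl (betaS q i))
  have hb := h.betaS_eq hi (by omega : i < q)
  rw [h.anti.injOn hu ⟨h.pos, le_rfl⟩ (hgu.trans hb),
    h.mono.injOn hv ⟨le_rfl, hm.2⟩ (hgv.trans hb)]

variable {β : ℝ}

lemma SolSpec.pos (h : SolSpec q i β) : 0 < vSol q i β := h.u_pos.trans_le h.u_le_v

lemma SolSpec.u_mem (h : SolSpec q i β) : uSol q i β ∈ gDomain q i :=
  ⟨h.u_pos, h.u_le_v.trans_lt h.v_lt⟩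

lemma SolSpec.v_mem (h : SolSpec q i β) : vSol q i β ∈ gDomain q i := ⟨h.pos, h.v_lt⟩

lemma SolSpec.eq_or (h : SolSpec q i β) {t : ℝ} (ht : t ∈ gDomain q i) (hg : g q i t = β) :
    t = uSol q i β ∨ t = vSol q i β := by
  by_contra hc
  push Not at hc
  rcases lt_or_gt_of_ne hc.1 with h1 | h1
  · exact (h.lt_u t ht.1 h1).ne hg.symm
  · rcases lt_or_gt_of_ne hc.2 with h2 | h2
    · exact (h.mid t h1 h2).ne hg
    · exact (h.v_lt_g t h2 ht.2).ne hg.symm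

lemma SolSpec.mem_of_lt (h : SolSpec q i β) {t : ℝ} (ht : t ∈ gDomain q i) (hg : g q i t < β) :
    uSol q i β < t ∧ t < vSol q i β := by
  constructor
  · by_contra hc
    rcases (not_lt.1 hc).eq_or_lt with h1 | h1
    · rw [h1, h.g_u] at hg; exact lt_irrefl _ hg
    · exact lt_asymm hg (h.lt_u t ht.1 h1)
  · by_contra hc
    rcases (not_lt.1 hc).eq_or_lt with h1 | h1
    · rw [← h1, h.g_v] at hg; exact lt_irrefl _ hg
    · exact lt_asymm hg (h.v_lt_g t h1 ht.2)

lemma SolSpec.v_lt_inv (h : SolSpec q i β) (hβ : β < q) :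
    vSol q i β < 1 / (q : ℝ) := by
  by_contra hc
  rcases (not_lt.1 hc).eq_or_lt with h1 | h1
  · have := h.g_v; rw [← h1, g_inv] at this; exact hβ.ne this.symm
  · have := h.mid _ h.u_lt_inv h1; rw [g_inv] at this; exact lt_asymm hβ this

lemma SolSpec.v_eq_inv (h : SolSpec q i q) (hi : 0 < i) (hq : i < q) :
    vSol q i q = 1 / (q : ℝ) := by
  rcases h.eq_or (inv_mem_gDomain hi hq) g_inv with h1 | h1
  · exact absurd h1 h.u_lt_inv.ne'
  · exact h1.symm

lemma SolSpec.inv_lt_v (h : SolSpec q i β) (hi : 0 < i) (hq : i < q) (hβ : q < β) :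
    1 / (q : ℝ) < vSol q i β :=
  (h.mem_of_lt (inv_mem_gDomain hi hq) (g_inv.trans_lt hβ)).2

end Shape

/-! ### The potential along the symmetric segments -/

/-- The value at the `i` distinguished coordinates of `twoValued A t`, `A.card = i`. -/
noncomputable def bval (q i : ℕ) (t : ℝ) : ℝ := (1 - ((q : ℝ) - i) * t) / i

lemma bval_sub {q i : ℕ} (hi : 0 < i) (t : ℝ) : bval q i t - t = (1 - q * t) / i := by
  have hi0 : (0 : ℝ) < i := by exact_mod_cast hi
  rw [bval]; field_simp; ring

lemma lt_bval {q i : ℕ} (hi : 0 < i) (hq : i < q) {t : ℝ} (ht : t < 1 / (q : ℝ)) :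
    t < bval q i t := by
  have hi0 : (0 : ℝ) < i := by exact_mod_cast hi
  have hq0 : (0 : ℝ) < q := by exact_mod_cast hi.trans hq
  rw [lt_div_iff₀ hq0] at ht
  have : 0 < bval q i t - t := by
    rw [bval_sub hi]; exact div_pos (by linarith) hi0
  linarith

lemma bval_pos {q i : ℕ} (hi : 0 < i) (hq : i < q) {t : ℝ} (ht : t ∈ gDomain q i) :
    0 < bval q i t := by
  have hi0 : (0 : ℝ) < i := by exact_mod_cast hi
  exact div_pos ((mem_gDomain_iff hq).1 ht).2 hi0

lemma mem_gDomain_of_lt_inv {q i : ℕ} (hi : 0 < i) (hq : i < q) {t : ℝ} (h0 : 0 < t)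
    (ht : t < 1 / (q : ℝ)) : t ∈ gDomain q i :=
  ⟨h0, ht.trans (inv_mem_gDomain hi hq).2⟩

/-- `g_i(t)` is the slope of the logarithm between the two coordinate values. -/
lemma g_eq_slope {q i : ℕ} (hi : 0 < i) (hq : i < q) {t : ℝ} (ht : t ∈ gDomain q i)
    (hne : t ≠ 1 / (q : ℝ)) :
    g q i t = (Real.log (bval q i t) - Real.log t) / (bval q i t - t) := by
  obtain ⟨h0, h1⟩ := (mem_gDomain_iff hq).1 ht
  have hi0 : (0 : ℝ) < i := by exact_mod_cast hi
  rw [g, if_neg hne, bval_sub hi, ← Real.log_div (bval_pos hi hq ht).ne' h0.ne',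
    show bval q i t / t = (1 - ((q : ℝ) - i) * t) / (i * t) by rw [bval]; field_simp]
  field_simp

lemma dphi_sub_dphi_bval {q i : ℕ} (hi : 0 < i) (hq : i < q) {t : ℝ} (ht : t ∈ gDomain q i)
    (hne : t ≠ 1 / (q : ℝ)) {β : ℝ} (hβ : 0 < β) :
    dphi β t - dphi β (bval q i t) = (bval q i t - t) * ((β - g q i t) / β) := by
  have h : bval q i t - t ≠ 0 := by
    have hi0 : (i : ℝ) ≠ 0 := by exact_mod_cast hi.ne'
    have hq0 : (q : ℝ) ≠ 0 := by exact_mod_cast (hi.trans hq).ne'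
    rw [bval_sub hi]
    refine div_ne_zero (fun h => hne ?_) hi0
    field_simp; linarith
  rw [g_eq_slope hi hq ht hne, dphi, dphi]
  field_simp
  ring

/-- `g_1 < g_2` to the left of `1 / q`. -/
lemma g_one_lt_g_two {q : ℕ} (hq : 5 ≤ q) {t : ℝ} (h0 : 0 < t) (ht : t < 1 / (q : ℝ)) :
    g q 1 t < g q 2 t := by
  have hq0 : (0 : ℝ) < q := by exact_mod_cast (by omega : 0 < q)
  rw [g_eq_slope one_pos (by omega) (mem_gDomain_of_lt_inv one_pos (by omega) h0 ht) ht.ne,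
    g_eq_slope two_pos (by omega) (mem_gDomain_of_lt_inv two_pos (by omega) h0 ht) ht.ne]
  have h2 := lt_bval two_pos (by omega : 2 < q) ht
  have h12 : bval q 2 t < bval q 1 t := by
    have := (lt_div_iff₀ hq0).1 ht
    simp only [bval]; push_cast
    nlinarith
  -- Both `g_1(t)` and `g_2(t)` are chord slopes of the logarithm starting at `t`; the chord for
  -- `g_1` is longer, hence flatter by concavity.
  have h := strictConcaveOn_log_Ioi.slope_anti_adjacent (x := t) (y := bval q 2 t)
    (z := bval q 1 t) h0 (h0.trans (h2.trans h12)) h2 h12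
  rw [div_lt_div_iff₀ (by linarith) (by linarith)] at h ⊢
  nlinarith

/-- The potential along the segment `t ↦ twoValued A t`, `A.card = i`. -/
noncomputable def fLine (q i : ℕ) (β t : ℝ) : ℝ :=
  i * phi β (bval q i t) + ((q : ℝ) - i) * phi β t

lemma sum_twoValued {q : ℕ} (A : Finset (Fin q)) (t : ℝ) (f : ℝ → ℝ) :
    ∑ k, f (twoValued A t k) =
      A.card * f (bval q A.card t) + ((q : ℝ) - A.card) * f t := by
  have h1 : ∀ k, f (twoValued A t k) =
      (if k ∈ A then f (bval q A.card t) - f t else 0) + f t := by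
    intro k
    by_cases h : k ∈ A <;> simp [twoValued, h, bval]
  simp only [h1, Finset.sum_add_distrib, Finset.sum_ite_mem, Finset.univ_inter, Finset.sum_const,
    Finset.card_univ, Fintype.card_fin, nsmul_eq_mul]
  ring

lemma potential_twoValued {q : ℕ} (β : ℝ) (A : Finset (Fin q)) (t : ℝ) :
    potential β (twoValued A t) = fLine q A.card β t := by
  rw [potential_eq_sum, sum_twoValued A t (phi β), fLine]

lemma card_lastSpins {q i : ℕ} (hi : i ≤ q) : (lastSpins q i).card = i := by
  have h := Fin.card_filter_val_lt (n := q) (m := q - i)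
  have h2 := Finset.card_filter_add_card_filter_not (s := (Finset.univ : Finset (Fin q)))
    (fun m : Fin q => (m : ℕ) < q - i)
  rw [Finset.card_univ, Fintype.card_fin] at h2
  have h3 : (Finset.univ.filter fun m : Fin q => ¬ (m : ℕ) < q - i) = lastSpins q i := by
    ext m; simp only [lastSpins, Finset.mem_filter, Finset.mem_univ, true_and]; omega
  rw [h3] at h2
  have : (Finset.univ.filter fun m : Fin q => (m : ℕ) < q - i).card = q - i := by
    rw [h]; omega
  omega

lemma heightV1_eq {q : ℕ} (hq : 5 ≤ q) (β : ℝ) : heightV1 q β = fLine q 1 β (vSol q 1 β) := by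
  rw [heightV1, potential_twoValued, card_lastSpins (by omega)]

lemma heightU2_eq {q : ℕ} (hq : 5 ≤ q) (β : ℝ) : heightU2 q β = fLine q 2 β (uSol q 2 β) := by
  rw [heightU2, potential_twoValued, card_lastSpins (by omega)]

lemma potential_v1Point {q : ℕ} (hq : 5 ≤ q) (β : ℝ) (k : Fin q) :
    potential β (v1Point β k) = heightV1 q β := by
  rw [v1Point, potential_twoValued, heightV1_eq hq, Finset.card_singleton]

lemma potential_u2Point {q : ℕ} (hq : 5 ≤ q) (β : ℝ) {k l : Fin q} (hkl : k ≠ l) :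
    potential β (u2Point β k l) = heightU2 q β := by
  rw [u2Point, potential_twoValued, heightU2_eq hq, Finset.card_pair hkl]

lemma twoValued_inv {q : ℕ} {A : Finset (Fin q)} (hA : A.Nonempty) :
    twoValued A (1 / (q : ℝ)) = pPoint q := by
  obtain ⟨k, hk⟩ := hA
  have hq : (q : ℝ) ≠ 0 := by
    have := Fin.pos k
    exact_mod_cast this.ne'
  have hA : (A.card : ℝ) ≠ 0 := by exact_mod_cast (Finset.card_pos.2 ⟨k, hk⟩).ne'
  ext m
  by_cases h : m ∈ A
  · simp only [twoValued, h, if_true, pPoint]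
    field_simp; ring
  · simp [twoValued, h, pPoint]

lemma potential_pPoint {q i : ℕ} (hi : 0 < i) (hq : i ≤ q) (β : ℝ) :
    potential β (pPoint q) = fLine q i β (1 / (q : ℝ)) := by
  have hc := card_lastSpins hq
  rw [← twoValued_inv (A := lastSpins q i) (Finset.card_pos.1 (by omega)), potential_twoValued, hc]

lemma twoValued_mem_stdSimplex {q : ℕ} {A : Finset (Fin q)} (hA : A.Nonempty) (hAq : A.card < q)
    {t : ℝ} (ht : t ∈ gDomain q A.card) : twoValued A t ∈ stdSimplex ℝ (Fin q) := by
  have hA0 := Finset.card_pos.2 hA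
  have hA1 : (A.card : ℝ) ≠ 0 := by exact_mod_cast hA0.ne'
  refine ⟨fun k => ?_, ?_⟩
  · by_cases h : k ∈ A
    · simpa [twoValued, h, bval] using (bval_pos hA0 hAq ht).le
    · simpa [twoValued, h] using ht.1.le
  · have := sum_twoValued A t id
    simp only [id] at this
    rw [this, bval]; field_simp; ring

lemma continuous_twoValued {q : ℕ} (A : Finset (Fin q)) :
    Continuous fun t : ℝ => twoValued A t := by
  refine continuous_pi fun k => ?_
  by_cases h : k ∈ A
  · simp only [twoValued, h, if_true]; fun_prop
  · simp only [twoValued, h, if_false]; fun_prop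

lemma continuous_bval (q i : ℕ) : Continuous (bval q i) := by
  unfold bval; fun_prop

lemma continuous_fLine (q i : ℕ) (β : ℝ) : Continuous (fLine q i β) := by
  have h1 := continuous_bval q i
  have h2 := continuous_phi β
  unfold fLine
  fun_prop

lemma hasDerivAt_fLine {q i : ℕ} (hi : 0 < i) (hq : i < q) {t : ℝ} (ht : t ∈ gDomain q i)
    (β : ℝ) :
    HasDerivAt (fLine q i β) (((q : ℝ) - i) * (dphi β t - dphi β (bval q i t))) t := by
  have hi0 : (i : ℝ) ≠ 0 := by exact_mod_cast hi.ne'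
  have h1 : HasDerivAt (bval q i) (-((q : ℝ) - i) / i) t := by
    have := (((hasDerivAt_id t).const_mul ((q : ℝ) - i)).const_sub 1).div_const (i : ℝ)
    exact this.congr_deriv (by ring)
  have h2 := ((hasDerivAt_phi β (bval_pos hi hq ht).ne').comp t h1).const_mul (i : ℝ)
  have h3 := (hasDerivAt_phi β ht.1.ne').const_mul ((q : ℝ) - i)
  refine (h2.add h3).congr_deriv ?_
  field_simp
  ring

section Monotone

variable {q i : ℕ} {β s t : ℝ}

lemma deriv_fLine (hi : 0 < i) (hq : i < q) (hβ : 0 < β) (ht : t ∈ gDomain q i)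
    (hne : t ≠ 1 / (q : ℝ)) : deriv (fLine q i β) t =
      ((q : ℝ) - i) * ((bval q i t - t) * ((β - g q i t) / β)) := by
  rw [(hasDerivAt_fLine hi hq ht β).deriv, dphi_sub_dphi_bval hi hq ht hne hβ]

/-- Left of `1 / q` we have `t < bval q i t`, so the derivative of `fLine` has the sign of `β - g q
i t`. -/
lemma fLine_lt_of_g_lt (hi : 0 < i) (hq : i < q) (hβ : 0 < β) (hs : 0 ≤ s) (hst : s < t)
    (ht : t ≤ 1 / (q : ℝ)) (h : ∀ r ∈ Set.Ioo s t, g q i r < β) :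
    fLine q i β s < fLine q i β t := by
  have hqi : (0 : ℝ) < (q : ℝ) - i := sub_pos.2 (by exact_mod_cast hq)
  have : StrictMonoOn (fLine q i β) (Set.Icc s t) := by
    refine strictMonoOn_of_deriv_pos (convex_Icc _ _) (continuous_fLine q i β).continuousOn ?_
    intro r hr
    rw [interior_Icc] at hr
    have hr1 := hr.2.trans_le ht
    rw [deriv_fLine hi hq hβ (mem_gDomain_of_lt_inv hi hq (hs.trans_lt hr.1) hr1) hr1.ne]
    exact mul_pos hqi (mul_pos (sub_pos.2 (lt_bval hi hq hr1)) (div_pos (sub_pos.2 (h r hr)) hβ))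
  exact this ⟨le_rfl, hst.le⟩ ⟨hst.le, le_rfl⟩ hst

lemma fLine_lt_of_lt_g (hi : 0 < i) (hq : i < q) (hβ : 0 < β) (hs : 0 ≤ s) (hst : s < t)
    (ht : t ≤ 1 / (q : ℝ)) (h : ∀ r ∈ Set.Ioo s t, β < g q i r) :
    fLine q i β t < fLine q i β s := by
  have hqi : (0 : ℝ) < (q : ℝ) - i := sub_pos.2 (by exact_mod_cast hq)
  have : StrictAntiOn (fLine q i β) (Set.Icc s t) := by
    refine strictAntiOn_of_deriv_neg (convex_Icc _ _) (continuous_fLine q i β).continuousOn ?_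
    intro r hr
    rw [interior_Icc] at hr
    have hr1 := hr.2.trans_le ht
    rw [deriv_fLine hi hq hβ (mem_gDomain_of_lt_inv hi hq (hs.trans_lt hr.1) hr1) hr1.ne]
    exact mul_neg_of_pos_of_neg hqi (mul_neg_of_pos_of_neg (sub_pos.2 (lt_bval hi hq hr1))
      (div_neg_of_neg_of_pos (sub_neg.2 (h r hr)) hβ))
  exact this ⟨le_rfl, hst.le⟩ ⟨hst.le, le_rfl⟩ hst

/-- Right of `1 / q` the factor `bval q i t - t` is negative, which reverses the previous rule. -/
lemma fLine_lt_of_inv_le (hi : 0 < i) (hq : i < q) (hβ : 0 < β) (hs : 1 / (q : ℝ) ≤ s)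
    (hst : s < t) (ht : t ∈ gDomain q i) (h : ∀ r ∈ Set.Ioo s t, g q i r < β) :
    fLine q i β t < fLine q i β s := by
  have hqi : (0 : ℝ) < (q : ℝ) - i := sub_pos.2 (by exact_mod_cast hq)
  have hi0 : (0 : ℝ) < i := by exact_mod_cast hi
  have hinv := inv_mem_gDomain hi hq
  have hq0 : (0 : ℝ) < q := by exact_mod_cast hi.trans hq
  have : StrictAntiOn (fLine q i β) (Set.Icc s t) := by
    refine strictAntiOn_of_deriv_neg (convex_Icc _ _) (continuous_fLine q i β).continuousOn ?_
    intro r hr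
    rw [interior_Icc] at hr
    have hr1 := hs.trans_lt hr.1
    have hr2 : bval q i r - r < 0 := by
      rw [bval_sub hi]
      have := (div_lt_iff₀ hq0).1 hr1
      exact div_neg_of_neg_of_pos (by linarith) hi0
    rw [deriv_fLine hi hq hβ ⟨hinv.1.trans hr1, hr.2.trans ht.2⟩ hr1.ne']
    exact mul_neg_of_pos_of_neg hqi (mul_neg_of_neg_of_pos hr2 (div_pos (sub_pos.2 (h r hr)) hβ))
  exact this ⟨le_rfl, hst.le⟩ ⟨hst.le, le_rfl⟩ hst

end Monotone

/-! ### Mass transfers in the simplex -/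

section Shift

variable {q : ℕ}

/-- Transfer of the mass `s` to the coordinate `j`, taken in equal parts from those in `A`. -/
noncomputable def shift (x : Fin q → ℝ) (j : Fin q) (A : Finset (Fin q)) (s : ℝ) : Fin q → ℝ :=
  fun m => if m = j then x m + s else if m ∈ A then x m - s / A.card else x m

lemma continuous_shift (x : Fin q → ℝ) (j : Fin q) (A : Finset (Fin q)) :
    Continuous (shift x j A) := by
  refine continuous_pi fun m => ?_
  unfold shift
  split_ifs <;> fun_prop

lemma shift_zero (x : Fin q → ℝ) (j : Fin q) (A : Finset (Fin q)) : shift x j A 0 = x := by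
  ext m; simp [shift]

lemma sum_shift (f : ℝ → ℝ) {x : Fin q → ℝ} {j : Fin q} {A : Finset (Fin q)} (hj : j ∉ A) {b : ℝ}
    (hb : ∀ k ∈ A, x k = b) (s : ℝ) :
    ∑ m, f (shift x j A s m) =
      ∑ m, f (x m) + (f (x j + s) + A.card * f (b - s / A.card) - (f (x j) + A.card * f b)) := by
  have h : ∀ m, f (shift x j A s m) = f (x m) + (if m = j then f (x j + s) - f (x j) else 0) +
      (if m ∈ A then f (b - s / A.card) - f b else 0) := by
    intro m
    by_cases h1 : m = j
    · subst h1; simp [shift, hj]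
    · by_cases h2 : m ∈ A
      · simp [shift, h1, h2, hb m h2]
      · simp [shift, h1, h2]
  simp only [h, Finset.sum_add_distrib, Finset.sum_ite_mem, Finset.univ_inter, Finset.sum_const,
    Finset.sum_ite_eq', Finset.mem_univ, if_true, nsmul_eq_mul]
  ring

lemma sum_shift_id {x : Fin q → ℝ} {j : Fin q} {A : Finset (Fin q)} (hj : j ∉ A)
    (hA : A.Nonempty) {b : ℝ} (hb : ∀ k ∈ A, x k = b) (s : ℝ) :
    ∑ m, shift x j A s m = ∑ m, x m := by
  have hA1 : (A.card : ℝ) ≠ 0 := by exact_mod_cast (Finset.card_pos.2 hA).ne'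
  have := sum_shift id hj hb s
  simp only [id] at this
  rw [this]; field_simp; ring

lemma potential_shift (β : ℝ) {x : Fin q → ℝ} {j : Fin q} {A : Finset (Fin q)} (hj : j ∉ A)
    {b : ℝ} (hb : ∀ k ∈ A, x k = b) (s : ℝ) :
    potential β (shift x j A s) = potential β x + (phi β (x j + s) +
      A.card * phi β (b - s / A.card) - (phi β (x j) + A.card * phi β b)) := by
  rw [potential_eq_sum, potential_eq_sum, sum_shift (phi β) hj hb]

/-- If mass can be moved to a coordinate then it is moved down the slope of the potential. -/
lemma eventually_shift_lt {β : ℝ} (hβ : 0 < β) {x : Fin q → ℝ} {j : Fin q} {A : Finset (Fin q)}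
    (hj : j ∉ A) (hA : A.Nonempty) {b : ℝ} (hb : ∀ k ∈ A, x k = b) (hb0 : 0 < b)
    (h : x j = 0 ∨ 0 < x j ∧ dphi β (x j) < dphi β b) :
    ∀ᶠ s in nhdsWithin (0 : ℝ) (Set.Ioi 0), potential β (shift x j A s) < potential β x := by
  have hA1 : (0 : ℝ) < A.card := by exact_mod_cast Finset.card_pos.2 hA
  filter_upwards [transfer_lt hβ hA1 hb0 h] with s hs
  rw [potential_shift β hj hb]
  linarith

lemma eventually_shift_neg_lt {β : ℝ} (hβ : 0 < β) {x : Fin q → ℝ} {j : Fin q}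
    {A : Finset (Fin q)} (hj : j ∉ A) (hA : A.Nonempty) {b : ℝ} (hb : ∀ k ∈ A, x k = b)
    (hb0 : 0 < b) (hj0 : 0 < x j) (h : dphi β b < dphi β (x j) ∨ x j = b ∧ 1 / β < b) :
    ∀ᶠ s in nhdsWithin (0 : ℝ) (Set.Ioi 0), potential β (shift x j A (-s)) < potential β x := by
  have hA1 : (0 : ℝ) < A.card := by exact_mod_cast Finset.card_pos.2 hA
  rcases h with h | ⟨h, h1⟩
  · have hlim : Filter.Tendsto (fun s : ℝ => s / A.card) (nhdsWithin 0 (Set.Ioi 0))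
        (nhdsWithin 0 (Set.Ioi 0)) := by
      refine tendsto_nhdsWithin_iff.2 ⟨?_, ?_⟩
      · have : Continuous fun s : ℝ => s / A.card := by fun_prop
        simpa using (this.tendsto 0).mono_left nhdsWithin_le_nhds
      · filter_upwards [self_mem_nhdsWithin] with s hs
        exact div_pos hs hA1
    -- The roles are exchanged: each member of `A` receives `s / A.card` from `j`. Per member of
    -- `A`, the donor `j` counts with weight `1 / A.card`.
    have := hlim.eventually (transfer_lt hβ (n := 1 / (A.card : ℝ)) (by positivity) hj0
      (Or.inr ⟨hb0, h⟩))
    filter_upwards [this] with s hs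
    rw [potential_shift β hj hb]
    rw [show s / (A.card : ℝ) / (1 / A.card) = s by field_simp] at hs
    have e := mul_lt_mul_of_pos_left hs hA1
    have e1 : ∀ c d : ℝ, (A.card : ℝ) * (c + 1 / A.card * d) = A.card * c + d := by
      intro c d; field_simp
    rw [e1, e1] at e
    rw [neg_div, sub_neg_eq_add, ← sub_eq_add_neg]
    linarith
  · filter_upwards [split_lt hβ hA1 h1] with s hs
    rw [potential_shift β hj hb, neg_div, sub_neg_eq_add, h, ← sub_eq_add_neg]
    linarith

lemma shift_mem_stdSimplex {x : Fin q → ℝ} (hx : x ∈ stdSimplex ℝ (Fin q)) {j : Fin q}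
    {A : Finset (Fin q)} (hj : j ∉ A) (hA : A.Nonempty) {b : ℝ} (hb : ∀ k ∈ A, x k = b)
    {s : ℝ} (h1 : 0 ≤ x j + s) (h2 : 0 ≤ b - s / A.card) :
    shift x j A s ∈ stdSimplex ℝ (Fin q) := by
  refine ⟨fun m => ?_, (sum_shift_id hj hA hb s).trans hx.2⟩
  unfold shift
  split_ifs with h3 h4
  · rw [h3]; exact h1
  · rw [hb m h4]; exact h2
  · exact hx.1 m

end Shift

/-! ### Local minima of the potential -/

section LocalMin

variable {q : ℕ} {β : ℝ}

lemma tendsto_shift (x : Fin q → ℝ) (j : Fin q) (A : Finset (Fin q)) (σ : ℝ) :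
    Filter.Tendsto (fun s => shift x j A (σ * s)) (nhdsWithin (0 : ℝ) (Set.Ioi 0)) (nhds x) := by
  have h : Continuous fun s => shift x j A (σ * s) :=
    (continuous_shift x j A).comp (continuous_const.mul continuous_id)
  have := (h.tendsto 0).mono_left (nhdsWithin_le_nhds (s := Set.Ioi 0))
  simpa [shift_zero] using this

/-- Every component of a sublevel set contains a local minimum. -/
lemma exists_isLocalMinOn (β h : ℝ) {x : Fin q → ℝ} (hx : x ∈ sublevel q β h) :
    ∃ y ∈ connectedComponentIn (sublevel q β h) x,
      IsLocalMinOn (potential β) (stdSimplex ℝ (Fin q)) y := by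
  set K := connectedComponentIn (sublevel q β h) x with hK
  have hxK : x ∈ K := mem_connectedComponentIn hx
  have hKs : K ⊆ sublevel q β h := connectedComponentIn_subset _ _
  have hcl : closure K ⊆ stdSimplex ℝ (Fin q) :=
    closure_minimal (fun z hz => (hKs hz).1) (isClosed_stdSimplex ℝ (Fin q))
  have hcomp : IsCompact (closure K) :=
    (isCompact_stdSimplex ℝ (Fin q)).of_isClosed_subset isClosed_closure hcl
  have hne : (closure K).Nonempty := ⟨x, subset_closure hxK⟩
  obtain ⟨y, hy, hmin⟩ := hcomp.exists_isMinOn hne (continuous_potential β).continuousOn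
  have hyF : potential β y < h := (hmin (subset_closure hxK)).trans_lt (hKs hxK).2
  have hpre : IsPreconnected K := isPreconnected_connectedComponentIn
  have hys : y ∈ sublevel q β h := ⟨hcl hy, hyF⟩
  -- The minimiser over the closure still lies strictly below the level `h`, so adjoining it keeps a
  -- preconnected subset of the sublevel set.
  have hyK : y ∈ K := by
    have h1 : IsPreconnected (insert y K) :=
      hpre.subset_closure (Set.subset_insert _ _) (Set.insert_subset hy subset_closure)
    exact h1.subset_connectedComponentIn (Set.mem_insert_of_mem _ hxK)
      (Set.insert_subset hys hKs) (Set.mem_insert _ _)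
  refine ⟨y, hyK, ?_⟩
  have hopen : {z | potential β z < h} ∈ nhds y :=
    (isOpen_lt (continuous_potential β) continuous_const).mem_nhds hyF
  obtain ⟨ε, hε, hball⟩ := Metric.mem_nhds_iff.1 hopen
  have hsub : Metric.ball y ε ∩ stdSimplex ℝ (Fin q) ⊆ K := by
    have hc : IsPreconnected (Metric.ball y ε ∩ stdSimplex ℝ (Fin q)) :=
      ((convex_ball y ε).inter (convex_stdSimplex ℝ (Fin q))).isPreconnected
    have h2 := hc.subset_connectedComponentIn (F := sublevel q β h)
      ⟨Metric.mem_ball_self hε, hcl hy⟩ (fun z hz => ⟨hz.2, hball hz.1⟩)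
    rwa [← connectedComponentIn_eq hyK] at h2
  have : Metric.ball y ε ∩ stdSimplex ℝ (Fin q) ∈ nhdsWithin y (stdSimplex ℝ (Fin q)) :=
    Filter.inter_mem (mem_nhdsWithin_of_mem_nhds (Metric.ball_mem_nhds y hε)) self_mem_nhdsWithin
  filter_upwards [this] with z hz
  exact hmin (subset_closure (hsub hz))

/-- A point of the simplex with one value on `A` and another one off `A`. -/
lemma eq_twoValued_of_eq {y : Fin q → ℝ} (hy : ∑ k, y k = 1) {A : Finset (Fin q)}
    (hA : A.Nonempty) {a t : ℝ} (h1 : ∀ k ∈ A, y k = a) (h2 : ∀ k ∉ A, y k = t) :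
    a = bval q A.card t ∧ y = twoValued A t := by
  have hA1 : (A.card : ℝ) ≠ 0 := by exact_mod_cast (Finset.card_pos.2 hA).ne'
  have h : ∀ k, y k = (if k ∈ A then a - t else 0) + t := by
    intro k
    by_cases hk : k ∈ A
    · simp [hk, h1 k hk]
    · simp [hk, h2 k hk]
  have hs : (A.card : ℝ) * (a - t) + q * t = 1 := by
    rw [← hy]
    simp only [h, Finset.sum_add_distrib, Finset.sum_ite_mem, Finset.univ_inter, Finset.sum_const,
      nsmul_eq_mul, Finset.card_univ, Fintype.card_fin]
  have ha : a = bval q A.card t := by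
    rw [bval]; field_simp; linarith
  refine ⟨ha, ?_⟩
  ext k
  by_cases hk : k ∈ A
  · simp only [twoValued, hk, if_true]
    rw [h1 k hk, ha, bval]
  · simp [twoValued, hk, h2 k hk]

lemma exists_pos_of_mem_stdSimplex {y : Fin q → ℝ} (hy : y ∈ stdSimplex ℝ (Fin q)) :
    ∃ k, 0 < y k := by
  by_contra hc
  push Not at hc
  have : ∑ k, y k ≤ 0 := Finset.sum_nonpos fun k _ => hc k
  rw [hy.2] at this
  linarith

lemma g_eq_of_dphi_eq {i : ℕ} (hi : 0 < i) (hq : i < q) (hβ : 0 < β) {t : ℝ}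
    (ht : t ∈ gDomain q i) (hne : t ≠ 1 / (q : ℝ)) (hb : t ≠ bval q i t)
    (h : dphi β t = dphi β (bval q i t)) : g q i t = β := by
  have := dphi_sub_dphi_bval hi hq ht hne hβ
  rw [h, sub_self, eq_comm, mul_eq_zero, div_eq_zero_iff] at this
  rcases this with h1 | h1 | h1
  · exact absurd (sub_eq_zero.1 h1).symm hb
  · linarith
  · exact absurd h1 hβ.ne'

/-- Solutions of `g_i(t) = β` are critical along the segment. At `t = 1 / q` the two values
coincide, so the slopes agree for that reason alone. -/
lemma dphi_eq_of_g_eq {i : ℕ} (hi : 0 < i) (hq : i < q) (hβ : 0 < β) {t : ℝ}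
    (ht : t ∈ gDomain q i) (h : g q i t = β) : dphi β t = dphi β (bval q i t) := by
  by_cases hne : t = 1 / (q : ℝ)
  · have hi0 : (i : ℝ) ≠ 0 := by exact_mod_cast hi.ne'
    have hq0 : (q : ℝ) ≠ 0 := by exact_mod_cast (hi.trans hq).ne'
    have : bval q i t - t = 0 := by
      rw [bval_sub hi, hne]; field_simp; simp
    rw [sub_eq_zero.1 this]
  · have := dphi_sub_dphi_bval hi hq ht hne hβ
    rw [h, sub_self, zero_div, mul_zero] at this
    exact sub_eq_zero.1 this

/-- The parameter of a point of the simplex with two values `t < a`. -/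
lemma lt_inv_of_lt_bval {i : ℕ} (hi : 0 < i) (hq : i < q) {t : ℝ} (h : t < bval q i t) :
    t < 1 / (q : ℝ) := by
  have hi0 : (0 : ℝ) < i := by exact_mod_cast hi
  have hq0 : (0 : ℝ) < q := by exact_mod_cast hi.trans hq
  have h1 := bval_sub (q := q) hi t
  rw [lt_div_iff₀ hq0]
  by_contra hc
  have : (1 - q * t) / (i : ℝ) ≤ 0 := div_nonpos_of_nonpos_of_nonneg (by linarith) hi0.le
  linarith

/-- The local minima of the potential. -/
lemma localMin_cases (hq : 2 ≤ q) (hβ : 0 < β) {y : Fin q → ℝ} (hy : y ∈ stdSimplex ℝ (Fin q))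
    (hmin : IsLocalMinOn (potential β) (stdSimplex ℝ (Fin q)) y) :
    y = pPoint q ∨ ∃ k t, 0 < t ∧ t < 1 / (q : ℝ) ∧ g q 1 t = β ∧ y = twoValued {k} t := by
  have hnot : ∀ j k : Fin q, ∀ σ : ℝ, (∀ᶠ s in nhdsWithin (0 : ℝ) (Set.Ioi 0),
      shift y j {k} (σ * s) ∈ stdSimplex ℝ (Fin q)) →
      ¬ ∀ᶠ s in nhdsWithin (0 : ℝ) (Set.Ioi 0),
        potential β (shift y j {k} (σ * s)) < potential β y := by
    intro j k σ h1 h2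
    have h3 := tendsto_nhdsWithin_iff.2 ⟨tendsto_shift y j {k} σ, h1⟩
    obtain ⟨s, hs1, hs2⟩ := (h2.and (h3.eventually hmin)).exists
    exact absurd hs1 (not_lt.2 hs2)
  have hdown : ∀ j k : Fin q, j ≠ k → 0 < y k →
      ¬ (y j = 0 ∨ 0 < y j ∧ dphi β (y j) < dphi β (y k)) := by
    intro j k hjk hk h
    have hj : j ∉ ({k} : Finset (Fin q)) := by simpa using hjk
    have hb : ∀ m ∈ ({k} : Finset (Fin q)), y m = y k := by simp
    refine hnot j k 1 ?_ ?_
    · filter_upwards [Ioo_mem_nhdsGT hk] with s hs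
      refine shift_mem_stdSimplex hy hj (Finset.singleton_nonempty k) hb ?_ ?_
      · linarith [hy.1 j, hs.1]
      · simp; linarith [hs.2]
    · simpa using eventually_shift_lt hβ hj (Finset.singleton_nonempty k) hb hk h
  obtain ⟨k₀, hk₀⟩ := exists_pos_of_mem_stdSimplex hy
  have hpos : ∀ j, 0 < y j := by
    intro j
    by_cases hjk : j = k₀
    · rwa [hjk]
    · exact (hy.1 j).lt_of_ne fun h => hdown j k₀ hjk hk₀ (Or.inl h.symm)
  have heq : ∀ j k, dphi β (y j) = dphi β (y k) := by
    intro j k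
    by_cases hjk : j = k
    · rw [hjk]
    · rcases lt_trichotomy (dphi β (y j)) (dphi β (y k)) with h | h | h
      · exact absurd (Or.inr ⟨hpos j, h⟩) (hdown j k hjk (hpos k))
      · exact h
      · exact absurd (Or.inr ⟨hpos k, h⟩) (hdown k j (Ne.symm hjk) (hpos j))
  by_cases hbig : ∃ k, 1 / β < y k
  · right
    obtain ⟨k, hk⟩ := hbig
    -- Two coordinates above `1 / β` with equal slope are equal, and moving mass from one to the
    -- other would lower the potential.
    have hsmall : ∀ j, j ≠ k → y j ≤ 1 / β := by
      intro j hjk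
      by_contra hc
      push Not at hc
      have hjk' : y j = y k := (dphi_strictAntiOn hβ).injOn hc.le hk.le (heq j k)
      have hj : j ∉ ({k} : Finset (Fin q)) := by simpa using hjk
      have hb : ∀ m ∈ ({k} : Finset (Fin q)), y m = y k := by simp
      refine hnot j k (-1) ?_ ?_
      · filter_upwards [Ioo_mem_nhdsGT (hpos j)] with s hs
        refine shift_mem_stdSimplex hy hj (Finset.singleton_nonempty k) hb ?_ ?_
        · linarith [hs.2]
        · simp; linarith [hs.1, hpos k]
      · simpa using eventually_shift_neg_lt hβ hj (Finset.singleton_nonempty k) hb (hpos k)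
          (hpos j) (Or.inr ⟨hjk', hk⟩)
    obtain ⟨j, hjk⟩ : ∃ j : Fin q, j ≠ k := by
      have : Nontrivial (Fin q) := Fin.nontrivial_iff_two_le.2 hq
      exact exists_ne k
    have hall : ∀ m ∉ ({k} : Finset (Fin q)), y m = y j := by
      intro m hm
      exact (dphi_strictMonoOn hβ).injOn ⟨hpos m, hsmall m (by simpa using hm)⟩
        ⟨hpos j, hsmall j hjk⟩ (heq m j)
    obtain ⟨h1, h2⟩ := eq_twoValued_of_eq hy.2 (Finset.singleton_nonempty k) (a := y k)
      (by simp) hall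
    rw [Finset.card_singleton] at h1
    have hlt : y j < bval q 1 (y j) := h1 ▸ (hsmall j hjk).trans_lt hk
    have hinv := lt_inv_of_lt_bval one_pos (by omega) hlt
    refine ⟨k, y j, hpos j, hinv, ?_, h2⟩
    exact g_eq_of_dphi_eq one_pos (by omega) hβ (mem_gDomain_of_lt_inv one_pos (by omega)
      (hpos j) hinv) hinv.ne hlt.ne (h1 ▸ heq j k)
  · left
    push Not at hbig
    have hall : ∀ m, y m = y k₀ := fun m =>
      (dphi_strictMonoOn hβ).injOn ⟨hpos m, hbig m⟩ ⟨hpos k₀, hbig k₀⟩ (heq m k₀)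
    have hs := hy.2
    simp only [hall, Finset.sum_const, Finset.card_univ, Fintype.card_fin, nsmul_eq_mul] at hs
    ext m
    rw [hall m, pPoint]
    have : (q : ℝ) ≠ 0 := by positivity
    field_simp; linarith

end LocalMin

/-! ### The two barriers: fixed maximal coordinate, and tied maximum -/

section Barrier

variable {q : ℕ} {β : ℝ}

/-- Among the points whose largest coordinate is the upper value of `v_1`, those of `𝒱_1` have the
lowest potential. -/
lemma fLine_le_potential (hq : 2 ≤ q) (hβ : 0 < β) {v : ℝ} (hv0 : 0 < v) (hv : v < 1 / (q : ℝ))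
    (hg : g q 1 v = β) {x : Fin q → ℝ} (hx : x ∈ stdSimplex ℝ (Fin q)) {k : Fin q}
    (hk : x k = bval q 1 v) (hmax : ∀ j, x j ≤ bval q 1 v) :
    fLine q 1 β v ≤ potential β x ∧ (potential β x = fLine q 1 β v → x = twoValued {k} v) := by
  have hdom := mem_gDomain_of_lt_inv one_pos (by omega : 1 < q) hv0 hv
  have hd := dphi_eq_of_g_eq one_pos (by omega) hβ hdom hg
  have hlt := lt_bval one_pos (by omega : 1 < q) hv
  set c := bval q 1 v with hc
  have hcv : c + ((q : ℝ) - 1) * v = 1 := by rw [hc, bval]; push_cast; ring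
  -- The gap between `phi` and its tangent at `v`. Since the coordinates sum to `1`, the linear
  -- terms cancel and the excess over `F(v_1)` is the sum of these gaps over `j ≠ k`.
  set d : Fin q → ℝ := fun j =>
    (phi β (x j) - dphi β v * x j) - (phi β v - dphi β v * v) with hdd
  have hd0 : ∀ j, 0 ≤ d j := by
    intro j
    by_cases h : x j = v
    · simp [hdd, h]
    · have := phi_tangent hβ hv0 hlt hd (hx.1 j) (hmax j) h
      simp only [hdd]; linarith
  have hsum : potential β x - fLine q 1 β v = ∑ j ∈ Finset.univ.erase k, d j := by
    have h1 : ∑ j, d j = potential β x - dphi β v - q * (phi β v - dphi β v * v) := by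
      simp only [hdd, Finset.sum_sub_distrib, ← Finset.mul_sum, hx.2, potential_eq_sum,
        Finset.sum_const, Finset.card_univ, Fintype.card_fin, nsmul_eq_mul]
      ring
    have h2 := Finset.add_sum_erase Finset.univ d (Finset.mem_univ k)
    have h3 : d k = (phi β c - dphi β v * c) - (phi β v - dphi β v * v) := by
      simp only [hdd, hk]
    rw [fLine, ← hc]
    push_cast
    have h4 : dphi β v * (c + ((q : ℝ) - 1) * v) = dphi β v := by rw [hcv, mul_one]
    linarith
  have hnn : 0 ≤ ∑ j ∈ Finset.univ.erase k, d j := Finset.sum_nonneg fun j _ => hd0 j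
  refine ⟨by linarith, fun h => ?_⟩
  rw [h, sub_self] at hsum
  have hz := (Finset.sum_eq_zero_iff_of_nonneg fun j _ => hd0 j).1 hsum.symm
  refine (eq_twoValued_of_eq hx.2 (Finset.singleton_nonempty k) (a := c) (by simpa using hk) ?_).2
  intro j hj
  by_contra hne
  have := phi_tangent hβ hv0 hlt hd (hx.1 j) (hmax j) hne
  have h5 := hz j (by simpa using hj)
  simp only [hdd] at h5
  linarith

/-- The points of the simplex with two equal largest coordinates `k`, `l` of size at least `c`. -/
def tieSet (c : ℝ) (k l : Fin q) : Set (Fin q → ℝ) :=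
  {x | x ∈ stdSimplex ℝ (Fin q) ∧ x k = x l ∧ (∀ j, x j ≤ x k) ∧ c ≤ x k}

lemma isCompact_tieSet (c : ℝ) (k l : Fin q) : IsCompact (tieSet c k l) := by
  refine (isCompact_stdSimplex ℝ (Fin q)).of_isClosed_subset ?_ fun x hx => hx.1
  have h : IsClosed {x : Fin q → ℝ | ∀ j, x j ≤ x k} := by
    rw [Set.ofPred_forall]
    exact isClosed_iInter fun j => isClosed_le (continuous_apply j) (continuous_apply k)
  exact (isClosed_stdSimplex ℝ (Fin q)).inter ((isClosed_eq (continuous_apply k)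
    (continuous_apply l)).inter (h.inter (isClosed_le continuous_const (continuous_apply k))))

/-- The minimisers of the potential on `tieSet c k l`. -/
lemma isMinOn_tieSet_cases (hq : 3 ≤ q) (hβ : 0 < β) {c : ℝ} (hc : 1 / β ≤ c) {k l : Fin q}
    (hkl : k ≠ l) {y : Fin q → ℝ} (hy : y ∈ tieSet c k l)
    (hmin : IsMinOn (potential β) (tieSet c k l) y) :
    y k = c ∨ ∃ t, 0 < t ∧ t < 1 / (q : ℝ) ∧ g q 2 t = β ∧ y = twoValued {k, l} t := by
  obtain ⟨hys, hykl, hmax, hck⟩ := hy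
  rcases hck.eq_or_lt with h | hlt
  · exact Or.inl h.symm
  right
  have hβ0 : 0 < 1 / β := by positivity
  have ha : 1 / β < y k := hc.trans_lt hlt
  have ha0 : 0 < y k := hβ0.trans ha
  set A : Finset (Fin q) := {k, l} with hA
  have hAc : A.card = 2 := Finset.card_pair hkl
  have hAn : A.Nonempty := ⟨k, by simp [hA]⟩
  have hb : ∀ m ∈ A, y m = y k := by
    intro m hm
    rcases Finset.mem_insert.1 hm with h | h
    · rw [h]
    · rw [Finset.mem_singleton.1 h, hykl]
  have hmemk : k ∈ A := by simp [hA]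
  have hmeml : l ∈ A := by simp [hA]
  have hne : ∀ j ∉ A, j ≠ k ∧ j ≠ l := by
    intro j hj
    simpa [hA, not_or] using hj
  have hshk : ∀ j ∉ A, ∀ s, shift y j A s k = y k - s / 2 := by
    intro j hj s
    simp [shift, (hne j hj).1.symm, hmemk, hAc]
  have hshl : ∀ j ∉ A, ∀ s, shift y j A s l = y k - s / 2 := by
    intro j hj s
    simp [shift, (hne j hj).2.symm, hmeml, hAc, hykl]
  have hnot : ∀ j : Fin q, ∀ σ : ℝ, (∀ᶠ s in nhdsWithin (0 : ℝ) (Set.Ioi 0),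
      shift y j A (σ * s) ∈ tieSet c k l) →
      ¬ ∀ᶠ s in nhdsWithin (0 : ℝ) (Set.Ioi 0),
        potential β (shift y j A (σ * s)) < potential β y := by
    intro j σ h1 h2
    obtain ⟨s, hs1, hs2⟩ := (h2.and h1).exists
    exact absurd hs1 (not_lt.2 (hmin hs2))
  -- A third coordinate equal to the maximum could be lowered in favour of the pair: the tie and the
  -- bound `c` survive, while concavity above `1 / β` makes the potential drop.
  have hlow : ∀ j ∉ A, y j < y k := by
    intro j hj
    refine (hmax j).lt_of_ne fun hjk => ?_
    have hj0 : 0 < y j := hjk ▸ ha0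
    refine hnot j (-1) ?_ ?_
    · filter_upwards [Ioo_mem_nhdsGT hj0] with s hs
      refine ⟨shift_mem_stdSimplex hys hj hAn hb ?_ ?_, ?_, ?_, ?_⟩
      · linarith [hs.2]
      · rw [hAc]; push_cast; linarith [hs.1]
      · rw [hshk j hj, hshl j hj]
      · intro m
        rw [hshk j hj]
        unfold shift
        split_ifs with h1 h2
        · rw [h1]; linarith [hs.1]
        · rw [hb m h2, hAc]; push_cast; linarith
        · linarith [hmax m, hs.1]
      · rw [hshk j hj]; linarith [hs.1]
    · simpa using eventually_shift_neg_lt hβ hj hAn hb ha0 hj0 (Or.inr ⟨hjk, ha⟩)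
  -- The constraints on the maximum are now slack at `y`, and shifts treating `k` and `l` alike
  -- preserve the tie. Small shifts thus stay in the tie set and yield the critical equations.
  have hstay : ∀ j ∉ A, ∀ σ : ℝ, (0 < y j ∨ 0 ≤ σ) → ∀ᶠ s in nhdsWithin (0 : ℝ) (Set.Ioi 0),
      shift y j A (σ * s) ∈ tieSet c k l := by
    intro j hj σ hσ
    have ht := tendsto_shift y j A σ
    have e1 : ∀ᶠ s in nhdsWithin (0 : ℝ) (Set.Ioi 0), ∀ m, m ∉ A →
        shift y j A (σ * s) m < shift y j A (σ * s) k := by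
      rw [Filter.eventually_all]
      intro m
      by_cases hm : m ∈ A
      · exact Filter.Eventually.of_forall fun s h => absurd hm h
      · have ho : IsOpen {z : Fin q → ℝ | z m < z k} :=
          isOpen_lt (continuous_apply m) (continuous_apply k)
        have hym : y ∈ {z : Fin q → ℝ | z m < z k} := hlow m hm
        filter_upwards [ht.eventually (ho.mem_nhds hym)] with s hs _ using hs
    have e2 : ∀ᶠ s in nhdsWithin (0 : ℝ) (Set.Ioi 0), c < shift y j A (σ * s) k := by
      have ho : IsOpen {z : Fin q → ℝ | c < z k} := isOpen_lt continuous_const (continuous_apply k)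
      have hym : y ∈ {z : Fin q → ℝ | c < z k} := hlt
      exact ht.eventually (ho.mem_nhds hym)
    have e3 : ∀ᶠ s in nhdsWithin (0 : ℝ) (Set.Ioi 0), 0 ≤ y j + σ * s := by
      rcases hσ with h | h
      · have hlim : Filter.Tendsto (fun s : ℝ => y j + σ * s) (nhdsWithin 0 (Set.Ioi 0))
            (nhds (y j)) := by
          have : Continuous fun s : ℝ => y j + σ * s := by fun_prop
          simpa using (this.tendsto 0).mono_left nhdsWithin_le_nhds
        filter_upwards [hlim.eventually (lt_mem_nhds h)] with s hs using hs.le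
      · filter_upwards [self_mem_nhdsWithin] with s hs
        exact add_nonneg (hys.1 j) (mul_nonneg h (le_of_lt hs))
    filter_upwards [e1, e2, e3] with s h1 h2 h3
    refine ⟨shift_mem_stdSimplex hys hj hAn hb h3 ?_, ?_, ?_, h2.le⟩
    · rw [hshk j hj] at h2
      rw [hAc]; push_cast; linarith
    · rw [hshk j hj, hshl j hj]
    · intro m
      by_cases hm : m ∈ A
      · rcases Finset.mem_insert.1 hm with h | h
        · rw [h]
        · rw [Finset.mem_singleton.1 h, hshk j hj, hshl j hj]
      · exact (h1 m hm).le
  have hpos : ∀ j ∉ A, 0 < y j := by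
    intro j hj
    refine (hys.1 j).lt_of_ne fun h => ?_
    exact hnot j 1 (hstay j hj 1 (Or.inr zero_le_one))
      (by simpa using eventually_shift_lt hβ hj hAn hb ha0 (Or.inl h.symm))
  have heq : ∀ j ∉ A, dphi β (y j) = dphi β (y k) := by
    intro j hj
    rcases lt_trichotomy (dphi β (y j)) (dphi β (y k)) with h | h | h
    · exact absurd (by simpa using eventually_shift_lt hβ hj hAn hb ha0 (Or.inr ⟨hpos j hj, h⟩))
        (hnot j 1 (hstay j hj 1 (Or.inr zero_le_one)))
    · exact h
    · exact absurd (by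
        simpa using eventually_shift_neg_lt hβ hj hAn hb ha0 (hpos j hj) (Or.inl h))
        (hnot j (-1) (hstay j hj (-1) (Or.inl (hpos j hj))))
  obtain ⟨j, hj⟩ : ∃ j, j ∉ A := by
    by_contra hcon
    push Not at hcon
    have := Finset.card_le_card (fun m _ => hcon m : (Finset.univ : Finset (Fin q)) ⊆ A)
    rw [Finset.card_univ, Fintype.card_fin, hAc] at this
    omega
  have hside : ∀ m ∉ A, y m ∈ Set.Ioc 0 (1 / β) := fun m hm =>
    ⟨hpos m hm, (dphi_eq_sides hβ (hpos m hm) (hlow m hm) (heq m hm)).1.le⟩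
  have hall : ∀ m ∉ A, y m = y j := fun m hm =>
    (dphi_strictMonoOn hβ).injOn (hside m hm) (hside j hj) ((heq m hm).trans (heq j hj).symm)
  obtain ⟨h1, h2⟩ := eq_twoValued_of_eq hys.2 hAn hb hall
  rw [hAc] at h1
  have hjk := hlow j hj
  have hinv := lt_inv_of_lt_bval two_pos (by omega : 2 < q) (h1 ▸ hjk)
  refine ⟨y j, hpos j hj, hinv, ?_, h2⟩
  exact g_eq_of_dphi_eq two_pos (by omega) hβ (mem_gDomain_of_lt_inv two_pos (by omega)
    (hpos j hj) hinv) hinv.ne (h1 ▸ hjk.ne) (h1 ▸ heq j hj)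

lemma fLine_u_lt_v {i : ℕ} (hi : 0 < i) (hq : i < q) (hβ : 0 < β) (h : SolSpec q i β) {t : ℝ}
    (h1 : uSol q i β < t) (h2 : t ≤ vSol q i β) (h3 : t ≤ 1 / (q : ℝ)) :
    fLine q i β (uSol q i β) < fLine q i β t :=
  fLine_lt_of_g_lt hi hq hβ h.u_pos.le h1 h3 fun r hr => h.mid r hr.1 (hr.2.trans_le h2)

/-- The minimum of the potential on `tieSet c k l` is attained on its lower boundary or is
`F_β(u_2)`. -/
lemma tieSet_lower_bound (hq : 5 ≤ q) (hβ : 0 < β) {c : ℝ} (hc : 1 / β ≤ c) {k l : Fin q}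
    (hkl : k ≠ l) {x : Fin q → ℝ} (hx : x ∈ tieSet c k l) :
    (∃ y ∈ tieSet c k l, y k = c ∧ potential β y ≤ potential β x) ∨
      betaS q 2 ≤ β ∧ heightU2 q β ≤ potential β x ∧
        (potential β x = heightU2 q β → x = u2Point β k l) := by
  have hne : (tieSet c k l).Nonempty := ⟨x, hx⟩
  obtain ⟨y, hy, hmin⟩ := (isCompact_tieSet c k l).exists_isMinOn hne
    (continuous_potential β).continuousOn
  rcases isMinOn_tieSet_cases (by omega) hβ hc hkl hy hmin with h | ⟨t, ht0, ht, hg, hyt⟩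
  · exact Or.inl ⟨y, hy, h, hmin hx⟩
  -- Excluding this alternative for `x` itself lets the equality case apply the classification of
  -- minimisers to `x` in place of `y`.
  by_cases hleft : ∃ y ∈ tieSet c k l, y k = c ∧ potential β y ≤ potential β x
  · exact Or.inl hleft
  right
  have hdom := mem_gDomain_of_lt_inv two_pos (by omega : 2 < q) ht0 ht
  have hbS : betaS q 2 ≤ β := hg ▸ betaS_le_g two_pos (by omega) hdom
  have hspec := solSpec two_pos (by omega : 2 * 2 < q) hbS
  -- Of the two solutions the smaller gives the lower point, because the potential increases between
  -- `u_2` and `v_2` up to `1 / q`.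
  have hval : ∀ s, s ∈ gDomain q 2 → s < 1 / (q : ℝ) → g q 2 s = β →
      heightU2 q β ≤ potential β (twoValued {k, l} s) ∧
      (potential β (twoValued {k, l} s) = heightU2 q β → s = uSol q 2 β) := by
    intro s hs hs1 hgs
    rw [potential_twoValued, Finset.card_pair hkl, heightU2_eq hq]
    rcases hspec.eq_or hs hgs with h | h
    · rw [h]; exact ⟨le_rfl, fun _ => rfl⟩
    · by_cases hu : uSol q 2 β = s
      · rw [hu]; exact ⟨le_rfl, fun _ => rfl⟩
      · have hlt : uSol q 2 β < s := (h ▸ hspec.u_le_v).lt_of_ne hu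
        have := fLine_u_lt_v two_pos (by omega) hβ hspec hlt h.le hs1.le
        exact ⟨this.le, fun h => absurd h this.ne'⟩
  have hle : heightU2 q β ≤ potential β y := hyt ▸ (hval t hdom ht hg).1
  refine ⟨hbS, hle.trans (hmin hx), fun hxe => ?_⟩
  have hxmin : IsMinOn (potential β) (tieSet c k l) x := fun z hz =>
    (hxe.le.trans hle).trans (hmin hz)
  rcases isMinOn_tieSet_cases (by omega) hβ hc hkl hx hxmin with h | ⟨s, hs0, hs, hgs, hxs⟩
  · exact absurd ⟨x, hx, h, le_rfl⟩ hleft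
  · have := (hval s (mem_gDomain_of_lt_inv two_pos (by omega) hs0 hs) hs hgs).2 (hxs ▸ hxe)
    rw [hxs, this, u2Point]

end Barrier

/-! ### The order of the heights and the critical value `β_3` -/

section Beta

variable {q : ℕ}

lemma betaS_pos {i : ℕ} (hi : 0 < i) (hq : 2 * i < q) : 0 < betaS q i := by
  obtain ⟨m, hm0, hm1, hg⟩ := exists_g_eq_betaS hi hq
  have hdom := mem_gDomain_of_lt_inv hi (by omega) hm0 hm1
  rw [← hg, g_eq_slope hi (by omega) hdom hm1.ne]
  have hlt := lt_bval hi (by omega : i < q) hm1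
  exact div_pos (sub_pos.2 (Real.log_lt_log hm0 hlt)) (sub_pos.2 hlt)

lemma betaS_one_lt_two (hq : 5 ≤ q) : betaS q 1 < betaS q 2 := by
  obtain ⟨m, hm0, hm1, hg⟩ := exists_g_eq_betaS two_pos (by omega : 2 * 2 < q)
  rw [← hg]
  exact (betaS_le_g one_pos (by omega) (mem_gDomain_of_lt_inv one_pos (by omega) hm0 hm1)).trans_lt
    (g_one_lt_g_two hq hm0 hm1)

/-- At `u_2` the value of `g_1` is below `g_2 = β`, so `u_2` lies strictly between `u_1` and `v_1`.
-/
lemma uSol_two_lt_vSol_one (hq : 5 ≤ q) {β : ℝ} (hβ : betaS q 2 ≤ β) :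
    uSol q 2 β < vSol q 1 β := by
  have h1 := solSpec one_pos (by omega : 2 * 1 < q) ((betaS_one_lt_two hq).le.trans hβ)
  have h2 := solSpec two_pos (by omega : 2 * 2 < q) hβ
  have hg := g_one_lt_g_two hq h2.u_pos h2.u_lt_inv
  rw [h2.g_u] at hg
  exact (h1.mem_of_lt (mem_gDomain_of_lt_inv one_pos (by omega) h2.u_pos h2.u_lt_inv) hg).2

/-- Both pairs of values are conjugate for `dphi`, and conjugation reverses the order of the lower
values. -/
lemma bval_v_lt_bval_u (hq : 5 ≤ q) {β : ℝ} (hβ : betaS q 2 ≤ β) (hβq : β < q) :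
    bval q 1 (vSol q 1 β) < bval q 2 (uSol q 2 β) := by
  have hpos := (betaS_pos two_pos (by omega : 2 * 2 < q)).trans_le hβ
  have h1 := solSpec one_pos (by omega : 2 * 1 < q) ((betaS_one_lt_two hq).le.trans hβ)
  have h2 := solSpec two_pos (by omega : 2 * 2 < q) hβ
  have hv := h1.v_lt_inv hβq
  exact dphi_conj_lt hpos h2.u_pos (lt_bval two_pos (by omega) h2.u_lt_inv)
    (dphi_eq_of_g_eq two_pos (by omega) hpos h2.u_mem h2.g_u) h1.pos
    (lt_bval one_pos (by omega) hv) (dphi_eq_of_g_eq one_pos (by omega) hpos h1.v_mem h1.g_v)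
    (uSol_two_lt_vSol_one hq hβ)

/-- The sum of the squares of the coordinates of `twoValued A t`, `A.card = i`. -/
noncomputable def sqSum (q i : ℕ) (t : ℝ) : ℝ := i * bval q i t ^ 2 + ((q : ℝ) - i) * t ^ 2

/-- At a fixed point `β F_β` is affine in `β`: the entropy enters without `β`, and the slope is
minus half the sum of squares. -/
lemma mul_fLine_sub (q i : ℕ) {β β' : ℝ} (hβ : β ≠ 0) (hβ' : β' ≠ 0) (t : ℝ) :
    β' * fLine q i β' t = β * fLine q i β t - (β' - β) / 2 * sqSum q i t := by
  simp only [fLine, phi, sqSum]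
  field_simp
  ring

lemma sqSum_lt (hq : 5 ≤ q) {β : ℝ} (hβ : betaS q 2 ≤ β) (hβq : β < q) :
    sqSum q 1 (vSol q 1 β) < sqSum q 2 (uSol q 2 β) := by
  have h1 := solSpec one_pos (by omega : 2 * 1 < q) ((betaS_one_lt_two hq).le.trans hβ)
  have h2 := solSpec two_pos (by omega : 2 * 2 < q) hβ
  have hlt := uSol_two_lt_vSol_one hq hβ
  have hb := bval_v_lt_bval_u hq hβ hβq
  have hv := lt_bval one_pos (by omega : 1 < q) (h1.v_lt_inv hβq)
  have e1 : bval q 1 (vSol q 1 β) = 1 - ((q : ℝ) - 1) * vSol q 1 β := by simp [bval]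
  have e2 : 2 * bval q 2 (uSol q 2 β) = 1 - ((q : ℝ) - 2) * uSol q 2 β := by
    rw [bval]; push_cast; ring
  simp only [sqSum]
  push_cast
  set a := bval q 2 (uSol q 2 β)
  set c := bval q 1 (vSol q 1 β)
  set u := uSol q 2 β
  set v := vSol q 1 β
  have hu0 := h2.u_pos
  -- Both points have total mass `1`. This turns the difference of the sums of squares into `(a -
  -- c)(a + c - v - u) + (a - v)(a - u)`, positive because `u < v < c < a`.
  have e3 : ((q : ℝ) - 2) * (v - u) = (a - c) + (a - v) := by linarith
  have key : 2 * a ^ 2 + ((q : ℝ) - 2) * u ^ 2 - (1 * c ^ 2 + ((q : ℝ) - 1) * v ^ 2) =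
      (a - c) * (a + c) + (a - v) * (a + v) - ((q : ℝ) - 2) * (v - u) * (v + u) := by ring
  rw [e3] at key
  have k1 : 0 < (a - c) * (a + c - (v + u)) := mul_pos (by linarith) (by linarith)
  have k2 : 0 < (a - v) * (a + v - (v + u)) := mul_pos (by linarith) (by linarith)
  nlinarith

/-- The difference of the heights, scaled by `β`. -/
noncomputable def heightGap (q : ℕ) (β : ℝ) : ℝ := β * heightU2 q β - β * heightV1 q β

/-- A difference version of the envelope theorem, avoiding derivatives of `u_2` and `v_1` in `β`. At
each of the two temperatures the parameter belonging to it is compared with the other one: `u_2`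
gives the smaller value (`a1`, `a2`), `v_1` the larger (`a3`, `a4`). Affinity in `β` then encloses
the change of the gap between sums of squares taken at `β` and at `β'`. -/
lemma heightGap_bounds (hq : 5 ≤ q) {β β' : ℝ} (hβ : betaS q 2 ≤ β) (hlt : β < β')
    (hβ' : β' ≤ q) :
    heightGap q β' < heightGap q β ∧ heightGap q β - (β' - β) / 2 ≤ heightGap q β' := by
  have hpos := (betaS_pos two_pos (by omega : 2 * 2 < q)).trans_le hβ
  have hpos' := hpos.trans hlt
  have hβq := hlt.trans_le hβ'
  have h12 := (betaS_one_lt_two hq).le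
  have h1 := solSpec one_pos (by omega : 2 * 1 < q) (h12.trans hβ)
  have h2 := solSpec two_pos (by omega : 2 * 2 < q) hβ
  have h1' := solSpec one_pos (by omega : 2 * 1 < q) (h12.trans (hβ.trans hlt.le))
  have h2' := solSpec two_pos (by omega : 2 * 2 < q) (hβ.trans hlt.le)
  have hu := h2'.mem_of_lt h2.u_mem (h2.g_u.trans_lt hlt)
  have hv := h1'.mem_of_lt h1.v_mem (h1.g_v.trans_lt hlt)
  have hv'inv : vSol q 1 β' ≤ 1 / (q : ℝ) := by
    rcases hβ'.eq_or_lt with h | h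
    · subst h; exact (h1'.v_eq_inv one_pos (by omega)).le
    · exact (h1'.v_lt_inv h).le
  have a1 : fLine q 2 β' (uSol q 2 β') < fLine q 2 β' (uSol q 2 β) :=
    fLine_u_lt_v two_pos (by omega) hpos' h2' hu.1 hu.2.le h2.u_lt_inv.le
  have a2 : fLine q 2 β (uSol q 2 β) < fLine q 2 β (uSol q 2 β') :=
    fLine_lt_of_lt_g two_pos (by omega) hpos h2'.u_pos.le hu.1 h2.u_lt_inv.le
      fun r hr => h2.lt_u r (h2'.u_pos.trans hr.1) hr.2
  have a3 : fLine q 1 β' (vSol q 1 β) < fLine q 1 β' (vSol q 1 β') :=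
    fLine_lt_of_g_lt one_pos (by omega) hpos' h1.pos.le hv.2 hv'inv
      fun r hr => h1'.mid r (hv.1.trans hr.1) hr.2
  have a4 : fLine q 1 β (vSol q 1 β') < fLine q 1 β (vSol q 1 β) :=
    fLine_lt_of_lt_g one_pos (by omega) hpos h1.pos.le hv.2 hv'inv
      fun r hr => h1.v_lt_g r hr.1 (hr.2.trans h1'.v_lt)
  have hQ := sqSum_lt hq hβ hβq
  have hQ1 : sqSum q 2 (uSol q 2 β') ≤ 1 := by
    have hb := bval_pos two_pos (by omega : 2 < q) h2'.u_mem
    have e2 : 2 * bval q 2 (uSol q 2 β') + ((q : ℝ) - 2) * uSol q 2 β' = 1 := by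
      rw [bval]; push_cast; ring
    have hq2 : (2 : ℝ) ≤ (q : ℝ) - 2 := by
      have : (5 : ℝ) ≤ q := by exact_mod_cast hq
      linarith
    rw [sqSum]; push_cast
    set a := bval q 2 (uSol q 2 β')
    set u := uSol q 2 β'
    have hu0 := h2'.u_pos
    have ha1 : a ≤ 1 := by nlinarith
    have hu1 : u ≤ 1 := by nlinarith
    nlinarith [mul_nonneg hb.le (sub_nonneg.2 ha1),
      mul_nonneg (mul_nonneg (by linarith : (0 : ℝ) ≤ (q : ℝ) - 2) hu0.le) (sub_nonneg.2 hu1)]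
  have hQ2 : 0 ≤ sqSum q 1 (vSol q 1 β') := by
    have : (1 : ℝ) ≤ q := by exact_mod_cast (by omega : 1 ≤ q)
    rw [sqSum]; push_cast
    have : 0 ≤ (q : ℝ) - 1 := by linarith
    positivity
  have b1 := mul_lt_mul_of_pos_left a1 hpos'
  have b2 := mul_lt_mul_of_pos_left a2 hpos
  have b3 := mul_lt_mul_of_pos_left a3 hpos'
  have b4 := mul_lt_mul_of_pos_left a4 hpos
  have c1 := mul_fLine_sub q 2 hpos.ne' hpos'.ne' (uSol q 2 β)
  have c2 := mul_fLine_sub q 2 hpos.ne' hpos'.ne' (uSol q 2 β')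
  have c3 := mul_fLine_sub q 1 hpos.ne' hpos'.ne' (vSol q 1 β)
  have c4 := mul_fLine_sub q 1 hpos.ne' hpos'.ne' (vSol q 1 β')
  have hd : 0 < (β' - β) / 2 := by linarith
  have d1 := mul_lt_mul_of_pos_left hQ hd
  have d2 := mul_le_mul_of_nonneg_left hQ1 hd.le
  have d3 := mul_nonneg hd.le hQ2
  simp only [heightGap, heightU2_eq hq, heightV1_eq hq]
  constructor <;> linarith

lemma exists_ne_ne (hq : 5 ≤ q) : ∃ k l : Fin q, k ≠ l := by
  have : Nontrivial (Fin q) := Fin.nontrivial_iff_two_le.2 (by omega)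
  exact exists_pair_ne _

/-- At `β_{s,2}` one has `u_2 = v_2` and `g_2 > β` beyond it, so the potential falls along the
two-spin segment from `u_2` to the point whose large value is `c`, the upper value of `v_1`. That
point lies on the barrier, where `F ≥ F(v_1)`. -/
lemma heightGap_betaS_pos (hq : 5 ≤ q) : 0 < heightGap q (betaS q 2) := by
  set β := betaS q 2 with hβd
  have hpos : 0 < β := betaS_pos two_pos (by omega : 2 * 2 < q)
  have hβq : β < q := betaS_lt_q two_pos (by omega : 2 * 2 < q)
  have h1 := solSpec one_pos (by omega : 2 * 1 < q) (betaS_one_lt_two hq).le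
  have h2 := solSpec two_pos (by omega : 2 * 2 < q) (le_refl β)
  have hv := h1.v_lt_inv hβq
  have hb := bval_v_lt_bval_u hq (le_refl β) hβq
  have hlt := lt_bval one_pos (by omega : 1 < q) hv
  set c := bval q 1 (vSol q 1 β) with hc
  have hq2 : (0 : ℝ) < (q : ℝ) - 2 := by
    have : (5 : ℝ) ≤ q := by exact_mod_cast hq
    linarith
  have hq0 : (0 : ℝ) < q := by linarith
  have hcq : 1 / (q : ℝ) < c := by
    have e1 : c = 1 - ((q : ℝ) - 1) * vSol q 1 β := by simp [hc, bval]
    have := (lt_div_iff₀ hq0).1 hv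
    rw [div_lt_iff₀ hq0, e1]
    nlinarith
  obtain ⟨t, htc⟩ : ∃ t, bval q 2 t = c := by
    refine ⟨(1 - 2 * c) / ((q : ℝ) - 2), ?_⟩
    rw [bval]; push_cast; field_simp; ring
  have e2 : 2 * c = 1 - ((q : ℝ) - 2) * t := by rw [← htc, bval]; push_cast; ring
  have e3 : 2 * bval q 2 (uSol q 2 β) = 1 - ((q : ℝ) - 2) * uSol q 2 β := by
    rw [bval]; push_cast; ring
  have hut : uSol q 2 β < t := by nlinarith
  have htq : t < 1 / (q : ℝ) := by
    rw [lt_div_iff₀ hq0]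
    have := (div_lt_iff₀ hq0).1 hcq
    nlinarith
  have huv : uSol q 2 β = vSol q 2 β := uSol_betaS two_pos (by omega)
  have hf : fLine q 2 β t < fLine q 2 β (uSol q 2 β) := by
    refine fLine_lt_of_lt_g two_pos (by omega) hpos h2.u_pos.le hut htq.le fun r hr => ?_
    exact h2.v_lt_g r (huv ▸ hr.1) (hr.2.trans (mem_gDomain_of_lt_inv two_pos (by omega)
      (h2.u_pos.trans hut) htq).2)
  obtain ⟨k, l, hkl⟩ := exists_ne_ne hq
  have hcard : ({k, l} : Finset (Fin q)).card = 2 := Finset.card_pair hkl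
  have hk : ∀ m ∈ ({k, l} : Finset (Fin q)), twoValued {k, l} t m = c := by
    intro m hm
    rw [← htc]
    simp only [twoValued, hm, if_true, hcard, bval]
  have hA := fLine_le_potential (by omega) hpos h1.pos hv h1.g_v
    (x := twoValued {k, l} t) (twoValued_mem_stdSimplex ⟨k, by simp⟩ (by omega)
      (hcard ▸ mem_gDomain_of_lt_inv two_pos (by omega) (h2.u_pos.trans hut) htq))
    (hk k (by simp)) (by
      intro j
      by_cases hj : j ∈ ({k, l} : Finset (Fin q))
      · exact (hk j hj).le
      · simp only [twoValued, hj, if_false]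
        exact (htq.trans hcq).le)
  have := hA.1
  rw [potential_twoValued, hcard] at this
  rw [heightGap, ← mul_sub, heightU2_eq hq, heightV1_eq hq]
  exact mul_pos hpos (by linarith)

/-- For `β ≥ q` the centre parameter `1 / q` lies in `(u_2, v_2]`, where the potential has risen
from its value at `u_2`. -/
lemma heightU2_lt_pPoint (hq : 5 ≤ q) {β : ℝ} (hβ : (q : ℝ) ≤ β) :
    heightU2 q β < potential β (pPoint q) := by
  have hq0 : (0 : ℝ) < q := by exact_mod_cast (by omega : 0 < q)
  have hpos := hq0.trans_le hβ
  have hbS := (betaS_lt_q two_pos (by omega : 2 * 2 < q)).le.trans hβ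
  have h2 := solSpec two_pos (by omega : 2 * 2 < q) hbS
  rw [heightU2_eq hq, potential_pPoint two_pos (by omega)]
  refine fLine_u_lt_v two_pos (by omega) hpos h2 h2.u_lt_inv ?_ le_rfl
  rcases hβ.eq_or_lt with h | h
  · subst h; exact (h2.v_eq_inv two_pos (by omega)).ge
  · exact (h2.inv_lt_v two_pos (by omega) h).le

lemma heightV1_le_pPoint (hq : 5 ≤ q) {β : ℝ} (hβ : (q : ℝ) ≤ β) :
    heightV1 q β ≤ potential β (pPoint q) := by
  have hq0 : (0 : ℝ) < q := by exact_mod_cast (by omega : 0 < q)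
  have hpos := hq0.trans_le hβ
  have hbS := (betaS_lt_q one_pos (by omega : 2 * 1 < q)).le.trans hβ
  have h1 := solSpec one_pos (by omega : 2 * 1 < q) hbS
  rw [heightV1_eq hq, potential_pPoint one_pos (by omega)]
  rcases hβ.eq_or_lt with h | h
  · subst h; rw [h1.v_eq_inv one_pos (by omega)]
  · have := h1.inv_lt_v one_pos (by omega) h
    exact (fLine_lt_of_inv_le one_pos (by omega) hpos le_rfl this h1.v_mem fun r hr =>
      h1.mid r (h1.u_lt_inv.trans hr.1) hr.2).le

/-- At `β = q` the point `v_1` merges with `p`, which is above `u_2`. -/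
lemma heightGap_q_neg (hq : 5 ≤ q) : heightGap q q < 0 := by
  have hq0 : (0 : ℝ) < q := by exact_mod_cast (by omega : 0 < q)
  have h1 := solSpec one_pos (by omega : 2 * 1 < q) (betaS_lt_q one_pos (by omega)).le
  have h := heightU2_lt_pPoint hq (le_refl (q : ℝ))
  rw [potential_pPoint one_pos (by omega : 1 ≤ q), ← h1.v_eq_inv one_pos (by omega),
    ← heightV1_eq hq] at h
  rw [heightGap, ← mul_sub]
  exact mul_neg_of_pos_of_neg hq0 (by linarith)

/-- The two bounds on increments make the gap Lipschitz, so continuity of `u_2` and `v_1` in `β` is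
not needed. -/
lemma continuousOn_heightGap (hq : 5 ≤ q) :
    ContinuousOn (heightGap q) (Set.Icc (betaS q 2) q) := by
  have h : LipschitzOnWith 1 (heightGap q) (Set.Icc (betaS q 2) q) := by
    have key : ∀ β ∈ Set.Icc (betaS q 2) (q : ℝ), ∀ β' ∈ Set.Icc (betaS q 2) (q : ℝ), β < β' →
        |heightGap q β - heightGap q β'| ≤ |β - β'| := by
      intro β hβ β' hβ' hlt
      obtain ⟨h1, h2⟩ := heightGap_bounds hq hβ.1 hlt hβ'.2
      rw [abs_of_pos (by linarith), abs_of_neg (by linarith)]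
      linarith
    refine LipschitzOnWith.of_dist_le_mul fun x hx y hy => ?_
    simp only [NNReal.coe_one, one_mul, Real.dist_eq]
    rcases lt_trichotomy x y with h | h | h
    · exact key x hx y hy h
    · simp [h]
    · rw [abs_sub_comm, abs_sub_comm x]; exact key y hy x hx h
  exact h.continuousOn

/-- The third critical temperature is the zero of the height difference. -/
lemma beta3_spec (hq : 5 ≤ q) : betaS q 2 < beta3 q ∧ beta3 q < q ∧ heightGap q (beta3 q) = 0 := by
  have hlt : betaS q 2 < q := betaS_lt_q two_pos (by omega : 2 * 2 < q)
  have h1 := heightGap_betaS_pos hq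
  have h2 := heightGap_q_neg hq
  obtain ⟨b, hb, hb0⟩ := intermediate_value_Icc' hlt.le (continuousOn_heightGap hq) ⟨h2.le, h1.le⟩
  have hpos : ∀ β, betaS q 2 ≤ β → 0 < β := fun β hβ =>
    (betaS_pos two_pos (by omega : 2 * 2 < q)).trans_le hβ
  have h3 : beta3 q = b := by
    refine IsLeast.csInf_eq ⟨⟨hb.1, ?_⟩, fun β hβ => ?_⟩
    · rw [heightGap, sub_eq_zero] at hb0
      exact (mul_left_cancel₀ (hpos b hb.1).ne' hb0).le
    · by_contra hc
      have hc : β < b := not_le.1 hc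
      have := (heightGap_bounds hq hβ.1 hc hb.2).1
      rw [hb0, heightGap, ← mul_sub] at this
      have h4 := mul_nonpos_of_nonneg_of_nonpos (hpos β hβ.1).le (sub_nonpos.2 hβ.2)
      linarith
  rw [h3]
  refine ⟨hb.1.lt_of_ne fun h => ?_, hb.2.lt_of_ne fun h => ?_, hb0⟩
  · rw [← h] at hb0; exact h1.ne' hb0
  · rw [h] at hb0; exact h2.ne hb0

lemma heightV1_lt_heightU2 (hq : 5 ≤ q) {β : ℝ} (h1 : betaS q 2 ≤ β) (h2 : β < beta3 q) :
    heightV1 q β < heightU2 q β := by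
  obtain ⟨h3, h4, h5⟩ := beta3_spec hq
  have := (heightGap_bounds hq h1 h2 h4.le).1
  rw [h5, heightGap, ← mul_sub] at this
  have hpos := (betaS_pos two_pos (by omega : 2 * 2 < q)).trans_le h1
  linarith [(mul_pos_iff_of_pos_left hpos).1 this]

lemma heightV1_eq_heightU2 (hq : 5 ≤ q) : heightV1 q (beta3 q) = heightU2 q (beta3 q) := by
  obtain ⟨h3, h4, h5⟩ := beta3_spec hq
  rw [heightGap, sub_eq_zero] at h5
  exact (mul_left_cancel₀ ((betaS_pos two_pos (by omega : 2 * 2 < q)).trans h3).ne' h5).symm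

lemma heightU2_lt_heightV1 (hq : 5 ≤ q) {β : ℝ} (h1 : beta3 q < β) (h2 : β ≤ q) :
    heightU2 q β < heightV1 q β := by
  obtain ⟨h3, h4, h5⟩ := beta3_spec hq
  have := (heightGap_bounds hq h3.le h1 h2).1
  rw [h5, heightGap, ← mul_sub] at this
  have hpos := (betaS_pos two_pos (by omega : 2 * 2 < q)).trans (h3.trans h1)
  linarith [neg_of_mul_neg_right this hpos.le]

end Beta

/-! ### The outer wells and their mutual gates -/

section Wells

variable {q : ℕ} {β : ℝ}

/-- The size of the largest coordinate on the barrier around the centre `p`. -/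
noncomputable def threshold (q : ℕ) (β : ℝ) : ℝ :=
  if β < q then bval q 1 (vSol q 1 β) else 1 / (q : ℝ)

lemma beta1_pos (hq : 5 ≤ q) : 0 < beta1 q := betaS_pos one_pos (by omega)

lemma solSpec_one (hq : 5 ≤ q) (hβ : beta1 q < β) : SolSpec q 1 β :=
  solSpec one_pos (by omega) hβ.le

lemma uSol_lt_vSol (hq : 5 ≤ q) (hβ : beta1 q < β) : uSol q 1 β < vSol q 1 β := by
  obtain ⟨m, hm0, hm1, hg⟩ := exists_g_eq_betaS one_pos (by omega : 2 * 1 < q)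
  have := (solSpec_one hq hβ).mem_of_lt (mem_gDomain_of_lt_inv one_pos (by omega) hm0 hm1)
    (hg.trans_lt hβ)
  exact this.1.trans this.2

lemma solSpec_two (hq : 5 ≤ q) (hβ : beta3 q ≤ β) : SolSpec q 2 β :=
  solSpec two_pos (by omega) ((beta3_spec hq).1.le.trans hβ)

lemma beta1_lt_beta3 (hq : 5 ≤ q) : beta1 q < beta3 q :=
  (betaS_one_lt_two hq).trans (beta3_spec hq).1

lemma threshold_of_lt (hβq : β < q) : threshold q β = bval q 1 (vSol q 1 β) := if_pos hβq

lemma threshold_of_le (hβq : q ≤ β) : threshold q β = 1 / (q : ℝ) := if_neg (not_lt.2 hβq)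

lemma bval_one (q : ℕ) (t : ℝ) : bval q 1 t = 1 - ((q : ℝ) - 1) * t := by simp [bval]

lemma inv_lt_bval_one (hq : 5 ≤ q) {t : ℝ} (ht : t < 1 / (q : ℝ)) : 1 / (q : ℝ) < bval q 1 t :=
  by
  have hq0 : (5 : ℝ) ≤ q := by exact_mod_cast hq
  have h0 : (0 : ℝ) < q := by linarith
  have := (lt_div_iff₀ h0).1 ht
  rw [bval_one, div_lt_iff₀ h0]
  nlinarith

lemma inv_lt_threshold (hq : 5 ≤ q) (hβ : beta1 q < β) (hβq : β < q) :
    1 / (q : ℝ) < threshold q β := by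
  rw [threshold_of_lt hβq]
  exact inv_lt_bval_one hq ((solSpec_one hq hβ).v_lt_inv hβq)

lemma inv_le_threshold (hq : 5 ≤ q) (hβ : beta1 q < β) : 1 / (q : ℝ) ≤ threshold q β := by
  rcases lt_or_ge β q with h | h
  · exact (inv_lt_threshold hq hβ h).le
  · exact (threshold_of_le h).ge

lemma inv_beta_le_threshold (hq : 5 ≤ q) (hβ : beta1 q < β) : 1 / β ≤ threshold q β := by
  have hpos := (beta1_pos hq).trans hβ
  rcases lt_or_ge β q with h | h
  · have h1 := solSpec_one hq hβ
    rw [threshold_of_lt h]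
    exact (dphi_eq_sides hpos h1.pos (lt_bval one_pos (by omega) (h1.v_lt_inv h))
      (dphi_eq_of_g_eq one_pos (by omega) hpos h1.v_mem h1.g_v)).2.le
  · rw [threshold_of_le h]
    exact one_div_le_one_div_of_le (by exact_mod_cast (by omega : 0 < q)) h

/-- The potential on the barrier around the centre. -/
lemma heightV1_le_of_max (hq : 5 ≤ q) (hβ : beta1 q < β) (hβq : β < q) {x : Fin q → ℝ}
    (hx : x ∈ stdSimplex ℝ (Fin q)) {k : Fin q} (hk : x k = threshold q β)
    (hmax : ∀ j, x j ≤ threshold q β) :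
    heightV1 q β ≤ potential β x ∧ (potential β x = heightV1 q β → x = v1Point β k) := by
  have h1 := solSpec_one hq hβ
  rw [threshold_of_lt hβq] at hk hmax
  rw [heightV1_eq hq]
  exact fLine_le_potential (by omega) ((beta1_pos hq).trans hβ) h1.pos (h1.v_lt_inv hβq) h1.g_v
    hx hk hmax

lemma eq_pPoint_of_max (hq : 5 ≤ q) {x : Fin q → ℝ} (hx : x ∈ stdSimplex ℝ (Fin q))
    (hmax : ∀ j, x j ≤ 1 / (q : ℝ)) : x = pPoint q := by
  have hq0 : (q : ℝ) ≠ 0 := by exact_mod_cast (by omega : q ≠ 0)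
  have hs : ∑ j, (1 / (q : ℝ) - x j) = 0 := by
    rw [Finset.sum_sub_distrib, hx.2, Finset.sum_const, Finset.card_univ, Fintype.card_fin,
      nsmul_eq_mul]
    field_simp; simp
  have := (Finset.sum_eq_zero_iff_of_nonneg fun j _ => sub_nonneg.2 (hmax j)).1 hs
  ext j
  have := this j (Finset.mem_univ j)
  rw [pPoint]; linarith

lemma v1Point_self (β : ℝ) (k : Fin q) : v1Point β k k = bval q 1 (vSol q 1 β) := by
  simp [v1Point, twoValued, bval]

lemma v1Point_of_ne (β : ℝ) {k j : Fin q} (h : j ≠ k) : v1Point β k j = vSol q 1 β := by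
  simp [v1Point, twoValued, h]

/-- Every point of the tie set is at least as high as the lowest saddle points. -/
lemma height_le_of_mem_tieSet (hq : 5 ≤ q) (hβ : beta1 q < β) {k l : Fin q} (hkl : k ≠ l)
    {x : Fin q → ℝ} (hx : x ∈ tieSet (threshold q β) k l) :
    height q β ≤ potential β x ∧
      (potential β x = height q β → beta3 q ≤ β ∧ x = u2Point β k l) := by
  have hpos := (beta1_pos hq).trans hβ
  -- The lower boundary of the tie set lies on the surface barrier. The inequality is strict there
  -- for `β < q`, since `v_1^k` has a unique largest coordinate; for `β ≥ q` the only such point is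
  -- `p`.
  have hbound : ∀ y ∈ tieSet (threshold q β) k l, y k = threshold q β →
      (β < q ∧ heightV1 q β < potential β y) ∨ (q ≤ β ∧ heightU2 q β < potential β y) := by
    rintro y ⟨hys, hykl, hmax, -⟩ hyk
    rcases lt_or_ge β q with h | h
    · left
      have hA := heightV1_le_of_max hq hβ h hys hyk (fun j => hyk ▸ hmax j)
      refine ⟨h, hA.1.lt_of_ne fun he => ?_⟩
      have hyv := hA.2 he.symm
      rw [hyv, v1Point_self, v1Point_of_ne β hkl.symm] at hykl
      exact (lt_bval one_pos (by omega : 1 < q) ((solSpec_one hq hβ).v_lt_inv h)).ne' hykl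
    · right
      rw [threshold_of_le h] at hyk
      rw [eq_pPoint_of_max hq hys (fun j => hyk ▸ hmax j)]
      exact ⟨h, heightU2_lt_pPoint hq h⟩
  have h34 := (beta3_spec hq).2.1
  rcases tieSet_lower_bound hq hpos (inv_beta_le_threshold hq hβ) hkl hx with
    ⟨y, hy, hyk, hyx⟩ | ⟨h1, h2, h3⟩
  · have hlt : height q β < potential β x := by
      refine lt_of_lt_of_le ?_ hyx
      rcases hbound y hy hyk with ⟨hlt, hV⟩ | ⟨hle, hU⟩
      · by_cases h3 : β < beta3 q
        · rwa [height, if_pos h3]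
        · rw [height, if_neg h3]
          rcases (not_lt.1 h3).eq_or_lt with h4 | h4
          · subst h4; rwa [← heightV1_eq_heightU2 hq]
          · exact (heightU2_lt_heightV1 hq h4 hlt.le).trans hV
      · rwa [height, if_neg (not_lt.2 (h34.le.trans hle))]
    exact ⟨hlt.le, fun h => absurd h hlt.ne'⟩
  · by_cases hb : β < beta3 q
    · have := (heightV1_lt_heightU2 hq h1 hb).trans_le h2
      rw [height, if_pos hb]
      exact ⟨this.le, fun h => absurd h this.ne'⟩
    · rw [height, if_neg hb]
      exact ⟨h2, fun h => ⟨not_lt.1 hb, h3 h⟩⟩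

/-- For `β < q` this follows from `H ≤ F(v_1)`. For `β ≥ q` the surface shrinks to `p`, which is
above `u_2`. -/
lemma height_le_of_max (hq : 5 ≤ q) (hβ : beta1 q < β) {x : Fin q → ℝ}
    (hx : x ∈ stdSimplex ℝ (Fin q)) {k : Fin q} (hk : x k = threshold q β)
    (hmax : ∀ j, x j ≤ threshold q β) : height q β ≤ potential β x := by
  have h34 := (beta3_spec hq).2.1
  rcases lt_or_ge β q with h | h
  · have hA := (heightV1_le_of_max hq hβ h hx hk hmax).1
    by_cases h3 : β < beta3 q
    · rwa [height, if_pos h3]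
    · rw [height, if_neg h3]
      rcases (not_lt.1 h3).eq_or_lt with h4 | h4
      · subst h4; rwa [← heightV1_eq_heightU2 hq]
      · exact (heightU2_lt_heightV1 hq h4 h.le).le.trans hA
  · rw [threshold_of_le h] at hmax
    rw [eq_pPoint_of_max hq hx hmax, height, if_neg (not_lt.2 (h34.le.trans h))]
    exact (heightU2_lt_pPoint hq h).le

/-- The open region of points whose strictly largest coordinate is `k`, above `c`. -/
def region (c : ℝ) (k : Fin q) : Set (Fin q → ℝ) := {x | c < x k ∧ ∀ j, j ≠ k → x j < x k}

lemma isOpen_region (c : ℝ) (k : Fin q) : IsOpen (region c k) := by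
  have h : IsOpen {x : Fin q → ℝ | ∀ j, j ≠ k → x j < x k} := by
    simp only [Set.ofPred_forall]
    exact isOpen_iInter_of_finite fun j => isOpen_iInter_of_finite fun _ =>
      isOpen_lt (continuous_apply j) (continuous_apply k)
  exact (isOpen_lt continuous_const (continuous_apply k)).inter h

lemma closure_region (c : ℝ) (k : Fin q) :
    closure (region c k) ⊆ {x | c ≤ x k ∧ ∀ j, x j ≤ x k} := by
  have h : IsClosed {x : Fin q → ℝ | ∀ j, x j ≤ x k} := by
    simp only [Set.ofPred_forall]
    exact isClosed_iInter fun j => isClosed_le (continuous_apply j) (continuous_apply k)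
  refine closure_minimal ?_ ((isClosed_le continuous_const (continuous_apply k)).inter h)
  rintro x ⟨h1, h2⟩
  refine ⟨h1.le, fun j => ?_⟩
  by_cases hj : j = k
  · rw [hj]
  · exact (h2 j hj).le

lemma disjoint_region (c : ℝ) {k l : Fin q} (hkl : k ≠ l) :
    Disjoint (region c k) (region c l) := by
  rw [Set.disjoint_left]
  rintro x ⟨-, h1⟩ ⟨-, h2⟩
  exact lt_asymm (h1 l hkl.symm) (h2 k hkl)

/-- The components of the sublevel set do not leave the region. -/
lemma component_subset_region (hq : 5 ≤ q) (hβ : beta1 q < β) {k : Fin q} {x : Fin q → ℝ}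
    (hx : x ∈ sublevel q β (height q β)) (hxk : x ∈ region (threshold q β) k) :
    connectedComponentIn (sublevel q β (height q β)) x ⊆ region (threshold q β) k := by
  -- A preconnected set that meets an open set and avoids its boundary stays inside. A boundary
  -- point has maximum equal to the threshold or a tie, hence height at least `H`.
  refine isPreconnected_connectedComponentIn.subset_of_closure_inter_subset (isOpen_region _ _)
    ⟨x, mem_connectedComponentIn hx, hxk⟩ ?_
  rintro y ⟨hy, hyc⟩
  obtain ⟨hys, hyF⟩ := connectedComponentIn_subset _ _ hyc
  obtain ⟨h1, h2⟩ := closure_region _ _ hy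
  have hlt : threshold q β < y k := by
    refine h1.lt_of_ne fun h => ?_
    exact absurd hyF (not_lt.2 (height_le_of_max hq hβ hys h.symm (fun j => h ▸ h2 j)))
  refine ⟨hlt, fun j hj => (h2 j).lt_of_ne fun h => ?_⟩
  exact absurd hyF (not_lt.2
    (height_le_of_mem_tieSet hq hβ hj.symm ⟨hys, h.symm, h2, h1⟩).1)

lemma pPoint_not_mem_region (hq : 5 ≤ q) (hβ : beta1 q < β) (k : Fin q) :
    pPoint q ∉ region (threshold q β) k :=
  fun h => absurd h.1 (not_lt.2 (inv_le_threshold hq hβ))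

/-- The local minima of the potential are `p` and the elements of `𝒰_1`. -/
lemma localMin_eq (hq : 5 ≤ q) (hβ : beta1 q < β) {y : Fin q → ℝ}
    (hy : y ∈ stdSimplex ℝ (Fin q))
    (hmin : IsLocalMinOn (potential β) (stdSimplex ℝ (Fin q)) y) :
    y = pPoint q ∨ (∃ k, y = u1Point β k) ∨ β < q ∧ ∃ k, y = v1Point β k := by
  have h1 := solSpec_one hq hβ
  rcases localMin_cases (by omega) ((beta1_pos hq).trans hβ) hy hmin with
    h | ⟨k, t, ht0, ht, hg, hyt⟩
  · exact Or.inl h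
  · right
    rcases h1.eq_or (mem_gDomain_of_lt_inv one_pos (by omega) ht0 ht) hg with h | h
    · left; exact ⟨k, by rw [hyt, h, u1Point]⟩
    -- The points `v_1^k` are not excluded as local minima here. In later uses they are discarded
    -- because they lie outside the region of `k` or exactly at the level.
    · right
      refine ⟨?_, k, by rw [hyt, h, v1Point]⟩
      by_contra hc
      rcases (not_lt.1 hc).eq_or_lt with h2 | h2
      · subst h2
        rw [h, h1.v_eq_inv one_pos (by omega)] at ht
        exact lt_irrefl _ ht
      · exact lt_asymm ht (h ▸ h1.inv_lt_v one_pos (by omega) h2)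

lemma u1Point_self (β : ℝ) (k : Fin q) : u1Point β k k = bval q 1 (uSol q 1 β) := by
  simp [u1Point, twoValued, bval]

lemma u1Point_of_ne (β : ℝ) {k j : Fin q} (h : j ≠ k) : u1Point β k j = uSol q 1 β := by
  simp [u1Point, twoValued, h]

/-- A point of low potential in the region of `k` belongs to the well of `k`. -/
lemma component_eq_well (hq : 5 ≤ q) (hβ : beta1 q < β) {k : Fin q} {x : Fin q → ℝ}
    (hx : x ∈ sublevel q β (height q β)) (hxk : x ∈ region (threshold q β) k) :
    u1Point β k ∈ sublevel q β (height q β) ∧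
      well β (some k) = connectedComponentIn (sublevel q β (height q β)) x := by
  have hsub := component_subset_region hq hβ hx hxk
  obtain ⟨y, hy, hmin⟩ := exists_isLocalMinOn β (height q β) hx
  have hyk := hsub hy
  have hys := connectedComponentIn_subset _ _ hy
  have h1 := solSpec_one hq hβ
  have hyu : y = u1Point β k := by
    rcases localMin_eq hq hβ hys.1 hmin with h | ⟨j, h⟩ | ⟨hβq, j, h⟩
    · exact absurd (h ▸ hyk) (pPoint_not_mem_region hq hβ k)
    · by_cases hjk : k = j
      · rw [hjk]; exact h
      · have h2 := hyk.2 j (Ne.symm hjk)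
        rw [h, u1Point_of_ne β hjk, u1Point_self] at h2
        exact absurd h2 (not_lt.2 (lt_bval one_pos (by omega) h1.u_lt_inv).le)
    · have hv := h1.v_lt_inv hβq
      by_cases hjk : k = j
      · have h2 := hyk.1
        rw [h, hjk, v1Point_self, threshold_of_lt hβq] at h2
        exact absurd h2 (lt_irrefl _)
      · have h2 := hyk.2 j (Ne.symm hjk)
        rw [h, v1Point_of_ne β hjk, v1Point_self] at h2
        exact absurd h2 (not_lt.2 (lt_bval one_pos (by omega) hv).le)
  rw [hyu] at hy hys
  exact ⟨hys, (connectedComponentIn_eq hy).symm⟩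

lemma well_subset_region (hq : 5 ≤ q) (hβ : beta1 q < β) {k : Fin q} :
    well β (some k) ⊆ region (threshold q β) k := by
  have h1 := solSpec_one hq hβ
  by_cases hu : u1Point β k ∈ sublevel q β (height q β)
  · refine component_subset_region hq hβ hu ⟨?_, fun j hj => ?_⟩
    · rw [u1Point_self]
      rcases lt_or_ge β q with h | h
      · rw [threshold_of_lt h]
        have := uSol_lt_vSol hq hβ
        have hq5 : (5 : ℝ) ≤ q := by exact_mod_cast hq
        rw [bval_one, bval_one]
        nlinarith
      · rw [threshold_of_le h]
        exact inv_lt_bval_one hq h1.u_lt_inv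
    · rw [u1Point_self, u1Point_of_ne β hj]
      exact lt_bval one_pos (by omega) h1.u_lt_inv
  · rw [show well β (some k) = connectedComponentIn (sublevel q β (height q β)) (u1Point β k)
      from rfl, connectedComponentIn_eq_empty hu]
    exact Set.empty_subset _

lemma closure_sublevel_le {C : Set (Fin q → ℝ)} {h : ℝ} (hC : C ⊆ sublevel q β h)
    {x : Fin q → ℝ} (hx : x ∈ closure C) : x ∈ stdSimplex ℝ (Fin q) ∧ potential β x ≤ h :=
  by
  have hcl : IsClosed {x | x ∈ stdSimplex ℝ (Fin q) ∧ potential β x ≤ h} :=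
    (isClosed_stdSimplex ℝ (Fin q)).inter (isClosed_le (continuous_potential β) continuous_const)
  have hsub : C ⊆ {x | x ∈ stdSimplex ℝ (Fin q) ∧ potential β x ≤ h} :=
    fun _ hy => ⟨(hC hy).1, (hC hy).2.le⟩
  exact closure_minimal hsub hcl hx

lemma well_some_subset (β : ℝ) (k : Fin q) : well β (some k) ⊆ sublevel q β (height q β) :=
  connectedComponentIn_subset _ _

lemma well_none_subset (q : ℕ) (β : ℝ) :
    well β (none : Option (Fin q)) ⊆ sublevel q β (heightV1 q β) :=
  connectedComponentIn_subset _ _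

lemma mem_closure_well (hq : 5 ≤ q) (hβ : beta1 q < β) {k : Fin q} {x : Fin q → ℝ}
    (hx : x ∈ closure (well β (some k))) :
    (x ∈ stdSimplex ℝ (Fin q) ∧ potential β x ≤ height q β) ∧
      threshold q β ≤ x k ∧ ∀ j, x j ≤ x k :=
  ⟨closure_sublevel_le (well_some_subset β k) hx,
    closure_region _ _ (closure_mono (well_subset_region hq hβ) hx)⟩

lemma disjoint_wells (hq : 5 ≤ q) (hβ : beta1 q < β) {k l : Fin q} (hkl : k ≠ l) :
    Disjoint (well β (some k)) (well β (some l)) :=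
  (disjoint_region _ hkl).mono (well_subset_region hq hβ) (well_subset_region hq hβ)

/-- Points common to the closures of two wells. -/
lemma mem_gate_some (hq : 5 ≤ q) (hβ : beta1 q < β) {k l : Fin q} (hkl : k ≠ l) {x : Fin q → ℝ}
    (hx : x ∈ gate β (some k) (some l)) : beta3 q ≤ β ∧ x = u2Point β k l := by
  obtain ⟨⟨hs, hF⟩, h1, h2⟩ := mem_closure_well hq hβ hx.1
  obtain ⟨-, h3, h4⟩ := mem_closure_well hq hβ hx.2
  have hB := height_le_of_mem_tieSet hq hβ hkl ⟨hs, le_antisymm (h4 k) (h2 l), h2, h1⟩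
  exact hB.2 (le_antisymm hF hB.1)

lemma u2Point_comm (β : ℝ) (k l : Fin q) : u2Point β k l = u2Point β l k := by
  rw [u2Point, u2Point, Finset.pair_comm]

/-- Above the third critical temperature `u_2^{k,l}` is adherent to the well of `k`. -/
lemma u2Point_adherent (hq : 5 ≤ q) (hβ : beta3 q ≤ β) {k l : Fin q} (hkl : k ≠ l) :
    (well β (some k)).Nonempty ∧ u2Point β k l ∈ closure (well β (some k)) := by
  have hβ1 := (beta1_lt_beta3 hq).trans_le hβ
  have hpos := (beta1_pos hq).trans hβ1
  have h2 := solSpec_two hq hβ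
  have hcard : ({k, l} : Finset (Fin q)).card = 2 := Finset.card_pair hkl
  set x := u2Point β k l with hx
  set a := bval q 2 (uSol q 2 β) with ha
  have hua : uSol q 2 β < a := lt_bval two_pos (by omega) h2.u_lt_inv
  have hxk : ∀ m ∈ ({k, l} : Finset (Fin q)), x m = a := by
    intro m hm
    simp only [hx, u2Point, twoValued, hm, if_true, hcard, ha, bval]
  have hxm : ∀ m ∉ ({k, l} : Finset (Fin q)), x m = uSol q 2 β := by
    intro m hm
    simp only [hx, u2Point, twoValued, hm, if_false]
  have hk := hxk k (by simp)
  have hl := hxk l (by simp)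
  have haβ : 1 / β < a := (dphi_eq_sides hpos h2.u_pos hua
    (dphi_eq_of_g_eq two_pos (by omega) hpos h2.u_mem h2.g_u)).2
  have ha0 : 0 < a := h2.u_pos.trans hua
  have hac : threshold q β < a := by
    rcases lt_or_ge β q with h | h
    · rw [threshold_of_lt h]
      exact bval_v_lt_bval_u hq ((beta3_spec hq).1.le.trans hβ) h
    · rw [threshold_of_le h]
      have hq5 : (5 : ℝ) ≤ q := by exact_mod_cast hq
      have hq0 : (0 : ℝ) < q := by linarith
      have := (lt_div_iff₀ hq0).1 h2.u_lt_inv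
      have e : 2 * a = 1 - ((q : ℝ) - 2) * uSol q 2 β := by rw [ha, bval]; push_cast; ring
      rw [div_lt_iff₀ hq0]
      nlinarith
  have hxs : x ∈ stdSimplex ℝ (Fin q) :=
    twoValued_mem_stdSimplex ⟨k, by simp⟩ (by omega) (hcard ▸ h2.u_mem)
  have hlk : l ∉ ({k} : Finset (Fin q)) := by simpa using hkl.symm
  have hb : ∀ m ∈ ({k} : Finset (Fin q)), x m = a := by
    intro m hm; rw [Finset.mem_singleton.1 hm, hk]
  have hFx : potential β x = height q β := by
    rw [height, if_neg (not_lt.2 hβ), hx, potential_u2Point hq β hkl]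
  -- The common value exceeds `1 / β`, so moving mass from `l` to `k` goes below `H` and makes `k`
  -- the strict maximum.
  have hlow := eventually_shift_neg_lt hpos hlk (Finset.singleton_nonempty k) hb ha0
    (hl ▸ ha0) (Or.inr ⟨hl, haβ⟩)
  have hev : ∀ᶠ s in nhdsWithin (0 : ℝ) (Set.Ioi 0), shift x l {k} (-1 * s) ∈ well β (some k) := by
    filter_upwards [hlow, Ioo_mem_nhdsGT ha0] with s hs hs0
    rw [neg_one_mul]
    have hsk : shift x l {k} (-s) k = a + s := by
      simp [shift, hkl, hk]
    have hmem : shift x l {k} (-s) ∈ sublevel q β (height q β) := by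
      refine ⟨shift_mem_stdSimplex hxs hlk (Finset.singleton_nonempty k) hb ?_ ?_, hFx ▸ hs⟩
      · rw [hl]; linarith [hs0.2]
      · simp; linarith [hs0.1]
    have hreg : shift x l {k} (-s) ∈ region (threshold q β) k := by
      refine ⟨by rw [hsk]; linarith [hs0.1], fun j hj => ?_⟩
      rw [hsk]
      by_cases hjl : j = l
      · simp only [shift, hjl, if_true, hl]; linarith [hs0.1]
      · simp only [shift, hjl, if_false, Finset.mem_singleton, hj]
        rw [hxm j (by simp [hj, hjl])]
        linarith [hs0.1]
    rw [(component_eq_well hq hβ1 hmem hreg).2]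
    exact mem_connectedComponentIn hmem
  obtain ⟨s, hs⟩ := hev.exists
  exact ⟨⟨_, hs⟩, mem_closure_of_tendsto (tendsto_shift x l {k} (-1)) hev⟩

end Wells

/-! ### The central well, its gates, and the level `F(v_1)` -/

section Center

variable {q : ℕ} {β : ℝ}

/-- The points all of whose coordinates are below `c`. -/
def centralRegion (q : ℕ) (c : ℝ) : Set (Fin q → ℝ) := {x | ∀ j, x j < c}

lemma isOpen_centralRegion (c : ℝ) : IsOpen (centralRegion q c) := by
  simp only [centralRegion, Set.ofPred_forall]
  exact isOpen_iInter_of_finite fun j => isOpen_lt (continuous_apply j) continuous_const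

lemma closure_centralRegion (c : ℝ) : closure (centralRegion q c) ⊆ {x | ∀ j, x j ≤ c} := by
  have h : IsClosed {x : Fin q → ℝ | ∀ j, x j ≤ c} := by
    simp only [Set.ofPred_forall]
    exact isClosed_iInter fun j => isClosed_le (continuous_apply j) continuous_const
  exact closure_minimal (fun x hx j => (hx j).le) h

/-- The points with some coordinate above `c`. -/
def outerRegion (q : ℕ) (c : ℝ) : Set (Fin q → ℝ) := {x | ∃ j, c < x j}

lemma isOpen_outerRegion (c : ℝ) : IsOpen (outerRegion q c) := by
  simp only [outerRegion, Set.ofPred_exists]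
  exact isOpen_iUnion fun j => isOpen_lt continuous_const (continuous_apply j)

lemma closure_outerRegion (c : ℝ) : closure (outerRegion q c) ⊆ {x | ∃ j, c ≤ x j} := by
  have h : IsClosed {x : Fin q → ℝ | ∃ j, c ≤ x j} := by
    simp only [Set.ofPred_exists]
    exact isClosed_iUnion_of_finite fun j => isClosed_le continuous_const (continuous_apply j)
  exact closure_minimal (fun x ⟨j, hj⟩ => ⟨j, hj.le⟩) h

/-- The form in which the surface barrier is used: no path below `F(v_1)` crosses from the central
to the outer region. -/
lemma not_lt_heightV1 (hq : 5 ≤ q) (hβ : beta1 q < β) (hβq : β < q) {x : Fin q → ℝ}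
    (hx : x ∈ sublevel q β (heightV1 q β)) (hmax : ∀ j, x j ≤ threshold q β) {k : Fin q}
    (hk : threshold q β ≤ x k) : False :=
  absurd hx.2 (not_lt.2
    (heightV1_le_of_max hq hβ hβq hx.1 (le_antisymm (hmax k) hk) hmax).1)

lemma fLine_lt_heightV1 (hq : 5 ≤ q) (hβ : beta1 q < β) {t : ℝ} (h1 : uSol q 1 β ≤ t)
    (h2 : t < vSol q 1 β) (hβq : β < q) : fLine q 1 β t < heightV1 q β := by
  have hs := solSpec_one hq hβ
  rw [heightV1_eq hq]
  exact fLine_lt_of_g_lt one_pos (by omega) ((beta1_pos hq).trans hβ) (hs.u_pos.le.trans h1) h2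
    (hs.v_lt_inv hβq).le fun r hr => hs.mid r (h1.trans_lt hr.1) hr.2

lemma fLine_lt_heightV1' (hq : 5 ≤ q) (hβ : beta1 q < β) {t : ℝ} (h1 : vSol q 1 β < t)
    (h2 : t ≤ 1 / (q : ℝ)) : fLine q 1 β t < heightV1 q β := by
  have hs := solSpec_one hq hβ
  rw [heightV1_eq hq]
  exact fLine_lt_of_lt_g one_pos (by omega) ((beta1_pos hq).trans hβ) hs.pos.le h1 h2
    fun r hr => hs.v_lt_g r hr.1 ((hr.2.trans_le h2).trans (inv_mem_gDomain one_pos (by omega)).2)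

lemma twoValued_mem_sublevel {k : Fin q} (hq : 5 ≤ q) {t h : ℝ} (ht0 : 0 < t)
    (ht : t ≤ 1 / (q : ℝ)) (hF : fLine q 1 β t < h) : twoValued {k} t ∈ sublevel q β h := by
  refine ⟨twoValued_mem_stdSimplex (Finset.singleton_nonempty k) ?_ ?_, ?_⟩
  · rw [Finset.card_singleton]; omega
  · rw [Finset.card_singleton]
    exact ⟨ht0, ht.trans_lt (inv_mem_gDomain one_pos (by omega)).2⟩
  · rwa [potential_twoValued, Finset.card_singleton]

lemma pPoint_mem_sublevel (hq : 5 ≤ q) (hβ : beta1 q < β) (hβq : β < q) :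
    pPoint q ∈ sublevel q β (heightV1 q β) := by
  obtain ⟨k, -⟩ := exists_ne_ne hq
  rw [← twoValued_inv (Finset.singleton_nonempty k)]
  exact twoValued_mem_sublevel hq (by
    have : (0 : ℝ) < q := by exact_mod_cast (by omega : 0 < q)
    positivity) le_rfl
    (fLine_lt_heightV1' hq hβ ((solSpec_one hq hβ).v_lt_inv hβq) le_rfl)

lemma pPoint_mem_well (hq : 5 ≤ q) (hβ : beta1 q < β) (hβq : β < q) :
    pPoint q ∈ well β (none : Option (Fin q)) :=
  mem_connectedComponentIn (pPoint_mem_sublevel hq hβ hβq)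

lemma pPoint_mem_centralRegion (hq : 5 ≤ q) (hβ : beta1 q < β) (hβq : β < q) :
    pPoint q ∈ centralRegion q (threshold q β) := fun _ => inv_lt_threshold hq hβ hβq

lemma well_none_subset_centralRegion (hq : 5 ≤ q) (hβ : beta1 q < β) (hβq : β < q) :
    well β (none : Option (Fin q)) ⊆ centralRegion q (threshold q β) := by
  have hp := pPoint_mem_well hq hβ hβq
  refine (isPreconnected_connectedComponentIn (F := sublevel q β (heightV1 q β))
    (x := pPoint q)).subset_of_closure_inter_subset (isOpen_centralRegion _)
    ⟨_, hp, pPoint_mem_centralRegion hq hβ hβq⟩ ?_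
  rintro y ⟨hy, hyc⟩ j
  by_contra hc
  exact not_lt_heightV1 hq hβ hβq (well_none_subset q β hyc) (closure_centralRegion _ hy)
    (not_lt.1 hc)

lemma mem_closure_well_none (hq : 5 ≤ q) (hβ : beta1 q < β) (hβq : β < q) {x : Fin q → ℝ}
    (hx : x ∈ closure (well β (none : Option (Fin q)))) :
    (x ∈ stdSimplex ℝ (Fin q) ∧ potential β x ≤ heightV1 q β) ∧ ∀ j, x j ≤ threshold q β :=
  ⟨closure_sublevel_le (well_none_subset q β) hx,
    closure_centralRegion _ (closure_mono (well_none_subset_centralRegion hq hβ hβq) hx)⟩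

/-- `v_1^k` is adherent to the central well. -/
lemma v1Point_mem_closure_none (hq : 5 ≤ q) (hβ : beta1 q < β) (hβq : β < q) (k : Fin q) :
    v1Point β k ∈ closure (well β (none : Option (Fin q))) := by
  have hs := solSpec_one hq hβ
  have hv := hs.v_lt_inv hβq
  have hsub : (fun t => twoValued {k} t) '' Set.Ioc (vSol q 1 β) (1 / (q : ℝ)) ⊆
      well β (none : Option (Fin q)) := by
    refine IsPreconnected.subset_connectedComponentIn
      (isPreconnected_Ioc.image _ (continuous_twoValued {k}).continuousOn)
      ⟨1 / (q : ℝ), ⟨hv, le_rfl⟩, twoValued_inv (Finset.singleton_nonempty k)⟩ ?_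
    rintro _ ⟨t, ht, rfl⟩
    exact twoValued_mem_sublevel hq (hs.pos.trans ht.1) ht.2 (fLine_lt_heightV1' hq hβ ht.1 ht.2)
  refine closure_mono hsub (image_closure_subset_closure_image (continuous_twoValued {k})
    ⟨vSol q 1 β, ?_, rfl⟩)
  rw [closure_Ioc hv.ne]
  exact ⟨le_rfl, hv.le⟩

lemma u1Point_mem_sublevel_heightV1 (hq : 5 ≤ q) (hβ : beta1 q < β) (hβq : β < q) (k : Fin q) :
    u1Point β k ∈ sublevel q β (heightV1 q β) :=
  twoValued_mem_sublevel hq (solSpec_one hq hβ).u_pos (solSpec_one hq hβ).u_lt_inv.le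
    (fLine_lt_heightV1 hq hβ le_rfl (uSol_lt_vSol hq hβ) hβq)

/-- `v_1^k` is adherent to the component of `u_1^k`. -/
lemma v1Point_mem_closure_component (hq : 5 ≤ q) (hβ : beta1 q < β) (hβq : β < q) (k : Fin q) :
    v1Point β k ∈ closure (connectedComponentIn (sublevel q β (heightV1 q β)) (u1Point β k)) := by
  have hs := solSpec_one hq hβ
  have huv := uSol_lt_vSol hq hβ
  have hsub : (fun t => twoValued {k} t) '' Set.Ico (uSol q 1 β) (vSol q 1 β) ⊆
      connectedComponentIn (sublevel q β (heightV1 q β)) (u1Point β k) := by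
    refine IsPreconnected.subset_connectedComponentIn
      (isPreconnected_Ico.image _ (continuous_twoValued {k}).continuousOn)
      ⟨uSol q 1 β, ⟨le_rfl, huv⟩, rfl⟩ ?_
    rintro _ ⟨t, ht, rfl⟩
    exact twoValued_mem_sublevel hq (hs.u_pos.trans_le ht.1) (ht.2.trans (hs.v_lt_inv hβq)).le
      (fLine_lt_heightV1 hq hβ ht.1 ht.2 hβq)
  refine closure_mono hsub (image_closure_subset_closure_image (continuous_twoValued {k})
    ⟨vSol q 1 β, ?_, rfl⟩)
  rw [closure_Ico huv.ne]
  exact ⟨huv.le, le_rfl⟩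

lemma height_eq_heightV1 (hq : 5 ≤ q) (hβ : β ≤ beta3 q) : height q β = heightV1 q β := by
  rcases hβ.eq_or_lt with h | h
  · rw [height, if_neg h.not_lt, h, heightV1_eq_heightU2 hq]
  · rw [height, if_pos h]

lemma height_lt_heightV1 (hq : 5 ≤ q) (hβ : beta3 q < β) (hβq : β < q) :
    height q β < heightV1 q β := by
  rw [height, if_neg hβ.not_gt]
  exact heightU2_lt_heightV1 hq hβ hβq.le

lemma disjoint_well_none (hq : 5 ≤ q) (hβ : beta1 q < β) (hβq : β < q) (k : Fin q) :
    Disjoint (well β none) (well β (some k)) := by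
  rw [Set.disjoint_left]
  intro x hx hxk
  exact lt_asymm (well_none_subset_centralRegion hq hβ hβq hx k)
    (well_subset_region hq hβ hxk).1

lemma pairwise_disjoint_wells (hq : 5 ≤ q) (hβ : beta1 q < β) (hβq : β < q) :
    ∀ k l : Option (Fin q), k ≠ l → Disjoint (well β k) (well β l)
  | none, none, h => absurd rfl h
  | none, some k, _ => disjoint_well_none hq hβ hβq k
  | some k, none, _ => (disjoint_well_none hq hβ hβq k).symm
  | some _, some _, h => disjoint_wells hq hβ fun e => h (congrArg some e)

lemma wells_nonempty (hq : 5 ≤ q) (hβ : beta1 q < β) (hβ3 : β ≤ beta3 q) :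
    ∀ k : Option (Fin q), (well β k).Nonempty
  | none => ⟨_, pPoint_mem_well hq hβ (hβ3.trans_lt (beta3_spec hq).2.1)⟩
  | some k => ⟨u1Point β k, mem_connectedComponentIn (by
      rw [height_eq_heightV1 hq hβ3]
      exact u1Point_mem_sublevel_heightV1 hq hβ (hβ3.trans_lt (beta3_spec hq).2.1) k)⟩

/-- A common adherent point has maximal coordinate `x k` equal to the threshold and height at most
`F(v_1)`, so it is the equality case of the barrier. Up to `β_3` the outer level is also `F(v_1)`,
hence `v_1^k` is reached from both sides. -/
lemma gate_none_some (hq : 5 ≤ q) (hβ : beta1 q < β) (hβ3 : β ≤ beta3 q) (k : Fin q) :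
    gate β none (some k) = {v1Point β k} := by
  have hβq := hβ3.trans_lt (beta3_spec hq).2.1
  ext x
  rw [Set.mem_singleton_iff]
  constructor
  · rintro ⟨h1, h2⟩
    obtain ⟨⟨hs, hF⟩, hmax⟩ := mem_closure_well_none hq hβ hβq h1
    obtain ⟨-, h3, -⟩ := mem_closure_well hq hβ h2
    have hA := heightV1_le_of_max hq hβ hβq hs (le_antisymm (hmax k) h3) hmax
    exact hA.2 (le_antisymm hF hA.1)
  · rintro rfl
    refine ⟨v1Point_mem_closure_none hq hβ hβq k, ?_⟩
    rw [show well β (some k) = connectedComponentIn (sublevel q β (height q β)) (u1Point β k)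
      from rfl, height_eq_heightV1 hq hβ3]
    exact v1Point_mem_closure_component hq hβ hβq k

/-- Below `q` a common point would lie on the barrier, at height at least `F(v_1) > H`. From `q` on,
`F(v_1) ≤ F(p)` and the central well is empty by definition. -/
lemma gate_none_some_eq_empty (hq : 5 ≤ q) (hβ3 : beta3 q < β) (k : Fin q) :
    gate β none (some k) = ∅ := by
  have hβ := (beta1_lt_beta3 hq).trans hβ3
  rw [Set.eq_empty_iff_forall_notMem]
  rintro x ⟨h1, h2⟩
  rcases lt_or_ge β q with hβq | hβq
  · obtain ⟨⟨hs, -⟩, hmax⟩ := mem_closure_well_none hq hβ hβq h1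
    obtain ⟨⟨-, hF⟩, h3, -⟩ := mem_closure_well hq hβ h2
    have hA := heightV1_le_of_max hq hβ hβq hs (le_antisymm (hmax k) h3) hmax
    linarith [hA.1, height_lt_heightV1 hq hβ3 hβq]
  · have : well β (none : Option (Fin q)) = ∅ :=
      connectedComponentIn_eq_empty fun h => absurd h.2 (not_lt.2 (heightV1_le_pPoint hq hβq))
    rw [this, closure_empty] at h1
    exact h1

lemma gate_some_some_eq_empty (hq : 5 ≤ q) (hβ : beta1 q < β) (hβ3 : β < beta3 q) {k l : Fin q}
    (hkl : k ≠ l) : gate β (some k) (some l) = ∅ :=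
  Set.eq_empty_iff_forall_notMem.2 fun _ hx =>
    absurd (mem_gate_some hq hβ hkl hx).1 (not_le.2 hβ3)

lemma gate_some_some (hq : 5 ≤ q) (hβ3 : beta3 q ≤ β) {k l : Fin q} (hkl : k ≠ l) :
    gate β (some k) (some l) = {u2Point β k l} := by
  have hβ := (beta1_lt_beta3 hq).trans_le hβ3
  ext x
  rw [Set.mem_singleton_iff]
  refine ⟨fun hx => (mem_gate_some hq hβ hkl hx).2, ?_⟩
  rintro rfl
  exact ⟨(u2Point_adherent hq hβ3 hkl).2, u2Point_comm β l k ▸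
    (u2Point_adherent hq hβ3 hkl.symm).2⟩

lemma well_some_nonempty (hq : 5 ≤ q) (hβ3 : beta3 q ≤ β) (k : Fin q) :
    (well β (some k)).Nonempty := by
  have : Nontrivial (Fin q) := Fin.nontrivial_iff_two_le.2 (by omega)
  obtain ⟨l, hl⟩ := exists_ne k
  exact (u2Point_adherent hq hβ3 hl.symm).1

lemma u1Point_mem_well (hq : 5 ≤ q) (hβ3 : beta3 q ≤ β) (k : Fin q) :
    u1Point β k ∈ well β (some k) :=
  mem_connectedComponentIn (connectedComponentIn_nonempty_iff.1 (well_some_nonempty hq hβ3 k))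

/-- At the level `F_β(v_1)` the wells of the `u_1^k` belong to one component. -/
lemma u1Point_mem_component (hq : 5 ≤ q) (hβ3 : beta3 q < β) (hβq : β < q) (k l : Fin q) :
    u1Point β l ∈ connectedComponentIn (sublevel q β (heightV1 q β)) (u1Point β k) := by
  have hβ := (beta1_lt_beta3 hq).trans hβ3
  by_cases hkl : k = l
  · rw [hkl]; exact mem_connectedComponentIn (u1Point_mem_sublevel_heightV1 hq hβ hβq l)
  have hH := height_lt_heightV1 hq hβ3 hβq
  -- The closed wells stay at heights at most `H < F(v_1)`, and those of `k` and `l` share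
  -- `u_2^{k,l}`, so their union is connected inside the higher sublevel set.
  have hcl : ∀ m, closure (well β (some m)) ⊆ sublevel q β (heightV1 q β) := fun m x hx =>
    ⟨(mem_closure_well hq hβ hx).1.1, (mem_closure_well hq hβ hx).1.2.trans_lt hH⟩
  have hpre : ∀ m : Fin q, IsPreconnected (closure (well β (some m))) := fun m =>
    isPreconnected_connectedComponentIn.closure
  have hU := (hpre k).union (u2Point β k l) (u2Point_adherent hq hβ3.le hkl).2
    (u2Point_comm β l k ▸ (u2Point_adherent hq hβ3.le (Ne.symm hkl)).2) (hpre l)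
  exact hU.subset_connectedComponentIn (Or.inl (subset_closure (u1Point_mem_well hq hβ3.le k)))
    (Set.union_subset (hcl k) (hcl l))
    (Or.inr (subset_closure (u1Point_mem_well hq hβ3.le l)))

lemma component_subset_outerRegion (hq : 5 ≤ q) (hβ : beta1 q < β) (hβq : β < q) (k : Fin q) :
    connectedComponentIn (sublevel q β (heightV1 q β)) (u1Point β k) ⊆
      outerRegion q (threshold q β) := by
  have hq5 : (5 : ℝ) ≤ q := by exact_mod_cast hq
  have huv := uSol_lt_vSol hq hβ
  refine isPreconnected_connectedComponentIn.subset_of_closure_inter_subset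
    (isOpen_outerRegion _) ⟨u1Point β k, mem_connectedComponentIn
      (u1Point_mem_sublevel_heightV1 hq hβ hβq k), k, ?_⟩ ?_
  · rw [u1Point_self, threshold_of_lt hβq, bval_one, bval_one]
    nlinarith
  · rintro y ⟨hy, hyc⟩
    obtain ⟨j, hj⟩ := closure_outerRegion _ hy
    by_contra hc
    have hmax : ∀ m, y m ≤ threshold q β := fun m => not_lt.1 fun h => hc ⟨m, h⟩
    exact not_lt_heightV1 hq hβ hβq (connectedComponentIn_subset _ _ hyc) hmax hj

lemma components_heightV1 (hq : 5 ≤ q) (hβ3 : beta3 q < β) (hβq : β < q) (k : Fin q) :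
    components (sublevel q β (heightV1 q β)) =
      {well β (none : Option (Fin q)),
        connectedComponentIn (sublevel q β (heightV1 q β)) (u1Point β k)} := by
  have hβ := (beta1_lt_beta3 hq).trans hβ3
  ext C
  rw [Set.mem_insert_iff, Set.mem_singleton_iff]
  constructor
  · rintro ⟨x, hx, rfl⟩
    obtain ⟨y, hy, hmin⟩ := exists_isLocalMinOn β _ hx
    have hys := connectedComponentIn_subset _ _ hy
    have hyC := connectedComponentIn_eq hy
    rcases localMin_eq hq hβ hys.1 hmin with h | ⟨j, h⟩ | ⟨-, j, h⟩
    · left; rw [hyC, h]; rfl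
    · right; rw [hyC, h]
      exact (connectedComponentIn_eq (u1Point_mem_component hq hβ3 hβq k j)).symm
    -- `v_1^j` has exactly the height of the level, so it is not in the strict sublevel set.
    · exact absurd hys.2 (by rw [h, potential_v1Point hq]; exact lt_irrefl _)
  · rintro (rfl | rfl)
    · exact ⟨_, pPoint_mem_sublevel hq hβ hβq, rfl⟩
    · exact ⟨_, u1Point_mem_sublevel_heightV1 hq hβ hβq k, rfl⟩

lemma closure_inter_closure_component (hq : 5 ≤ q) (hβ3 : beta3 q < β) (hβq : β < q) (k : Fin q) :
    closure (well β (none : Option (Fin q))) ∩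
      closure (connectedComponentIn (sublevel q β (heightV1 q β)) (u1Point β k)) = V1 q β := by
  have hβ := (beta1_lt_beta3 hq).trans hβ3
  ext x
  constructor
  · rintro ⟨h1, h2⟩
    obtain ⟨⟨hs, hF⟩, hmax⟩ := mem_closure_well_none hq hβ hβq h1
    obtain ⟨j, hj⟩ := closure_outerRegion _
      (closure_mono (component_subset_outerRegion hq hβ hβq k) h2)
    have hA := heightV1_le_of_max hq hβ hβq hs (le_antisymm (hmax j) hj) hmax
    exact ⟨j, (hA.2 (le_antisymm hF hA.1)).symm⟩
  · rintro ⟨j, rfl⟩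
    refine ⟨v1Point_mem_closure_none hq hβ hβq j, ?_⟩
    rw [connectedComponentIn_eq (u1Point_mem_component hq hβ3 hβq k j)]
    exact v1Point_mem_closure_component hq hβ hβq j

end Center

/-! ### The points `v_1^k` are saddle points -/

section Saddle

variable {q : ℕ} {β : ℝ}

lemma hasDerivAt_potential_line (β : ℝ) (x w : Fin q → ℝ) {s : ℝ} (h : ∀ k, x k + s * w k ≠ 0) :
    HasDerivAt (fun s : ℝ => potential β (x + s • w)) (∑ k, dphi β (x k + s * w k) * w k) s := by
  have h1 : (fun s : ℝ => potential β (x + s • w)) = fun s => ∑ k, phi β (x k + s * w k) := by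
    ext s; rw [potential_eq_sum]; rfl
  rw [h1]
  refine HasDerivAt.fun_sum fun k _ => ?_
  have h2 : HasDerivAt (fun s : ℝ => x k + s * w k) (w k) s := by
    simpa using ((hasDerivAt_id s).mul_const (w k)).const_add (x k)
  exact (hasDerivAt_phi β (h k)).comp s h2

lemma hessian_eq (β : ℝ) {x : Fin q → ℝ} (hx : ∀ k, 0 < x k) (w : Fin q → ℝ) :
    hessian β x w = ∑ k, (1 / (β * x k) - 1) * w k ^ 2 := by
  have hev : ∀ᶠ s in nhds (0 : ℝ), ∀ k, x k + s * w k ≠ 0 := by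
    rw [Filter.eventually_all]
    intro k
    have hc : Continuous fun s : ℝ => x k + s * w k := by fun_prop
    exact hc.continuousAt.eventually_ne (by simpa using (hx k).ne')
  have hd : deriv (fun s : ℝ => potential β (x + s • w)) =ᶠ[nhds 0]
      fun s => ∑ k, dphi β (x k + s * w k) * w k := by
    filter_upwards [hev] with s hs
    exact (hasDerivAt_potential_line β x w hs).deriv
  rw [hessian, iteratedDeriv_succ, iteratedDeriv_one, hd.deriv_eq]
  refine (HasDerivAt.fun_sum fun k _ => ?_).deriv
  have h2 : HasDerivAt (fun s : ℝ => x k + s * w k) (w k) 0 := by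
    simpa using ((hasDerivAt_id (0 : ℝ)).mul_const (w k)).const_add (x k)
  have h3 : x k + 0 * w k ≠ 0 := by simpa using (hx k).ne'
  have h4 := ((hasDerivAt_dphi β h3).comp (0 : ℝ) h2).mul_const (w k)
  refine h4.congr_deriv ?_
  rw [zero_mul, add_zero]; ring

lemma isSaddlePoint_v1Point (hq : 5 ≤ q) (hβ : beta1 q < β) (hβq : β < q) (k : Fin q) :
    IsSaddlePoint β (v1Point β k) := by
  have hs := solSpec_one hq hβ
  have hpos := (beta1_pos hq).trans hβ
  have hv := hs.v_lt_inv hβq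
  set v := vSol q 1 β with hvd
  set c := bval q 1 v with hc
  have hvc : v < c := lt_bval one_pos (by omega) hv
  have hd : dphi β v = dphi β c := dphi_eq_of_g_eq one_pos (by omega) hpos hs.v_mem hs.g_v
  have hvβ := (dphi_eq_sides hpos hs.pos hvc hd).1
  have hxk : v1Point β k k = c := v1Point_self β k
  have hxj : ∀ j, j ≠ k → v1Point β k j = v := fun j hj => v1Point_of_ne β hj
  have hc0 : 0 < c := hs.pos.trans hvc
  have hxpos : ∀ j, 0 < v1Point β k j := by
    intro j
    by_cases hj : j = k
    · rw [hj, hxk]; exact hc0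
    · rw [hxj j hj]; exact hs.pos
  have hq5 : (5 : ℝ) ≤ q := by exact_mod_cast hq
  have hhess : ∀ w : Fin q → ℝ, hessian β (v1Point β k) w =
      (1 / (β * c) - 1) * w k ^ 2 + (1 / (β * v) - 1) * ∑ j ∈ Finset.univ.erase k, w j ^ 2 := by
    intro w
    rw [hessian_eq β hxpos, ← Finset.add_sum_erase Finset.univ _ (Finset.mem_univ k), hxk,
      Finset.mul_sum]
    congr 1
    exact Finset.sum_congr rfl fun j hj => by rw [hxj j (Finset.ne_of_mem_erase hj)]
  refine ⟨twoValued_mem_stdSimplex (Finset.singleton_nonempty k)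
    (by rw [Finset.card_singleton]; omega) (by rw [Finset.card_singleton]; exact hs.v_mem),
    hxpos, ?_, ?_, ?_⟩
  · intro w hw
    have h0 : ∀ j, v1Point β k j + 0 * w j ≠ 0 := fun j => by simpa using (hxpos j).ne'
    rw [(hasDerivAt_potential_line β _ w h0).deriv]
    have : ∀ j, dphi β (v1Point β k j + 0 * w j) * w j = dphi β v * w j := by
      intro j
      rw [zero_mul, add_zero]
      by_cases hj : j = k
      · rw [hj, hxk, hd]
      · rw [hxj j hj]
    simp only [this, ← Finset.mul_sum, hw, mul_zero]
  -- The direction of the symmetric segment through `v_1^k`, along which `curvature_vSol` gives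
  -- strict concavity.
  · set e : Fin q → ℝ := fun j => if j = k then -((q : ℝ) - 1) else 1 with he
    have hek : e k = -((q : ℝ) - 1) := by simp [he]
    have hej : ∀ j, j ≠ k → e j = 1 := fun j hj => by simp [he, hj]
    have hcard : ((Finset.univ.erase k).card : ℝ) = (q : ℝ) - 1 := by
      rw [Finset.card_erase_of_mem (Finset.mem_univ k), Finset.card_univ, Fintype.card_fin,
        Nat.cast_sub (by omega)]
      simp
    have he0 : e ≠ 0 := fun h => by
      have := congrFun h k
      rw [hek, Pi.zero_apply] at this
      linarith
    have hsum : ∑ j, e j = 0 := by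
      rw [← Finset.add_sum_erase Finset.univ _ (Finset.mem_univ k), hek,
        Finset.sum_congr rfl fun j hj => hej j (Finset.ne_of_mem_erase hj), Finset.sum_const,
        nsmul_eq_mul, hcard]
      ring
    have hneg : hessian β (v1Point β k) e < 0 := by
      rw [hhess, hek, Finset.sum_congr rfl fun j hj =>
        (by rw [hej j (Finset.ne_of_mem_erase hj), one_pow] : e j ^ 2 = 1), Finset.sum_const,
        nsmul_eq_mul, hcard, mul_one]
      have hcurv := curvature_vSol one_pos (by omega : 2 * 1 < q) hβ hv
      rw [← hvd] at hcurv
      push_cast at hcurv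
      rw [← bval_one, ← hc, one_mul] at hcurv
      have h1 : (1 / (β * c) - 1) * (-((q : ℝ) - 1)) ^ 2 + (1 / (β * v) - 1) * ((q : ℝ) - 1) =
          ((q : ℝ) - 1) / β * (((q : ℝ) - 1) / c + 1 / v - q * β) := by
        have hv0 := hs.pos
        field_simp
        ring
      rw [h1]
      exact mul_neg_of_pos_of_neg (div_pos (by linarith) hpos) (by linarith)
    refine ⟨Submodule.span ℝ {e}, finrank_span_singleton he0, fun w hw => ?_⟩
    obtain ⟨r, rfl⟩ := Submodule.mem_span_singleton.1 hw
    refine ⟨by simp only [Pi.smul_apply, smul_eq_mul, ← Finset.mul_sum, hsum, mul_zero], ?_⟩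
    intro hr
    have hr0 : r ≠ 0 := fun h => hr (by rw [h, zero_smul])
    have hhom : hessian β (v1Point β k) (r • e) = r ^ 2 * hessian β (v1Point β k) e := by
      rw [hessian_eq β hxpos, hessian_eq β hxpos, Finset.mul_sum]
      refine Finset.sum_congr rfl fun j _ => ?_
      rw [Pi.smul_apply, smul_eq_mul]; ring
    rw [hhom]
    exact mul_neg_of_pos_of_neg (by positivity) hneg
  · rintro d ⟨V, rfl, hV⟩
    -- Since `v < 1 / β`, the Hessian is nonnegative on vectors with vanishing `k`-th coordinate. A
    -- negative definite space meets these only in `0`, so it embeds into the line by its `k`-th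
    -- coordinate.
    have hinj : Function.Injective ((LinearMap.proj k : (Fin q → ℝ) →ₗ[ℝ] ℝ) ∘ₗ V.subtype) := by
      rw [← LinearMap.ker_eq_bot, LinearMap.ker_eq_bot']
      intro w hw
      have hw : (w : Fin q → ℝ) k = 0 := hw
      by_contra hne
      have hlt := (hV w w.2).2 fun h => hne (Subtype.ext h)
      rw [hhess, hw] at hlt
      have h1 : 0 ≤ 1 / (β * v) - 1 := by
        have := (lt_div_iff₀ hpos).1 hvβ
        rw [sub_nonneg, le_div_iff₀ (mul_pos hpos hs.pos)]
        linarith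
      have := mul_nonneg h1 (Finset.sum_nonneg fun j (_ : j ∈ Finset.univ.erase k) =>
        sq_nonneg ((w : Fin q → ℝ) j))
      linarith
    have := LinearMap.finrank_le_finrank_of_injective hinj
    rwa [Module.finrank_self] at this

end Saddle

end CurieWeissPotts

/-! ### The theorem -/

open CurieWeissPotts in
/-- Wells and saddle gates of the Curie–Weiss–Potts potential for `q ≥ 5` spins. -/
theorem theorem3p5 (q : ℕ) (hq : 5 ≤ q) :
    -- `β₃` is the temperature at which the order of `F_β(v_1)` and `F_β(u_2)` is reversed
    (beta1 q < betaS q 2 ∧ betaS q 2 < beta3 q ∧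
      (∀ β ∈ Set.Ico (betaS q 2) (beta3 q), heightV1 q β < heightU2 q β) ∧
      heightV1 q (beta3 q) = heightU2 q (beta3 q) ∧
      (∀ β ∈ Set.Ioc (beta3 q) (q : ℝ), heightU2 q β < heightV1 q β)) ∧
    -- position of `β₃`
    beta3 q < q ∧
    -- wells and gates below `β₃`
    (∀ β ∈ Set.Ioo (beta1 q) (beta3 q),
      (∀ k : Option (Fin q), (well β k).Nonempty) ∧
      (∀ k l : Option (Fin q), k ≠ l → Disjoint (well β k) (well β l)) ∧
      (∀ k l : Fin q, k ≠ l → gate β (some k) (some l) = ∅) ∧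
      (∀ k : Fin q, gate β none (some k) = {v1Point β k})) ∧
    -- wells and gates at `β₃`
    (∀ β : ℝ, β = beta3 q →
      (∀ k : Option (Fin q), (well β k).Nonempty) ∧
      (∀ k l : Option (Fin q), k ≠ l → Disjoint (well β k) (well β l)) ∧
      (∀ k l : Fin q, k ≠ l → gate β (some k) (some l) = {u2Point β k l}) ∧
      (∀ k : Fin q, gate β none (some k) = {v1Point β k})) ∧
    -- wells and gates above `β₃`
    (∀ β ∈ Set.Ioi (beta3 q),
      (∀ k : Fin q, (well β (some k)).Nonempty) ∧
      (∀ k l : Fin q, k ≠ l → Disjoint (well β (some k)) (well β (some l))) ∧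
      (∀ k l : Fin q, k ≠ l → gate β (some k) (some l) = {u2Point β k l}) ∧
      (∀ k : Fin q, gate β none (some k) = ∅)) ∧
    -- the higher level `F_β(v_1)` between `β₃` and `q`
    (∀ β ∈ Set.Ioo (beta3 q) (q : ℝ),
      height q β < heightV1 q β ∧
      ∃ C : Set (Fin q → ℝ),
        components (sublevel q β (heightV1 q β)) = {well β none, C} ∧
        well β none ≠ C ∧ U1 q β ⊆ C ∧
        closure (well β none) ∩ closure C = V1 q β ∧
        ∀ x ∈ V1 q β, IsSaddlePoint β x) := by
  refine ⟨⟨betaS_one_lt_two hq, (beta3_spec hq).1, fun β hβ => heightV1_lt_heightU2 hq hβ.1 hβ.2,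
    heightV1_eq_heightU2 hq, fun β hβ => heightU2_lt_heightV1 hq hβ.1 hβ.2⟩,
    (beta3_spec hq).2.1, ?_, ?_, ?_, ?_⟩
  · rintro β ⟨h1, h2⟩
    have hβq := h2.trans (beta3_spec hq).2.1
    exact ⟨wells_nonempty hq h1 h2.le, pairwise_disjoint_wells hq h1 hβq,
      fun k l hkl => gate_some_some_eq_empty hq h1 h2 hkl, gate_none_some hq h1 h2.le⟩
  · rintro β rfl
    have h1 := beta1_lt_beta3 hq
    exact ⟨wells_nonempty hq h1 le_rfl, pairwise_disjoint_wells hq h1 (beta3_spec hq).2.1,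
      fun k l hkl => gate_some_some hq le_rfl hkl, gate_none_some hq h1 le_rfl⟩
  · intro β hβ
    have hβ : beta3 q < β := hβ
    exact ⟨well_some_nonempty hq hβ.le,
      fun k l hkl => disjoint_wells hq ((beta1_lt_beta3 hq).trans hβ) hkl,
      fun k l hkl => gate_some_some hq hβ.le hkl, gate_none_some_eq_empty hq hβ⟩
  · rintro β ⟨h1, h2⟩
    have hβ := (beta1_lt_beta3 hq).trans h1
    obtain ⟨k, -⟩ := exists_ne_ne hq
    refine ⟨height_lt_heightV1 hq h1 h2, _, components_heightV1 hq h1 h2 k, ?_, ?_,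
      closure_inter_closure_component hq h1 h2 k, ?_⟩
    · intro h
      have hp := pPoint_mem_well hq hβ h2
      obtain ⟨j, hj⟩ := component_subset_outerRegion hq hβ h2 k (h ▸ hp)
      exact lt_asymm hj (pPoint_mem_centralRegion hq hβ h2 j)
    · rintro _ ⟨l, rfl⟩
      exact u1Point_mem_component hq h1 h2 k l
    · rintro _ ⟨l, rfl⟩
      exact isSaddlePoint_v1Point hq hβ h2 l
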